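/- Let $\gamma:\mathbb{R}\to\mathbb{R}^2$ be an injective $C^3$ arc-length parametrization of a curve $\Gamma$, let $\nu(s)$ be the unit normal such that $(\gamma'(s),\nu(s))$ is a positively oriented orthonormal basis, and let $\kappa$ be the signed curvature, $\gamma''=\kappa\nu$. Assume that $\kappa(s)\to0$ as $s\to\pm\infty$ and $\kappa'\in L^\infty(\mathbb{R})$. Let $0<\varepsilon<(2\|\kappa\|_{L^\infty})^{-1}$ (the right-hand side being $+\infty$ if $\kappa\equiv0$), let $m\ge0$, put $\mathrm{Str}:=\mathbb{R}\times(-1,1)$ and $\Phi_\varepsilon(s,t):=\gamma(s)+\varepsilon t\,\nu(s)$, assume that $\Phi_\varepsilon$ is injective on $\mathrm{Str}$, and let $\Omega_\varepsilon:=\Phi_\varepsilon(\mathrm{Str})$. With the Pauli matrices $$\sigma_1=\begin{pmatrix}0&1\\1&0\end{pmatrix},\quad \sigma_2=\begin{pmatrix}0&-i\\i&0\end{pmatrix},\quad \sigma_3=\begin{pmatrix}1&0\\0&-1\end{pmatrix},\quad \sigma\cdot x=\sigma_1x_1+\sigma_2x_2,$$ let $\mathcal{D}_\Gamma(\varepsilon,m)$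 be the operator in $L^2(\Omega_\varepsilon,\mathbb{C}^2)$ given by $$\mathcal{D}_\Gamma(\varepsilon,m)u:=-i\,\sigma\cdot\nabla u+m\sigma_3u,\qquad \mathrm{dom}\,\mathcal{D}_\Gamma(\varepsilon,m):=\{u\in H^1(\Omega_\varepsilon,\mathbb{C}^2):\ -i\sigma_3\,(\sigma\cdot\nu_\varepsilon)\,u=u\ \text{on }\partial\Omega_\varepsilon\},$$ where the boundary condition is understood in the sense of traces on the two sides $s\mapsto\gamma(s)\pm\varepsilon\nu(s)$ of $\Omega_\varepsilon$, whose outward unit normal is $\nu_\varepsilon=\pm\nu(s)$. Then $\mathcal{D}_\Gamma(\varepsilon,m)$ is unitarily equivalent to the operator $\mathcal{E}_\Gamma(\varepsilon,m)$ in $L^2(\mathrm{Str},\mathbb{C}^2)$ defined by $$\mathcal{E}_\Gamma(\varepsilon,m):=\frac{1}{1-\varepsilon t\kappa}(-i\sigma_1)\partial_s+\frac1\varepsilon(-i\sigma_2)\partial_t+\frac{\varepsilon t\kappa'}{2(1-\varepsilon t\kappa)^2}(-i\sigma_1)+m\sigma_3,$$ $$\mathrm{dom}\,\mathcal{E}_\Gamma(\varepsilon,m):=\{u=(u_1,u_2)^\top\in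 H^1(\mathrm{Str},\mathbb{C}^2):\ u_2(\cdot,\pm1)=\mp u_1(\cdot,\pm1)\}.$$ More precisely, there are a function $\theta:\mathbb{R}\to\mathbb{R}$ with $\theta'=\kappa$ and $\nu_1+i\nu_2=e^{i\theta}$, and a unitary map $W:L^2(\Omega_\varepsilon,\mathbb{C}^2)\to L^2(\mathrm{Str},\mathbb{C}^2)$ such that, for almost every $(s,t)\in\mathrm{Str}$, $$(Wu)(s,t)=\sqrt{\varepsilon(1-\varepsilon t\kappa(s))}\begin{pmatrix}e^{i(\pi/4+\theta(s)/2)}&0\\0&-e^{-i(\pi/4+\theta(s)/2)}\end{pmatrix}u(\Phi_\varepsilon(s,t)),$$ and $\mathcal{E}_\Gamma(\varepsilon,m)=W\,\mathcal{D}_\Gamma(\varepsilon,m)\,W^{-1}$, with equality of domains. -/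

import Mathlib

open MeasureTheory Set Filter Topology
open scoped ContDiff

noncomputable section

namespace DiracWaveguide

/-! ### Spinors and Pauli matrices -/

/-- The spinor space `ℂ²` with its Hermitian norm. -/
abbrev Spinor : Type := EuclideanSpace ℂ (Fin 2)

/-- The Pauli matrix `σ₁`. -/
def σ₁ : Matrix (Fin 2) (Fin 2) ℂ := !![0, 1; 1, 0]

/-- The Pauli matrix `σ₂`. -/
def σ₂ : Matrix (Fin 2) (Fin 2) ℂ := !![0, -Complex.I; Complex.I, 0]

/-- The Pauli matrix `σ₃`. -/
def σ₃ : Matrix (Fin 2) (Fin 2) ℂ := !![1, 0; 0, -1]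

/-- `σ · x = σ₁ x₁ + σ₂ x₂` for `x ∈ ℝ²`. -/
def sigmaDot (x : ℝ × ℝ) : Matrix (Fin 2) (Fin 2) ℂ := (x.1 : ℂ) • σ₁ + (x.2 : ℂ) • σ₂

/-- A `2 × 2` matrix acting on spinors. -/
def act (M : Matrix (Fin 2) (Fin 2) ℂ) : Spinor →L[ℂ] Spinor :=
  Matrix.toEuclideanCLM (n := Fin 2) (𝕜 := ℂ) M

/-! ### Function spaces on open subsets of the plane

The plane is `ℝ × ℝ`; its `volume` is the two-dimensional Lebesgue measure. -/

/-- The Hilbert space `L²(Ω, ℂ²)`. -/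
abbrev L2 (Ω : TopologicalSpace.Opens (ℝ × ℝ)) : Type :=
  Lp Spinor 2 (volume.restrict (Ω : Set (ℝ × ℝ)))

/-- A constant matrix acting pointwise on `L²(Ω, ℂ²)`. -/
def matOp (Ω : TopologicalSpace.Opens (ℝ × ℝ)) (M : Matrix (Fin 2) (Fin 2) ℂ) :
    L2 Ω →L[ℂ] L2 Ω :=
  (act M).compLpL 2 (volume.restrict (Ω : Set (ℝ × ℝ)))

/-- Multiplication by an essentially bounded scalar function on `L²(Ω, ℂ²)`. -/
def mulOp {Ω : TopologicalSpace.Opens (ℝ × ℝ)} (a : ℝ × ℝ → ℂ)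
    (ha : MemLp a ⊤ (volume.restrict (Ω : Set (ℝ × ℝ)))) : L2 Ω →L[ℂ] L2 Ω :=
  (ContinuousLinearMap.lsmul ℂ ℂ).holderL (volume.restrict (Ω : Set (ℝ × ℝ))) ⊤ 2 2 (ha.toLp a)

/-- `v ∈ L²(Ω, ℂ²)` is the weak derivative of `u ∈ L²(Ω, ℂ²)` in the direction `e`. -/
def IsWeakDeriv (Ω : TopologicalSpace.Opens (ℝ × ℝ)) (e : ℝ × ℝ) (u v : L2 Ω) : Prop :=
  ∀ φ : ℝ × ℝ → ℝ, ContDiff ℝ ∞ φ → HasCompactSupport φ → tsupport φ ⊆ (Ω : Set (ℝ × ℝ)) →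
    ∫ x in (Ω : Set (ℝ × ℝ)), fderiv ℝ φ x e • u x = -∫ x in (Ω : Set (ℝ × ℝ)), φ x • v x

theorem integrable_smul_L2 {Ω : TopologicalSpace.Opens (ℝ × ℝ)} {φ : ℝ × ℝ → ℝ}
    (hφ : Continuous φ) (hc : HasCompactSupport φ) (u : L2 Ω) :
    Integrable (fun x => φ x • u x) (volume.restrict (Ω : Set (ℝ × ℝ))) := by
  have h1 : MemLp φ 2 (volume.restrict (Ω : Set (ℝ × ℝ))) := hφ.memLp_of_hasCompactSupport hc
  exact memLp_one_iff_integrable.1 ((Lp.memLp u).smul (r := 1) h1)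

theorem integrable_fderiv_smul_L2 {Ω : TopologicalSpace.Opens (ℝ × ℝ)} {φ : ℝ × ℝ → ℝ}
    (hφ : ContDiff ℝ ∞ φ) (hc : HasCompactSupport φ) (e : ℝ × ℝ) (u : L2 Ω) :
    Integrable (fun x => fderiv ℝ φ x e • u x) (volume.restrict (Ω : Set (ℝ × ℝ))) :=
  integrable_smul_L2 ((hφ.continuous_fderiv (by simp)).clm_apply continuous_const)
    (hc.fderiv_apply (𝕜 := ℝ) e) u

theorem IsWeakDeriv.add {Ω : TopologicalSpace.Opens (ℝ × ℝ)} {e : ℝ × ℝ} {u u' v v' : L2 Ω}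
    (h : IsWeakDeriv Ω e u v) (h' : IsWeakDeriv Ω e u' v') :
    IsWeakDeriv Ω e (u + u') (v + v') := by
  intro φ h1 h2 h3
  have e1 : ∫ x in (Ω : Set (ℝ × ℝ)), fderiv ℝ φ x e • (u + u') x =
      ∫ x in (Ω : Set (ℝ × ℝ)), (fderiv ℝ φ x e • u x + fderiv ℝ φ x e • u' x) := by
    apply integral_congr_ae
    filter_upwards [Lp.coeFn_add u u'] with x hx
    rw [hx, Pi.add_apply, smul_add]
  have e2 : ∫ x in (Ω : Set (ℝ × ℝ)), φ x • (v + v') x =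
      ∫ x in (Ω : Set (ℝ × ℝ)), (φ x • v x + φ x • v' x) := by
    apply integral_congr_ae
    filter_upwards [Lp.coeFn_add v v'] with x hx
    rw [hx, Pi.add_apply, smul_add]
  rw [e1, e2, integral_add (integrable_fderiv_smul_L2 h1 h2 e u)
    (integrable_fderiv_smul_L2 h1 h2 e u'), integral_add (integrable_smul_L2 h1.continuous h2 v)
    (integrable_smul_L2 h1.continuous h2 v'), h φ h1 h2 h3, h' φ h1 h2 h3, neg_add]

theorem IsWeakDeriv.smul {Ω : TopologicalSpace.Opens (ℝ × ℝ)} {e : ℝ × ℝ} {u v : L2 Ω}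
    (c : ℂ) (h : IsWeakDeriv Ω e u v) : IsWeakDeriv Ω e (c • u) (c • v) := by
  intro φ h1 h2 h3
  have e1 : ∫ x in (Ω : Set (ℝ × ℝ)), fderiv ℝ φ x e • (c • u) x =
      ∫ x in (Ω : Set (ℝ × ℝ)), c • (fderiv ℝ φ x e • u x) := by
    apply integral_congr_ae
    filter_upwards [Lp.coeFn_smul c u] with x hx
    rw [hx, Pi.smul_apply, smul_comm]
  have e2 : ∫ x in (Ω : Set (ℝ × ℝ)), φ x • (c • v) x =
      ∫ x in (Ω : Set (ℝ × ℝ)), c • (φ x • v x) := by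
    apply integral_congr_ae
    filter_upwards [Lp.coeFn_smul c v] with x hx
    rw [hx, Pi.smul_apply, smul_comm]
  rw [e1, e2, integral_smul, integral_smul, h φ h1 h2 h3, smul_neg]

theorem IsWeakDeriv.zero (Ω : TopologicalSpace.Opens (ℝ × ℝ)) (e : ℝ × ℝ) :
    IsWeakDeriv Ω e 0 0 := by
  intro φ h1 h2 h3
  have e1 : ∫ x in (Ω : Set (ℝ × ℝ)), fderiv ℝ φ x e • (0 : L2 Ω) x = 0 := by
    apply integral_eq_zero_of_ae
    filter_upwards [Lp.coeFn_zero Spinor 2 (volume.restrict (Ω : Set (ℝ × ℝ)))] with x hx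
    rw [hx, Pi.zero_apply, smul_zero]
  have e2 : ∫ x in (Ω : Set (ℝ × ℝ)), φ x • (0 : L2 Ω) x = 0 := by
    apply integral_eq_zero_of_ae
    filter_upwards [Lp.coeFn_zero Spinor 2 (volume.restrict (Ω : Set (ℝ × ℝ)))] with x hx
    rw [hx, Pi.zero_apply, smul_zero]
  rw [e1, e2, neg_zero]

/-- Weak derivatives are unique. -/
theorem IsWeakDeriv.unique {Ω : TopologicalSpace.Opens (ℝ × ℝ)} {e : ℝ × ℝ} {u v v' : L2 Ω}
    (h : IsWeakDeriv Ω e u v) (h' : IsWeakDeriv Ω e u v') : v = v' := by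
  have hd : ∀ᵐ x ∂volume, x ∈ (Ω : Set (ℝ × ℝ)) → (v x - v' x) = 0 := by
    apply Ω.isOpen.ae_eq_zero_of_integral_contDiff_smul_eq_zero
    · apply locallyIntegrableOn_of_locallyIntegrable_restrict
      exact ((Lp.memLp v).sub (Lp.memLp v')).locallyIntegrable (by norm_num)
    · intro φ h1 h2 h3
      have e0 : ∫ x, φ x • (v x - v' x) = ∫ x in (Ω : Set (ℝ × ℝ)), φ x • (v x - v' x) := by
        symm
        apply setIntegral_eq_integral_of_forall_compl_eq_zero
        intro x hx
        rw [image_eq_zero_of_notMem_tsupport (fun hh => hx (h3 hh)), zero_smul]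
      rw [e0]
      simp_rw [smul_sub]
      rw [integral_sub (integrable_smul_L2 h1.continuous h2 v)
        (integrable_smul_L2 h1.continuous h2 v'), sub_eq_zero, ← neg_inj,
        ← h φ h1 h2 h3, ← h' φ h1 h2 h3]
  apply Lp.ext
  filter_upwards [(ae_restrict_iff' Ω.isOpen.measurableSet).2 hd] with x hx
  exact sub_eq_zero.1 hx

/-- The weak derivative in the direction `e` as an unbounded operator in `L²(Ω, ℂ²)`, defined on
all `u` that have a weak derivative in `L²(Ω, ℂ²)`. -/
def weakDeriv (Ω : TopologicalSpace.Opens (ℝ × ℝ)) (e : ℝ × ℝ) : L2 Ω →ₗ.[ℂ] L2 Ω where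
  domain :=
    { carrier := {u | ∃ v, IsWeakDeriv Ω e u v}
      add_mem' := fun ⟨v, hv⟩ ⟨w, hw⟩ => ⟨v + w, hv.add hw⟩
      zero_mem' := ⟨0, IsWeakDeriv.zero Ω e⟩
      smul_mem' := fun c _ ⟨v, hv⟩ => ⟨c • v, hv.smul c⟩ }
  toFun :=
    { toFun := fun u => Classical.choose u.2
      map_add' := fun u w => (Classical.choose_spec (u + w).2).unique
        ((Classical.choose_spec u.2).add (Classical.choose_spec w.2))
      map_smul' := fun c u => (Classical.choose_spec (c • u).2).unique
        ((Classical.choose_spec u.2).smul c) }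

theorem weakDeriv_spec {Ω : TopologicalSpace.Opens (ℝ × ℝ)} {e : ℝ × ℝ}
    (u : (weakDeriv Ω e).domain) : IsWeakDeriv Ω e u (weakDeriv Ω e u) :=
  Classical.choose_spec u.2

/-- The Sobolev space `H¹(Ω, ℂ²)`, as a subspace of `L²(Ω, ℂ²)`. -/
def H1 (Ω : TopologicalSpace.Opens (ℝ × ℝ)) : Submodule ℂ (L2 Ω) :=
  (weakDeriv Ω (1, 0)).domain ⊓ (weakDeriv Ω (0, 1)).domain

/-- The derivative in the first variable, `H¹(Ω, ℂ²) → L²(Ω, ℂ²)`. -/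
def pd₁ (Ω : TopologicalSpace.Opens (ℝ × ℝ)) : H1 Ω →ₗ[ℂ] L2 Ω :=
  (weakDeriv Ω (1, 0)).toFun ∘ₗ Submodule.inclusion inf_le_left

/-- The derivative in the second variable, `H¹(Ω, ℂ²) → L²(Ω, ℂ²)`. -/
def pd₂ (Ω : TopologicalSpace.Opens (ℝ × ℝ)) : H1 Ω →ₗ[ℂ] L2 Ω :=
  (weakDeriv Ω (0, 1)).toFun ∘ₗ Submodule.inclusion inf_le_right

/-- `g ∈ L²(ℝ, ℂ²)` is the trace of `u` on the boundary curve `s ↦ b s` of `Ω`, taken from the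
side into which the unit normals `n s` point: for a representative of `u`, the restrictions to the
parallel curves `s ↦ b s + r n(s)` converge to `g` in `L²(ℝ, ℂ²)` as `r → 0⁺`. -/
def HasTrace (Ω : TopologicalSpace.Opens (ℝ × ℝ)) (b n : ℝ → ℝ × ℝ) (u : L2 Ω)
    (g : Lp Spinor 2 (volume : Measure ℝ)) : Prop :=
  ∃ w : ℝ × ℝ → Spinor, StronglyMeasurable w ∧ w =ᵐ[volume.restrict (Ω : Set (ℝ × ℝ))] u ∧
    Tendsto (fun r : ℝ => eLpNorm (fun s : ℝ => w (b s + r • n s) - g s) 2 volume)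
      (𝓝[>] 0) (𝓝 0)

theorem HasTrace.add {Ω : TopologicalSpace.Opens (ℝ × ℝ)} {b n : ℝ → ℝ × ℝ}
    (hb : Measurable b) (hn : Measurable n) {u u' : L2 Ω}
    {g g' : Lp Spinor 2 (volume : Measure ℝ)}
    (h : HasTrace Ω b n u g) (h' : HasTrace Ω b n u' g') :
    HasTrace Ω b n (u + u') (g + g') := by
  obtain ⟨w, hw, hwu, hl⟩ := h
  obtain ⟨w', hw', hwu', hl'⟩ := h'
  refine ⟨w + w', hw.add hw', ?_, ?_⟩
  · filter_upwards [hwu, hwu', Lp.coeFn_add u u'] with x h1 h2 h3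
    rw [h3, Pi.add_apply, Pi.add_apply, h1, h2]
  · have hs := hl.add hl'
    rw [add_zero] at hs
    refine tendsto_of_tendsto_of_tendsto_of_le_of_le tendsto_const_nhds hs
      (fun _ => zero_le) (fun r => ?_)
    have hm : Measurable (fun s => b s + r • n s) := hb.add (hn.const_smul r)
    have e1 : eLpNorm (fun s : ℝ => (w + w') (b s + r • n s) - (g + g') s) 2 volume =
        eLpNorm ((fun s : ℝ => w (b s + r • n s) - g s) +
          fun s : ℝ => w' (b s + r • n s) - g' s) 2 volume := by
      apply eLpNorm_congr_ae
      filter_upwards [Lp.coeFn_add g g'] with s hs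
      rw [hs]
      simp only [Pi.add_apply]
      abel
    rw [e1]
    exact eLpNorm_add_le
      ((hw.comp_measurable hm).aestronglyMeasurable.sub (Lp.aestronglyMeasurable g))
      ((hw'.comp_measurable hm).aestronglyMeasurable.sub (Lp.aestronglyMeasurable g'))
      (by norm_num)

theorem HasTrace.smul {Ω : TopologicalSpace.Opens (ℝ × ℝ)} {b n : ℝ → ℝ × ℝ} {u : L2 Ω}
    {g : Lp Spinor 2 (volume : Measure ℝ)} (c : ℂ) (h : HasTrace Ω b n u g) :
    HasTrace Ω b n (c • u) (c • g) := by
  obtain ⟨w, hw, hwu, hl⟩ := h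
  refine ⟨c • w, hw.const_smul c, ?_, ?_⟩
  · filter_upwards [hwu, Lp.coeFn_smul c u] with x h1 h2
    rw [h2, Pi.smul_apply, Pi.smul_apply, h1]
  · have hs := ENNReal.Tendsto.const_mul (a := ‖c‖ₑ) hl (Or.inr (by simp))
    rw [mul_zero] at hs
    refine hs.congr (fun r => ?_)
    rw [← eLpNorm_const_smul]
    apply eLpNorm_congr_ae
    filter_upwards [Lp.coeFn_smul c g] with s hs
    rw [hs]
    simp only [Pi.smul_apply, smul_sub]

theorem HasTrace.zero (Ω : TopologicalSpace.Opens (ℝ × ℝ)) (b n : ℝ → ℝ × ℝ) :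
    HasTrace Ω b n 0 0 := by
  refine ⟨0, stronglyMeasurable_zero, (Lp.coeFn_zero _ _ _).symm, ?_⟩
  refine tendsto_const_nhds.congr (fun r => ?_)
  symm
  rw [← eLpNorm_zero (μ := (volume : Measure ℝ)) (p := 2) (ε := Spinor)]
  apply eLpNorm_congr_ae
  filter_upwards [Lp.coeFn_zero Spinor 2 (volume : Measure ℝ)] with s hs
  rw [hs]
  simp

/-! ### Geometry of the waveguide -/

/-- The normal `ν`, such that `(γ', ν)` is positively oriented and orthonormal when `γ` has unit
speed. -/
def normal (γ : ℝ → ℝ × ℝ) (s : ℝ) : ℝ × ℝ := (-(deriv γ s).2, (deriv γ s).1)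

/-- The signed curvature `κ`, i.e. the component of `γ''` along the normal. -/
def curvature (γ : ℝ → ℝ × ℝ) (s : ℝ) : ℝ :=
  (deriv (deriv γ) s).1 * (normal γ s).1 + (deriv (deriv γ) s).2 * (normal γ s).2

/-- The fixed strip `ℝ × (-1, 1)`. -/
def strip : TopologicalSpace.Opens (ℝ × ℝ) :=
  ⟨univ ×ˢ Ioo (-1) 1, isOpen_univ.prod isOpen_Ioo⟩

/-- The tubular coordinates `Φ_ε (s, t) = γ(s) + ε t ν(s)`. -/
def tubeMap (γ : ℝ → ℝ × ℝ) (ε : ℝ) (p : ℝ × ℝ) : ℝ × ℝ := γ p.1 + (ε * p.2) • normal γ p.1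

/-- The standing hypotheses on the base curve `γ` and on the half-width `ε`. -/
structure IsWaveguide (γ : ℝ → ℝ × ℝ) (ε : ℝ) : Prop where
  /-- The parametrization is of class `C³`. -/
  contDiff : ContDiff ℝ 3 γ
  /-- The parametrization is by arc length. -/
  unit_speed : ∀ s, (deriv γ s).1 ^ 2 + (deriv γ s).2 ^ 2 = 1
  injective : Function.Injective γ
  curvature_atTop : Tendsto (curvature γ) atTop (𝓝 0)
  curvature_atBot : Tendsto (curvature γ) atBot (𝓝 0)
  deriv_curvature : MemLp (deriv (curvature γ)) ⊤ volume
  tube_injOn : InjOn (tubeMap γ ε) strip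
  eps_pos : 0 < ε
  /-- `ε < (2 ‖κ‖_∞)⁻¹`, the right-hand side being `+∞` when `κ = 0`. -/
  eps_lt : 2 * ε * (⨆ s, |curvature γ s|) < 1

namespace IsWaveguide

variable {γ : ℝ → ℝ × ℝ} {ε : ℝ}

theorem contDiff_deriv (h : IsWaveguide γ ε) : ContDiff ℝ 2 (deriv γ) :=
  (contDiff_succ_iff_deriv.1 (show ContDiff ℝ (2 + 1) γ from h.contDiff)).2.2

theorem contDiff_deriv_deriv (h : IsWaveguide γ ε) : ContDiff ℝ 1 (deriv (deriv γ)) :=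
  (contDiff_succ_iff_deriv.1 (show ContDiff ℝ (1 + 1) (deriv γ) from h.contDiff_deriv)).2.2

theorem contDiff_normal (h : IsWaveguide γ ε) : ContDiff ℝ 2 (normal γ) :=
  h.contDiff_deriv.snd.neg.prodMk h.contDiff_deriv.fst

theorem contDiff_curvature (h : IsWaveguide γ ε) : ContDiff ℝ 1 (curvature γ) := by
  have h1 : ContDiff ℝ 1 (normal γ) := h.contDiff_normal.of_le (by norm_num)
  exact (h.contDiff_deriv_deriv.fst.mul h1.fst).add (h.contDiff_deriv_deriv.snd.mul h1.snd)

theorem bddAbove_curvature (h : IsWaveguide γ ε) :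
    BddAbove (range fun s => |curvature γ s|) := by
  have hc : Continuous (curvature γ) := h.contDiff_curvature.continuous
  have hz : Tendsto (curvature γ) (cocompact ℝ) (𝓝 0) := by
    rw [cocompact_eq_atBot_atTop]
    exact h.curvature_atBot.sup h.curvature_atTop
  let f : ZeroAtInftyContinuousMap ℝ ℝ := ⟨⟨curvature γ, hc⟩, hz⟩
  obtain ⟨C, hC⟩ := (ZeroAtInftyContinuousMap.isBounded_range f).exists_norm_le
  refine ⟨C, ?_⟩
  rintro _ ⟨s, rfl⟩
  exact hC _ ⟨s, rfl⟩

/-- The Jacobian factor `1 - ε t κ(s)` is at least `1/2` on the strip. -/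
theorem half_le (h : IsWaveguide γ ε) {p : ℝ × ℝ} (hp : p ∈ strip) :
    1 / 2 ≤ 1 - ε * p.2 * curvature γ p.1 := by
  have h1 : |curvature γ p.1| ≤ ⨆ s, |curvature γ s| := le_ciSup h.bddAbove_curvature p.1
  have h2 : |p.2| ≤ 1 := abs_le.2 ⟨hp.2.1.le, hp.2.2.le⟩
  have h3 : ε * p.2 * curvature γ p.1 ≤ ε * |curvature γ p.1| := by
    have e1 : p.2 * curvature γ p.1 ≤ |p.2| * |curvature γ p.1| := by
      rw [← abs_mul]; exact le_abs_self _
    have e2 : |p.2| * |curvature γ p.1| ≤ 1 * |curvature γ p.1| :=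
      mul_le_mul_of_nonneg_right h2 (abs_nonneg _)
    have := mul_le_mul_of_nonneg_left (e1.trans e2) h.eps_pos.le
    linarith
  have h4 := mul_le_mul_of_nonneg_left h1 h.eps_pos.le
  have h5 := h.eps_lt
  linarith

theorem contDiff_tubeMap (h : IsWaveguide γ ε) : ContDiff ℝ 2 (tubeMap γ ε) := by
  have h1 : ContDiff ℝ 2 γ := h.contDiff.of_le (by norm_num)
  exact (h1.comp contDiff_fst).add
    ((contDiff_const.mul contDiff_snd).smul (h.contDiff_normal.comp contDiff_fst))

theorem isOpen_tube (h : IsWaveguide γ ε) : IsOpen (tubeMap γ ε '' strip) := by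
  rw [isOpen_iff_mem_nhds]
  rintro _ ⟨p, hp, rfl⟩
  have hs : HasStrictFDerivAt (tubeMap γ ε) (fderiv ℝ (tubeMap γ ε) p) p :=
    h.contDiff_tubeMap.contDiffAt.hasStrictFDerivAt (by norm_num)
  have hγ : HasDerivAt γ (deriv γ p.1) p.1 :=
    (h.contDiff.differentiable (by norm_num) p.1).hasDerivAt
  have hγ' : HasDerivAt (deriv γ) (deriv (deriv γ) p.1) p.1 :=
    (h.contDiff_deriv.differentiable (by norm_num) p.1).hasDerivAt
  have hν : HasDerivAt (normal γ)
      (-(deriv (deriv γ) p.1).2, (deriv (deriv γ) p.1).1) p.1 :=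
    ((hasFDerivAt_snd (𝕜 := ℝ)).comp_hasDerivAt p.1 hγ').neg.prodMk
      ((hasFDerivAt_fst (𝕜 := ℝ)).comp_hasDerivAt p.1 hγ')
  have hd : ∀ x y : ℝ, fderiv ℝ (tubeMap γ ε) p (x, y) =
      x • deriv γ p.1 + ((ε * p.2) • x •
        ((-(deriv (deriv γ) p.1).2, (deriv (deriv γ) p.1).1) : ℝ × ℝ) +
        (ε * y) • normal γ p.1) := by
    intro x y
    have k1 := hγ.hasFDerivAt.comp p (hasFDerivAt_fst (𝕜 := ℝ) (p := p))
    have k2 := hν.hasFDerivAt.comp p (hasFDerivAt_fst (𝕜 := ℝ) (p := p))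
    have k3 := (hasFDerivAt_snd (𝕜 := ℝ) (p := p)).const_mul ε
    have k := k1.add (k3.smul k2)
    have := k.fderiv
    change fderiv ℝ (tubeMap γ ε) p = _ at this
    rw [this]
    simp
  have hsurj : (fderiv ℝ (tubeMap γ ε) p).range = ⊤ := by
    rw [LinearMap.range_eq_top]
    rintro ⟨a, b⟩
    have hu := h.unit_speed p.1
    have hJ : 1 - ε * p.2 * curvature γ p.1 ≠ 0 := by
      have := h.half_le hp
      linarith
    have hε := h.eps_pos.ne'
    set c := (deriv γ p.1).1 with hc
    set d := (deriv γ p.1).2 with hd'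
    set A := (deriv (deriv γ) p.1).1 with hA
    set B := (deriv (deriv γ) p.1).2 with hB
    have hk : curvature γ p.1 = A * (-d) + B * c := rfl
    set J := 1 - ε * p.2 * curvature γ p.1 with hJd
    have hJ' : J = (c - ε * p.2 * B) * c + (d + ε * p.2 * A) * d := by
      rw [hJd, hk]; linear_combination -hu
    refine ⟨((a * c + b * d) / J,
      ((c - ε * p.2 * B) * b - (d + ε * p.2 * A) * a) / (ε * J)), ?_⟩
    rw [ContinuousLinearMap.coe_coe, hd]
    have hn : normal γ p.1 = (-d, c) := rfl
    rw [hn]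
    ext
    · simp only [Prod.fst_add, Prod.smul_fst, smul_eq_mul, ← hc]
      field_simp
      rw [hJ']
      ring
    · simp only [Prod.snd_add, Prod.smul_snd, smul_eq_mul, ← hd']
      field_simp
      rw [hJ']
      ring
  rw [← hs.map_nhds_eq_of_surj hsurj]
  exact image_mem_map (strip.isOpen.mem_nhds hp)

end IsWaveguide

/-- The tubular neighbourhood `Ω_ε = {γ(s) + ε t ν(s) : s ∈ ℝ, |t| < 1}`. -/
def tube {γ : ℝ → ℝ × ℝ} {ε : ℝ} (h : IsWaveguide γ ε) : TopologicalSpace.Opens (ℝ × ℝ) :=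
  ⟨tubeMap γ ε '' strip, h.isOpen_tube⟩

/-! ### The Dirac operator in the waveguide -/

/-- The domain of the Dirac operator with infinite mass boundary conditions: all
`u ∈ H¹(Ω_ε, ℂ²)` with `-i σ₃ (σ · ν_ε) u = u` on the boundary. The boundary consists of the two
sides `s ↦ γ(s) + τ ε ν(s)`, `τ = ±1`, on which the outward unit normal `ν_ε` is `τ ν(s)`. -/
def diracDomain {γ : ℝ → ℝ × ℝ} {ε : ℝ} (h : IsWaveguide γ ε) : Submodule ℂ (L2 (tube h)) where
  carrier := {u | u ∈ H1 (tube h) ∧ ∀ τ ∈ ({1, -1} : Set ℝ),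
    ∃ g, HasTrace (tube h) (fun s => γ s + (τ * ε) • normal γ s) (fun s => -τ • normal γ s) u g ∧
      ∀ᵐ s, act (-Complex.I • (σ₃ * sigmaDot (τ • normal γ s))) (g s) = g s}
  add_mem' := by
    rintro u u' ⟨hu, ht⟩ ⟨hu', ht'⟩
    refine ⟨add_mem hu hu', fun τ hτ => ?_⟩
    obtain ⟨g, hg, hb⟩ := ht τ hτ
    obtain ⟨g', hg', hb'⟩ := ht' τ hτ
    have hν : Continuous (normal γ) := h.contDiff_normal.continuous
    have hb₀ : Measurable fun s => γ s + (τ * ε) • normal γ s :=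
      (h.contDiff.continuous.add (hν.const_smul (τ * ε))).measurable
    have hn₀ : Measurable fun s => -τ • normal γ s := (hν.const_smul (-τ)).measurable
    refine ⟨g + g', hg.add hb₀ hn₀ hg', ?_⟩
    filter_upwards [hb, hb', Lp.coeFn_add g g'] with s h1 h2 h3
    rw [h3, Pi.add_apply, map_add, h1, h2]
  zero_mem' := by
    refine ⟨zero_mem _, fun τ _ => ⟨0, HasTrace.zero _ _ _, ?_⟩⟩
    filter_upwards [Lp.coeFn_zero Spinor 2 (volume : Measure ℝ)] with s hs
    rw [hs, Pi.zero_apply, map_zero]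
  smul_mem' := by
    rintro c u ⟨hu, ht⟩
    refine ⟨Submodule.smul_mem _ c hu, fun τ hτ => ?_⟩
    obtain ⟨g, hg, hb⟩ := ht τ hτ
    refine ⟨c • g, hg.smul c, ?_⟩
    filter_upwards [hb, Lp.coeFn_smul c g] with s h1 h2
    rw [h2, Pi.smul_apply, map_smul, h1]

/-- The Dirac operator `D_Γ(ε, m) u = -i σ · ∇ u + m σ₃ u` in `L²(Ω_ε, ℂ²)`. -/
def diracOp {γ : ℝ → ℝ × ℝ} {ε : ℝ} (h : IsWaveguide γ ε) (m : ℝ) :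
    L2 (tube h) →ₗ.[ℂ] L2 (tube h) where
  domain := diracDomain h
  toFun :=
    ((matOp (tube h) (-Complex.I • σ₁)).toLinearMap ∘ₗ pd₁ (tube h) +
      (matOp (tube h) (-Complex.I • σ₂)).toLinearMap ∘ₗ pd₂ (tube h) +
      (m : ℂ) • (matOp (tube h) σ₃).toLinearMap ∘ₗ (H1 (tube h)).subtype) ∘ₗ
    Submodule.inclusion (fun _ hu => hu.1)

/-! ### The straightened operator -/

/-- The coefficient `1 / (1 - ε t κ)`. -/
def coeffA (γ : ℝ → ℝ × ℝ) (ε : ℝ) (p : ℝ × ℝ) : ℂ :=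
  ((1 / (1 - ε * p.2 * curvature γ p.1) : ℝ) : ℂ)

/-- The coefficient `ε t κ' / (2 (1 - ε t κ)²)`. -/
def coeffB (γ : ℝ → ℝ × ℝ) (ε : ℝ) (p : ℝ × ℝ) : ℂ :=
  ((ε * p.2 * deriv (curvature γ) p.1 / (2 * (1 - ε * p.2 * curvature γ p.1) ^ 2) : ℝ) : ℂ)

theorem memLp_coeffA {γ : ℝ → ℝ × ℝ} {ε : ℝ} (h : IsWaveguide γ ε) :
    MemLp (coeffA γ ε) ⊤ (volume.restrict (strip : Set (ℝ × ℝ))) := by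
  have hκ : Measurable fun p : ℝ × ℝ => curvature γ p.1 :=
    h.contDiff_curvature.continuous.measurable.comp measurable_fst
  have hm : Measurable (coeffA γ ε) := by
    unfold coeffA
    fun_prop
  refine memLp_top_of_bound hm.aestronglyMeasurable 2 ?_
  filter_upwards [ae_restrict_mem strip.isOpen.measurableSet] with p hp
  have := h.half_le hp
  rw [coeffA, Complex.norm_real, Real.norm_eq_abs, abs_of_pos (by positivity), div_le_iff₀]
  · linarith
  · linarith

theorem memLp_coeffB {γ : ℝ → ℝ × ℝ} {ε : ℝ} (h : IsWaveguide γ ε) :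
    MemLp (coeffB γ ε) ⊤ (volume.restrict (strip : Set (ℝ × ℝ))) := by
  have hκ : Measurable fun p : ℝ × ℝ => curvature γ p.1 :=
    h.contDiff_curvature.continuous.measurable.comp measurable_fst
  have hκ' : Measurable fun p : ℝ × ℝ => deriv (curvature γ) p.1 :=
    (measurable_deriv _).comp measurable_fst
  have hm : Measurable (coeffB γ ε) := by
    unfold coeffB
    fun_prop
  set C := (eLpNormEssSup (deriv (curvature γ)) volume).toReal with hC
  have hfin : eLpNormEssSup (deriv (curvature γ)) volume < ⊤ := by
    simpa [eLpNorm_exponent_top] using h.deriv_curvature.2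
  have hb : ∀ᵐ s : ℝ, |deriv (curvature γ) s| ≤ C := by
    filter_upwards [ae_le_eLpNormEssSup (f := deriv (curvature γ)) (μ := volume)] with s hs
    have := ENNReal.toReal_mono hfin.ne hs
    simpa using this
  have hb' : ∀ᵐ p : ℝ × ℝ, |deriv (curvature γ) p.1| ≤ C :=
    Measure.quasiMeasurePreserving_fst.ae hb
  refine memLp_top_of_bound hm.aestronglyMeasurable (2 * ε * C) ?_
  filter_upwards [ae_restrict_mem strip.isOpen.measurableSet, ae_restrict_of_ae hb'] with p hp hd
  have h0 := h.half_le hp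
  have hε := h.eps_pos
  have h2 : |p.2| ≤ 1 := abs_le.2 ⟨hp.2.1.le, hp.2.2.le⟩
  have h3 : 1 / 2 ≤ 2 * (1 - ε * p.2 * curvature γ p.1) ^ 2 := by nlinarith
  rw [coeffB, Complex.norm_real, Real.norm_eq_abs, abs_div, abs_mul, abs_mul, abs_of_pos hε,
    abs_of_pos (by linarith : 0 < 2 * (1 - ε * p.2 * curvature γ p.1) ^ 2),
    div_le_iff₀ (by linarith)]
  have hC0 : 0 ≤ C := ENNReal.toReal_nonneg
  have e1 : ε * |p.2| * |deriv (curvature γ) p.1| ≤ ε * 1 * C := by gcongr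
  have e2 : 2 * ε * C * (1 / 2) ≤ 2 * ε * C * (2 * (1 - ε * p.2 * curvature γ p.1) ^ 2) := by
    gcongr
  linarith

/-- The domain of the straightened operator: all `u = (u₁, u₂) ∈ H¹(ℝ × (-1, 1), ℂ²)` with
`u₂(·, ±1) = ∓ u₁(·, ±1)`. Spinor components are indexed by `0` and `1`. -/
def stripDomain : Submodule ℂ (L2 strip) where
  carrier := {u | u ∈ H1 strip ∧ ∀ τ ∈ ({1, -1} : Set ℝ),
    ∃ g, HasTrace strip (fun s => (s, τ)) (fun _ => (0, -τ)) u g ∧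
      ∀ᵐ s, g s 1 = -(τ : ℂ) * g s 0}
  add_mem' := by
    rintro u u' ⟨hu, ht⟩ ⟨hu', ht'⟩
    refine ⟨add_mem hu hu', fun τ hτ => ?_⟩
    obtain ⟨g, hg, hb⟩ := ht τ hτ
    obtain ⟨g', hg', hb'⟩ := ht' τ hτ
    refine ⟨g + g', hg.add (by fun_prop) measurable_const hg', ?_⟩
    filter_upwards [hb, hb', Lp.coeFn_add g g'] with s h1 h2 h3
    rw [h3, Pi.add_apply, PiLp.add_apply, PiLp.add_apply, h1, h2, mul_add]
  zero_mem' := by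
    refine ⟨zero_mem _, fun τ _ => ⟨0, HasTrace.zero _ _ _, ?_⟩⟩
    filter_upwards [Lp.coeFn_zero Spinor 2 (volume : Measure ℝ)] with s hs
    rw [hs]
    simp
  smul_mem' := by
    rintro c u ⟨hu, ht⟩
    refine ⟨Submodule.smul_mem _ c hu, fun τ hτ => ?_⟩
    obtain ⟨g, hg, hb⟩ := ht τ hτ
    refine ⟨c • g, hg.smul c, ?_⟩
    filter_upwards [hb, Lp.coeFn_smul c g] with s h1 h2
    rw [h2, Pi.smul_apply, PiLp.smul_apply, PiLp.smul_apply, h1, smul_eq_mul, smul_eq_mul]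
    ring

/-- The operator
`E_Γ(ε, m) = (1 - ε t κ)⁻¹ (-i σ₁) ∂_s + ε⁻¹ (-i σ₂) ∂_t
  + ε t κ' / (2 (1 - ε t κ)²) (-i σ₁) + m σ₃` in `L²(ℝ × (-1, 1), ℂ²)`. -/
def straightOp {γ : ℝ → ℝ × ℝ} {ε : ℝ} (h : IsWaveguide γ ε) (m : ℝ) :
    L2 strip →ₗ.[ℂ] L2 strip where
  domain := stripDomain
  toFun :=
    ((mulOp (coeffA γ ε) (memLp_coeffA h)).toLinearMap ∘ₗ
        (matOp strip (-Complex.I • σ₁)).toLinearMap ∘ₗ pd₁ strip +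
      ((1 / ε : ℝ) : ℂ) • (matOp strip (-Complex.I • σ₂)).toLinearMap ∘ₗ pd₂ strip +
      (mulOp (coeffB γ ε) (memLp_coeffB h)).toLinearMap ∘ₗ
        (matOp strip (-Complex.I • σ₁)).toLinearMap ∘ₗ (H1 strip).subtype +
      (m : ℂ) • (matOp strip σ₃).toLinearMap ∘ₗ (H1 strip).subtype) ∘ₗ
    Submodule.inclusion (fun _ hu => hu.1)

/-! ### Unitary equivalence -/

/-- The unitary map `W` conjugates the unbounded operator `A` into `B`: `B = W A W⁻¹`, with
equality of domains. -/
def Conjugates {H K : Type*} [NormedAddCommGroup H] [InnerProductSpace ℂ H]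
    [NormedAddCommGroup K] [InnerProductSpace ℂ K]
    (W : H ≃ₗᵢ[ℂ] K) (A : H →ₗ.[ℂ] H) (B : K →ₗ.[ℂ] K) : Prop :=
  (∀ u : H, u ∈ A.domain ↔ W u ∈ B.domain) ∧
    ∀ (u : A.domain) (v : B.domain), (v : K) = W u → B v = W (A u)

/-- The gauge matrix
`U_θ = diag (exp (i (π/4 + θ/2)), -exp (-i (π/4 + θ/2)))`. -/
def gaugeMatrix (θ : ℝ) : Matrix (Fin 2) (Fin 2) ℂ :=
  !![Complex.exp (Complex.I * (Real.pi / 4 + θ / 2)), 0;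
    0, -Complex.exp (-(Complex.I * (Real.pi / 4 + θ / 2)))]

/-- The metric weight `g(s, t) = ε (1 - ε t κ(s))`, the Jacobian of the tubular coordinates. -/
def weight (γ : ℝ → ℝ × ℝ) (ε : ℝ) (p : ℝ × ℝ) : ℝ := ε * (1 - ε * p.2 * curvature γ p.1)

end DiracWaveguide

end

open DiracWaveguide

open MeasureTheory Set Filter Topology
open scoped ContDiff Convolution

noncomputable section

namespace DiracWaveguide

/-! ### Weak derivatives tested against `C¹` functions -/

/-! The Frenet equations γ'' = κν and ν' = -κγ' show that the differential of Φ sends ∂_s to Jγ' and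
∂_t to εν, where J = 1 - εtκ. Its determinant is εJ, which is positive on the strip, so composition
with Φ followed by multiplication by √(εJ) is unitary (`eLpNorm_straightenFun`,
`straightenIsometry_surjective`). The diagonal gauge is unitary at every point and preserves this.

In the coordinates (s, t) the operator -iσ·∇ becomes J⁻¹(-iσ·γ')∂_s + ε⁻¹(-iσ·ν)∂_t. With θ the
angle of ν, the quotient of the two gauge entries is γ'₁ + iγ'₂ (`gaugeCoeff_zero_eq`). Conjugation
by the gauge therefore turns σ·γ' into σ₁ and σ·ν into σ₂ and leaves σ₃ fixed. Differentiating the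
factor √(εJ) times the gauge adds zeroth-order terms (`fderiv_tubeFactor`). The s-derivative of √J
produces the coefficient with κ'. The half angle θ/2 and the t-derivative of √J each produce a
multiple of σ₂ κ/(2J), with opposite signs, and these cancel (`straightOp_straighten`).

Equality of domains has two parts. For H¹, weak derivatives must survive the change of variables and
the multiplication by the factor. The Jacobian and the factor are only known to be C¹, so weak
derivatives are first tested against complex C¹ functions (`IsWeakDeriv.test_C1`,
`WeakPartial.mul`). The chain rule is obtained by duality from the divergence identity in tubular
coordinates (`setIntegral_strip_div`, `weakPartial_of_comp_tubeMap`). The bounds on κ, κ' and J⁻¹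
keep all terms in L².

For the boundary condition, √(εJ) converges uniformly in s at each side and the gauge does not
depend on t. Traces therefore correspond in both directions (`hasTrace_straighten`,
`hasTrace_of_straighten`). The gauge takes -iσ₃(σ·τν) to -τσ₁, whose eigenvalue equation is u₂ =
-τu₁ (`boundary_condition_iff`). -/

/-- A compactly supported `C¹` function can be approximated in `C¹` by smooth functions whose
supports stay in a fixed compact subset of a given open set. -/
theorem exists_smooth_approx {U : Set (ℝ × ℝ)} (hU : IsOpen U) {φ : ℝ × ℝ → ℝ}
    (hφ : ContDiff ℝ 1 φ) (hc : HasCompactSupport φ) (hs : tsupport φ ⊆ U) :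
    ∃ K, IsCompact K ∧ K ⊆ U ∧ tsupport φ ⊆ K ∧ ∀ η > 0, ∃ ψ : ℝ × ℝ → ℝ, ContDiff ℝ ∞ ψ ∧
      tsupport ψ ⊆ K ∧ (∀ x, ‖ψ x - φ x‖ ≤ η) ∧ ∀ x, ‖fderiv ℝ ψ x - fderiv ℝ φ x‖ ≤ η := by
  have hcK : IsCompact (tsupport φ) := hc
  obtain ⟨δ, hδ, hδU⟩ := hcK.exists_cthickening_subset_open hU hs
  -- The compact set is fixed before η, so that later errors are η times integrals over one and the
  -- same set.
  refine ⟨Metric.cthickening δ (tsupport φ), hcK.cthickening, hδU,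
    Metric.self_subset_cthickening _, fun η hη => ?_⟩
  have hdc : Continuous (fderiv ℝ φ) := hφ.continuous_fderiv (by simp)
  obtain ⟨δ₁, hδ₁, h₁⟩ := Metric.uniformContinuous_iff.1
    (hc.uniformContinuous_of_continuous hφ.continuous) η hη
  obtain ⟨δ₂, hδ₂, h₂⟩ := Metric.uniformContinuous_iff.1
    ((hc.fderiv (𝕜 := ℝ)).uniformContinuous_of_continuous hdc) η hη
  -- This mollification radius keeps the support inside the thickening and makes the oscillation of
  -- both φ and its derivative at most η on each ball of averaging.
  set r := min δ (min δ₁ δ₂) with hr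
  have hr0 : 0 < r := lt_min hδ (lt_min hδ₁ hδ₂)
  let b : ContDiffBump (0 : ℝ × ℝ) := ⟨r / 2, r, half_pos hr0, half_lt_self hr0⟩
  have hbi : LocallyIntegrable (b.normed volume) (volume : Measure (ℝ × ℝ)) :=
    (b.contDiff_normed (n := 0)).continuous.locallyIntegrable
  have hd : ∀ x, fderiv ℝ (b.normed volume ⋆[ContinuousLinearMap.lsmul ℝ ℝ, volume] φ) x =
      (b.normed volume ⋆[ContinuousLinearMap.lsmul ℝ ℝ, volume] fderiv ℝ φ) x := fun x =>
    (hc.hasFDerivAt_convolution_right (ContinuousLinearMap.lsmul ℝ ℝ) hbi hφ x).fderiv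
  refine ⟨b.normed volume ⋆[ContinuousLinearMap.lsmul ℝ ℝ, volume] φ,
    b.hasCompactSupport_normed.contDiff_convolution_left _ b.contDiff_normed
      hφ.continuous.locallyIntegrable, ?_, fun x => ?_, fun x => ?_⟩
  · refine closure_minimal ?_ Metric.isClosed_cthickening
    refine (support_convolution_subset (ContinuousLinearMap.lsmul ℝ ℝ)).trans ?_
    rintro _ ⟨y, hy, z, hz, rfl⟩
    rw [b.support_normed_eq] at hy
    refine Metric.mem_cthickening_of_dist_le _ z _ _ (subset_tsupport _ hz) ?_
    have : ‖y‖ < r := by simpa using hy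
    simpa [dist_eq_norm] using this.le.trans (min_le_left _ _)
  · rw [← dist_eq_norm]
    refine b.dist_normed_convolution_le hφ.continuous.aestronglyMeasurable fun y hy => (h₁ ?_).le
    exact (Metric.mem_ball.1 hy).trans_le ((min_le_right _ _).trans (min_le_left _ _))
  · rw [hd, ← dist_eq_norm]
    refine b.dist_normed_convolution_le hdc.aestronglyMeasurable fun y hy => (h₂ ?_).le
    exact (Metric.mem_ball.1 hy).trans_le ((min_le_right _ _).trans (min_le_right _ _))

theorem locallyIntegrableOn_L2 {Ω : TopologicalSpace.Opens (ℝ × ℝ)} (u : L2 Ω) :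
    LocallyIntegrableOn u (Ω : Set (ℝ × ℝ)) :=
  locallyIntegrableOn_of_locallyIntegrable_restrict ((Lp.memLp u).locallyIntegrable (by norm_num))

theorem locallyIntegrableOn_L2_apply {Ω : TopologicalSpace.Opens (ℝ × ℝ)} (u : L2 Ω) (i : Fin 2) :
    LocallyIntegrableOn (fun x => u x i) (Ω : Set (ℝ × ℝ)) :=
  locallyIntegrableOn_of_locallyIntegrable_restrict
    (((Lp.memLp u).eval_piLp i).locallyIntegrable (by norm_num))

/-- Local integrability of `f` suffices, because the integrand lives on the compact set `K`. -/
theorem norm_setIntegral_smul_le {U K : Set (ℝ × ℝ)} (hU : MeasurableSet U) (hK : IsCompact K)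
    (hKU : K ⊆ U) {a : ℝ × ℝ → ℝ} {f : ℝ × ℝ → Spinor} (hf : LocallyIntegrableOn f U) {C : ℝ}
    (ha : ∀ x, ‖a x‖ ≤ C) (hsupp : ∀ x ∉ K, a x = 0) :
    ‖∫ x in U, a x • f x‖ ≤ C * ∫ x in K, ‖f x‖ := by
  have e : ∫ x in U, a x • f x = ∫ x in K, a x • f x := by
    refine setIntegral_eq_of_subset_of_forall_sdiff_eq_zero hU hKU fun x hx => ?_
    rw [hsupp x hx.2, zero_smul]
  rw [e, ← integral_const_mul]
  refine norm_integral_le_of_norm_le (((hf.integrableOn_compact_subset hKU hK).norm).const_mul C)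
    (Eventually.of_forall fun x => ?_)
  rw [norm_smul]
  exact mul_le_mul_of_nonneg_right (ha x) (norm_nonneg _)

/-- The defect of the identity for φ equals the defect for φ - ψ with ψ a smooth approximant, hence
is at most η times a constant that depends only on `K`, `u`, `v` and `e`. The extension is needed
because the Jacobian and the other factors put on test functions later are merely C¹. -/
theorem IsWeakDeriv.test_C1 {Ω : TopologicalSpace.Opens (ℝ × ℝ)} {e : ℝ × ℝ} {u v : L2 Ω}
    (h : IsWeakDeriv Ω e u v) {φ : ℝ × ℝ → ℝ} (hφ : ContDiff ℝ 1 φ) (hc : HasCompactSupport φ)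
    (hs : tsupport φ ⊆ (Ω : Set (ℝ × ℝ))) :
    ∫ x in (Ω : Set (ℝ × ℝ)), fderiv ℝ φ x e • u x = -∫ x in (Ω : Set (ℝ × ℝ)), φ x • v x := by
  obtain ⟨K, hK, hKU, hφK, happ⟩ := exists_smooth_approx Ω.isOpen hφ hc hs
  rw [← sub_eq_zero, sub_neg_eq_add, ← norm_le_zero_iff]
  set A := ‖e‖ * (∫ x in K, ‖u x‖) + ∫ x in K, ‖v x‖ with hA
  have hbound : ∀ η > 0, ‖(∫ x in (Ω : Set (ℝ × ℝ)), fderiv ℝ φ x e • u x) +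
      ∫ x in (Ω : Set (ℝ × ℝ)), φ x • v x‖ ≤ η * A := by
    intro η hη
    obtain ⟨ψ, hψ, hψK, h0, h1⟩ := happ η hη
    have hψc : HasCompactSupport ψ := hK.of_isClosed_subset (isClosed_tsupport _) hψK
    have key := h ψ hψ hψc (hψK.trans hKU)
    have i1 : Integrable (fun x => fderiv ℝ φ x e • u x)
        (volume.restrict (Ω : Set (ℝ × ℝ))) :=
      integrable_smul_L2 ((hφ.continuous_fderiv (by simp)).clm_apply continuous_const)
        (hc.fderiv_apply (𝕜 := ℝ) e) u
    have i2 := integrable_fderiv_smul_L2 hψ hψc e u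
    have i3 := integrable_smul_L2 hφ.continuous hc v
    have i4 := integrable_smul_L2 hψ.continuous hψc v
    have e1 : (∫ x in (Ω : Set (ℝ × ℝ)), fderiv ℝ φ x e • u x) +
        ∫ x in (Ω : Set (ℝ × ℝ)), φ x • v x =
        (∫ x in (Ω : Set (ℝ × ℝ)), (fderiv ℝ φ x e - fderiv ℝ ψ x e) • u x) +
        ∫ x in (Ω : Set (ℝ × ℝ)), (φ x - ψ x) • v x := by
      simp_rw [sub_smul]
      rw [integral_sub i1 i2, integral_sub i3 i4, key]
      abel
    have hz : ∀ {f : ℝ × ℝ → ℝ}, tsupport f ⊆ K → ∀ x ∉ K, f x = 0 ∧ fderiv ℝ f x = 0 := by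
      intro f hf x hx
      have hx' : x ∉ tsupport f := fun hh => hx (hf hh)
      exact ⟨image_eq_zero_of_notMem_tsupport hx',
        image_eq_zero_of_notMem_tsupport fun hh => hx' (tsupport_fderiv_subset ℝ hh)⟩
    rw [e1]
    refine (norm_add_le _ _).trans ?_
    have b1 := norm_setIntegral_smul_le Ω.isOpen.measurableSet hK hKU (locallyIntegrableOn_L2 u)
      (a := fun x => fderiv ℝ φ x e - fderiv ℝ ψ x e) (C := η * ‖e‖) (fun x => by
        rw [← sub_apply]
        refine (ContinuousLinearMap.le_opNorm _ _).trans ?_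
        rw [norm_sub_rev]
        exact mul_le_mul_of_nonneg_right (h1 x) (norm_nonneg _))
      (fun x hx => by simp [(hz hφK x hx).2, (hz hψK x hx).2])
    have b2 := norm_setIntegral_smul_le Ω.isOpen.measurableSet hK hKU (locallyIntegrableOn_L2 v)
      (a := fun x => φ x - ψ x) (C := η) (fun x => by rw [norm_sub_rev]; exact h0 x)
      (fun x hx => by simp [(hz hφK x hx).1, (hz hψK x hx).1])
    rw [hA]
    linarith
  have hlim : Tendsto (fun η : ℝ => η * A) (𝓝[>] 0) (𝓝 0) := by
    have : Tendsto (fun η : ℝ => η * A) (𝓝 0) (𝓝 (0 * A)) := tendsto_id.mul_const A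
    rw [zero_mul] at this
    exact this.mono_left nhdsWithin_le_nhds
  exact ge_of_tendsto hlim (eventually_mem_nhdsWithin.mono hbound)

/-! ### Scalar weak derivatives and the product rule -/

/-- `g` is the weak derivative of `f` in the direction `e` on `Ω`, tested against complex `C¹`
functions with compact support. -/
def WeakPartial (Ω : TopologicalSpace.Opens (ℝ × ℝ)) (e : ℝ × ℝ) (f g : ℝ × ℝ → ℂ) : Prop :=
  ∀ φ : ℝ × ℝ → ℂ, ContDiff ℝ 1 φ → HasCompactSupport φ → tsupport φ ⊆ (Ω : Set (ℝ × ℝ)) →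
    ∫ x in (Ω : Set (ℝ × ℝ)), fderiv ℝ φ x e * f x = -∫ x in (Ω : Set (ℝ × ℝ)), φ x * g x

theorem integrableOn_mul_of_tsupport_subset {U : Set (ℝ × ℝ)} {φ f : ℝ × ℝ → ℂ}
    (hφ : Continuous φ) (hc : HasCompactSupport φ) (hs : tsupport φ ⊆ U)
    (hf : LocallyIntegrableOn f U) : IntegrableOn (fun x => φ x * f x) U := by
  have h1 : IntegrableOn (fun x => φ x * f x) (tsupport φ) :=
    (hf.integrableOn_compact_subset hs hc).continuousOn_mul hφ.continuousOn hc
  refine ((integrableOn_iff_integrable_of_support_subset ?_).1 h1).integrableOn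
  exact (Function.support_mul_subset_left _ _).trans (subset_tsupport _)

/-- Real and imaginary parts of φ are tested separately and one spinor component is read off.
Complex test functions are wanted because the product rule moves a complex multiplier onto the test
function. -/
theorem IsWeakDeriv.weakPartial {Ω : TopologicalSpace.Opens (ℝ × ℝ)} {e : ℝ × ℝ} {u v : L2 Ω}
    (h : IsWeakDeriv Ω e u v) (i : Fin 2) : WeakPartial Ω e (fun x => u x i) (fun x => v x i) := by
  have real_test : ∀ φ : ℝ × ℝ → ℝ, ContDiff ℝ 1 φ → HasCompactSupport φ →
      tsupport φ ⊆ (Ω : Set (ℝ × ℝ)) →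
      ∫ x in (Ω : Set (ℝ × ℝ)), ((fderiv ℝ φ x e : ℝ) : ℂ) * u x i =
        -∫ x in (Ω : Set (ℝ × ℝ)), ((φ x : ℝ) : ℂ) * v x i := by
    intro φ hφ hc hs
    have key := congrArg (fun w : Spinor => w i) (h.test_C1 hφ hc hs)
    have i1 : Integrable (fun x => fderiv ℝ φ x e • u x) (volume.restrict (Ω : Set (ℝ × ℝ))) :=
      integrable_smul_L2 ((hφ.continuous_fderiv (by simp)).clm_apply continuous_const)
        (hc.fderiv_apply (𝕜 := ℝ) e) u
    have i2 := integrable_smul_L2 hφ.continuous hc v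
    simp only [PiLp.neg_apply] at key
    rw [eval_integral_piLp (fun j => i1.eval_piLp j),
      eval_integral_piLp (fun j => i2.eval_piLp j)] at key
    simpa using key
  intro φ hφ hc hs
  have hre : ContDiff ℝ 1 fun x => (φ x).re := Complex.reCLM.contDiff.comp hφ
  have him : ContDiff ℝ 1 fun x => (φ x).im := Complex.imCLM.contDiff.comp hφ
  have hd := hφ.differentiable (by simp)
  have sre : tsupport (fun x => (φ x).re) ⊆ tsupport φ := by
    refine closure_mono fun x hx hx' => hx (by simp [hx'])
  have sim : tsupport (fun x => (φ x).im) ⊆ tsupport φ := by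
    refine closure_mono fun x hx hx' => hx (by simp [hx'])
  have cre : HasCompactSupport fun x => (φ x).re := hc.of_isClosed_subset (isClosed_tsupport _) sre
  have cim : HasCompactSupport fun x => (φ x).im := hc.of_isClosed_subset (isClosed_tsupport _) sim
  have dre : ∀ x, fderiv ℝ (fun x => (φ x).re) x e = (fderiv ℝ φ x e).re := fun x => by
    have := (Complex.reCLM.hasFDerivAt.comp x (hd x).hasFDerivAt).fderiv
    change fderiv ℝ (fun x => (φ x).re) x = _ at this
    rw [this]; rfl
  have dim : ∀ x, fderiv ℝ (fun x => (φ x).im) x e = (fderiv ℝ φ x e).im := fun x => by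
    have := (Complex.imCLM.hasFDerivAt.comp x (hd x).hasFDerivAt).fderiv
    change fderiv ℝ (fun x => (φ x).im) x = _ at this
    rw [this]; rfl
  have kre := real_test _ hre cre (sre.trans hs)
  have kim := real_test _ him cim (sim.trans hs)
  have lu := locallyIntegrableOn_L2_apply u i
  have lv := locallyIntegrableOn_L2_apply v i
  have cast_int : ∀ {a : ℝ × ℝ → ℝ} {f : ℝ × ℝ → ℂ}, Continuous a → HasCompactSupport a →
      tsupport a ⊆ (Ω : Set (ℝ × ℝ)) → LocallyIntegrableOn f (Ω : Set (ℝ × ℝ)) →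
      IntegrableOn (fun x => ((a x : ℝ) : ℂ) * f x) (Ω : Set (ℝ × ℝ)) := by
    intro a f ha hca hsa hf
    have hst : tsupport (fun x => ((a x : ℝ) : ℂ)) ⊆ tsupport a :=
      closure_mono fun x hx hx' => hx (by simp [hx'])
    exact integrableOn_mul_of_tsupport_subset (Complex.continuous_ofReal.comp ha)
      (hca.of_isClosed_subset (isClosed_tsupport _) hst) (hst.trans hsa) hf
  have jre := cast_int ((hre.continuous_fderiv (by simp)).clm_apply continuous_const)
    (cre.fderiv_apply (𝕜 := ℝ) e) ((tsupport_fderiv_apply_subset ℝ e).trans (sre.trans hs)) lu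
  have jim := cast_int ((him.continuous_fderiv (by simp)).clm_apply continuous_const)
    (cim.fderiv_apply (𝕜 := ℝ) e) ((tsupport_fderiv_apply_subset ℝ e).trans (sim.trans hs)) lu
  have lre := cast_int hre.continuous cre (sre.trans hs) lv
  have lim := cast_int him.continuous cim (sim.trans hs) lv
  have e1 : ∀ x, fderiv ℝ φ x e * u x i = ((fderiv ℝ (fun x => (φ x).re) x e : ℝ) : ℂ) * u x i +
      Complex.I * (((fderiv ℝ (fun x => (φ x).im) x e : ℝ) : ℂ) * u x i) := fun x => by
    rw [dre, dim]
    nth_rewrite 1 [← Complex.re_add_im (fderiv ℝ φ x e)]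
    ring
  have e2 : ∀ x, φ x * v x i = (((φ x).re : ℝ) : ℂ) * v x i +
      Complex.I * ((((φ x).im : ℝ) : ℂ) * v x i) := fun x => by
    nth_rewrite 1 [← Complex.re_add_im (φ x)]
    ring
  simp_rw [e1, e2]
  rw [integral_add jre (jim.const_mul _), integral_add lre (lim.const_mul _),
    integral_const_mul, integral_const_mul, kre, kim]
  ring

theorem isWeakDeriv_of_weakPartial {Ω : TopologicalSpace.Opens (ℝ × ℝ)} {e : ℝ × ℝ} {u v : L2 Ω}
    (h : ∀ i, WeakPartial Ω e (fun x => u x i) (fun x => v x i)) : IsWeakDeriv Ω e u v := by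
  intro φ hφ hc hs
  have i1 := integrable_fderiv_smul_L2 hφ hc e u
  have i2 := integrable_smul_L2 hφ.continuous hc v
  have hd := hφ.differentiable (by simp)
  have hst : tsupport (fun x => ((φ x : ℝ) : ℂ)) ⊆ tsupport φ :=
    closure_mono fun x hx hx' => hx (by simp [hx'])
  ext i
  rw [PiLp.neg_apply, eval_integral_piLp (fun j => i1.eval_piLp j),
    eval_integral_piLp (fun j => i2.eval_piLp j)]
  have key := h i (fun x => ((φ x : ℝ) : ℂ))
    ((Complex.ofRealCLM.contDiff.comp hφ).of_le (by exact_mod_cast le_top))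
    (hc.of_isClosed_subset (isClosed_tsupport _) hst) (hst.trans hs)
  have hdc : ∀ x, fderiv ℝ (fun x => ((φ x : ℝ) : ℂ)) x e = ((fderiv ℝ φ x e : ℝ) : ℂ) := by
    intro x
    have := (Complex.ofRealCLM.hasFDerivAt.comp x (hd x).hasFDerivAt).fderiv
    change fderiv ℝ (fun x => ((φ x : ℝ) : ℂ)) x = _ at this
    rw [this]; rfl
  simp_rw [hdc] at key
  simpa using key

theorem WeakPartial.congr {Ω : TopologicalSpace.Opens (ℝ × ℝ)} {e : ℝ × ℝ} {f f' g g' : ℝ × ℝ → ℂ}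
    (h : WeakPartial Ω e f g) (hf : f =ᵐ[volume.restrict (Ω : Set (ℝ × ℝ))] f')
    (hg : g =ᵐ[volume.restrict (Ω : Set (ℝ × ℝ))] g') : WeakPartial Ω e f' g' := by
  intro φ h1 h2 h3
  have e1 : ∫ x in (Ω : Set (ℝ × ℝ)), fderiv ℝ φ x e * f' x =
      ∫ x in (Ω : Set (ℝ × ℝ)), fderiv ℝ φ x e * f x :=
    integral_congr_ae (by filter_upwards [hf] with x hx; rw [hx])
  have e2 : ∫ x in (Ω : Set (ℝ × ℝ)), φ x * g' x = ∫ x in (Ω : Set (ℝ × ℝ)), φ x * g x :=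
    integral_congr_ae (by filter_upwards [hg] with x hx; rw [hx])
  rw [e1, e2, h φ h1 h2 h3]

/-- Regularity of `a` outside `U` is irrelevant: near a point off the closed support of φ the
product vanishes identically. -/
theorem contDiff_mul_of_contDiffOn {U : Set (ℝ × ℝ)} (hU : IsOpen U) {φ a : ℝ × ℝ → ℂ}
    (hφ : ContDiff ℝ 1 φ) (hs : tsupport φ ⊆ U) (ha : ContDiffOn ℝ 1 a U) :
    ContDiff ℝ 1 fun x => φ x * a x := by
  refine contDiff_iff_contDiffAt.2 fun x => ?_
  by_cases hx : x ∈ tsupport φ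
  · exact hφ.contDiffAt.mul (ha.contDiffAt (hU.mem_nhds (hs hx)))
  · have h0 : (fun x => φ x * a x) =ᶠ[𝓝 x] fun _ => 0 := by
      filter_upwards [(isClosed_tsupport φ).isOpen_compl.mem_nhds hx] with y hy
      rw [image_eq_zero_of_notMem_tsupport hy, zero_mul]
    exact contDiffAt_const.congr_of_eventuallyEq h0

/-- The product rule for the weak derivative and a `C¹` multiplier. -/
theorem WeakPartial.mul {Ω : TopologicalSpace.Opens (ℝ × ℝ)} {e : ℝ × ℝ} {f g a : ℝ × ℝ → ℂ}
    (h : WeakPartial Ω e f g) (hf : LocallyIntegrableOn f (Ω : Set (ℝ × ℝ)))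
    (hg : LocallyIntegrableOn g (Ω : Set (ℝ × ℝ))) (ha : ContDiffOn ℝ 1 a (Ω : Set (ℝ × ℝ))) :
    WeakPartial Ω e (fun x => a x * f x) (fun x => a x * g x + fderiv ℝ a x e * f x) := by
  intro φ hφ hc hs
  -- The hypothesis is tested against φa; the Leibniz term φ ∂a f then moves to the side of the
  -- derivative.
  have hm := contDiff_mul_of_contDiffOn Ω.isOpen hφ hs ha
  have hst : tsupport (fun x => φ x * a x) ⊆ tsupport φ := tsupport_mul_subset_left
  have hmc : HasCompactSupport (fun x => φ x * a x) := hc.mul_right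
  have key := h _ hm hmc (hst.trans hs)
  have hcl : IsLocallyClosed (Ω : Set (ℝ × ℝ)) := Ω.isOpen.isLocallyClosed
  have hac : ContinuousOn (fun x => fderiv ℝ a x e) (Ω : Set (ℝ × ℝ)) :=
    (ha.continuousOn_fderiv_of_isOpen Ω.isOpen le_rfl).clm_apply continuousOn_const
  have hsd : tsupport (fun x => fderiv ℝ φ x e) ⊆ (Ω : Set (ℝ × ℝ)) :=
    (tsupport_fderiv_apply_subset ℝ e).trans hs
  have i1 := integrableOn_mul_of_tsupport_subset
    ((hφ.continuous_fderiv (by simp)).clm_apply continuous_const)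
    (hc.fderiv_apply (𝕜 := ℝ) e) hsd (hf.continuousOn_mul ha.continuousOn hcl)
  have i2 := integrableOn_mul_of_tsupport_subset hφ.continuous hc hs (hf.continuousOn_mul hac hcl)
  have i3 := integrableOn_mul_of_tsupport_subset hφ.continuous hc hs
    (hg.continuousOn_mul ha.continuousOn hcl)
  have e1 : ∫ x in (Ω : Set (ℝ × ℝ)), fderiv ℝ (fun x => φ x * a x) x e * f x =
      ∫ x in (Ω : Set (ℝ × ℝ)), (fderiv ℝ φ x e * (a x * f x) +
        φ x * (fderiv ℝ a x e * f x)) := by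
    refine setIntegral_congr_fun Ω.isOpen.measurableSet fun x hx => ?_
    have hax : DifferentiableAt ℝ a x :=
      (ha.contDiffAt (Ω.isOpen.mem_nhds hx)).differentiableAt (by simp)
    have hd : fderiv ℝ (fun x => φ x * a x) x = _ :=
      ((hφ.differentiable (by simp) x).hasFDerivAt.mul hax.hasFDerivAt).fderiv
    simp only [hd, add_apply, smul_apply, smul_eq_mul]
    ring
  have e2 : ∫ x in (Ω : Set (ℝ × ℝ)), φ x * (a x * g x + fderiv ℝ a x e * f x) =
      (∫ x in (Ω : Set (ℝ × ℝ)), φ x * (a x * g x)) +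
        ∫ x in (Ω : Set (ℝ × ℝ)), φ x * (fderiv ℝ a x e * f x) := by
    rw [← integral_add i3 i2]
    simp_rw [mul_add]
  rw [e1, integral_add i1 i2] at key
  have e3 : ∫ x in (Ω : Set (ℝ × ℝ)), φ x * a x * g x =
      ∫ x in (Ω : Set (ℝ × ℝ)), φ x * (a x * g x) := by simp_rw [mul_assoc]
  rw [e3] at key
  rw [e2]
  linear_combination key

/-! ### Geometry of tubular coordinates -/

/-- The Jacobian factor `1 - ε t κ(s)`. -/
def jac (γ : ℝ → ℝ × ℝ) (ε : ℝ) (p : ℝ × ℝ) : ℝ := 1 - ε * p.2 * curvature γ p.1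

theorem weight_eq (γ : ℝ → ℝ × ℝ) (ε : ℝ) (p : ℝ × ℝ) : weight γ ε p = ε * jac γ ε p := rfl

/-- The inverse of the tubular coordinates, extended by `0` outside the tube. -/
def tubeInv (γ : ℝ → ℝ × ℝ) (ε : ℝ) : ℝ × ℝ → ℝ × ℝ :=
  open Classical in
  (tubeMap γ ε '' strip).piecewise (Function.invFunOn (tubeMap γ ε) strip) 0

namespace IsWaveguide

variable {γ : ℝ → ℝ × ℝ} {ε : ℝ}

theorem hasDerivAt_curve (h : IsWaveguide γ ε) (s : ℝ) : HasDerivAt γ (deriv γ s) s :=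
  (h.contDiff.differentiable (by norm_num) s).hasDerivAt

/-- Differentiating |γ'|² = 1 gives γ''·γ' = 0, so γ'' equals its normal component. -/
theorem hasDerivAt_deriv (h : IsWaveguide γ ε) (s : ℝ) :
    HasDerivAt (deriv γ) (curvature γ s • normal γ s) s := by
  have h2 : HasDerivAt (deriv γ) (deriv (deriv γ) s) s :=
    (h.contDiff_deriv.differentiable (by norm_num) s).hasDerivAt
  have hx : HasDerivAt (fun s => (deriv γ s).1) (deriv (deriv γ) s).1 s :=
    (hasFDerivAt_fst (𝕜 := ℝ) (p := deriv γ s)).comp_hasDerivAt s h2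
  have hy : HasDerivAt (fun s => (deriv γ s).2) (deriv (deriv γ) s).2 s :=
    (hasFDerivAt_snd (𝕜 := ℝ) (p := deriv γ s)).comp_hasDerivAt s h2
  have hsum := (hx.pow 2).add (hy.pow 2)
  have hconst : (fun s => (deriv γ s).1) ^ 2 + (fun s => (deriv γ s).2) ^ 2 = fun _ => (1 : ℝ) :=
    funext fun s => h.unit_speed s
  rw [hconst] at hsum
  have hz := hsum.unique (hasDerivAt_const s (1 : ℝ))
  have hu := h.unit_speed s
  convert h2 using 1
  simp only [curvature, normal] at *
  ext
  · simp only [Prod.smul_fst, smul_eq_mul]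
    linear_combination (deriv (deriv γ) s).1 * hu - (deriv γ s).1 / 2 * hz
  · simp only [Prod.smul_snd, smul_eq_mul]
    linear_combination (deriv (deriv γ) s).2 * hu - (deriv γ s).2 / 2 * hz

theorem hasDerivAt_normal (h : IsWaveguide γ ε) (s : ℝ) :
    HasDerivAt (normal γ) (-curvature γ s • deriv γ s) s := by
  have h2 := h.hasDerivAt_deriv s
  have h3 : HasDerivAt (normal γ) (-(curvature γ s • normal γ s).2, (curvature γ s • normal γ s).1)
      s := ((hasFDerivAt_snd (𝕜 := ℝ)).comp_hasDerivAt s h2).neg.prodMk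
      ((hasFDerivAt_fst (𝕜 := ℝ)).comp_hasDerivAt s h2)
  convert h3 using 1
  ext <;> simp [normal]

theorem hasFDerivAt_tubeMap (h : IsWaveguide γ ε) (p : ℝ × ℝ) :
    HasFDerivAt (tubeMap γ ε) (fderiv ℝ (tubeMap γ ε) p) p :=
  (h.contDiff_tubeMap.differentiable (by norm_num) p).hasFDerivAt

theorem fderiv_tubeMap (h : IsWaveguide γ ε) (p : ℝ × ℝ) (x y : ℝ) :
    fderiv ℝ (tubeMap γ ε) p (x, y) =
      (jac γ ε p * x) • deriv γ p.1 + (ε * y) • normal γ p.1 := by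
  have k1 := (h.hasDerivAt_curve p.1).hasFDerivAt.comp p (hasFDerivAt_fst (𝕜 := ℝ) (p := p))
  have k2 := (h.hasDerivAt_normal p.1).hasFDerivAt.comp p (hasFDerivAt_fst (𝕜 := ℝ) (p := p))
  have k3 := (hasFDerivAt_snd (𝕜 := ℝ) (p := p)).const_mul ε
  have k := k1.add (k3.smul k2)
  have := k.fderiv
  change fderiv ℝ (tubeMap γ ε) p = _ at this
  rw [this]
  ext <;> simp [jac] <;> ring

/-- The columns are Jγ' and εν, and (γ', ν) is orthonormal and positively oriented. -/
theorem det_fderiv_tubeMap (h : IsWaveguide γ ε) (p : ℝ × ℝ) :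
    (fderiv ℝ (tubeMap γ ε) p).det = weight γ ε p := by
  have e : fderiv ℝ (tubeMap γ ε) p = (Matrix.toLin (Module.Basis.finTwoProd ℝ)
      (Module.Basis.finTwoProd ℝ) !![jac γ ε p * (deriv γ p.1).1, ε * (normal γ p.1).1;
        jac γ ε p * (deriv γ p.1).2, ε * (normal γ p.1).2]).toContinuousLinearMap := by
    refine ContinuousLinearMap.ext fun ⟨x, y⟩ => ?_
    rw [h.fderiv_tubeMap]
    simp only [LinearMap.coe_toContinuousLinearMap', Matrix.toLin_finTwoProd_apply]
    ext
    · simp only [Prod.fst_add, Prod.smul_fst, smul_eq_mul]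
      ring
    · simp only [Prod.snd_add, Prod.smul_snd, smul_eq_mul]
      ring
  rw [e, LinearMap.det_toContinuousLinearMap, LinearMap.det_toLin, Matrix.det_fin_two_of, weight_eq]
  simp only [normal]
  linear_combination ε * jac γ ε p * h.unit_speed p.1

theorem jac_pos (h : IsWaveguide γ ε) {p : ℝ × ℝ} (hp : p ∈ strip) : 0 < jac γ ε p :=
  lt_of_lt_of_le (by norm_num) (h.half_le hp)

theorem weight_pos (h : IsWaveguide γ ε) {p : ℝ × ℝ} (hp : p ∈ strip) : 0 < weight γ ε p :=
  mul_pos h.eps_pos (h.jac_pos hp)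

theorem contDiff_jac (h : IsWaveguide γ ε) : ContDiff ℝ 1 (jac γ ε) :=
  contDiff_const.sub ((contDiff_const.mul contDiff_snd).mul (h.contDiff_curvature.comp contDiff_fst))

theorem continuous_weight (h : IsWaveguide γ ε) : Continuous (weight γ ε) :=
  continuous_const.mul h.contDiff_jac.continuous

theorem tubeInv_eq_invFunOn {x : ℝ × ℝ} (hx : x ∈ tubeMap γ ε '' strip) :
    tubeInv γ ε x = Function.invFunOn (tubeMap γ ε) strip x :=
  if_pos hx

theorem tubeInv_tubeMap (h : IsWaveguide γ ε) {p : ℝ × ℝ} (hp : p ∈ strip) :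
    tubeInv γ ε (tubeMap γ ε p) = p := by
  have hm : tubeMap γ ε p ∈ tubeMap γ ε '' strip := mem_image_of_mem _ hp
  rw [tubeInv_eq_invFunOn hm]
  exact h.tube_injOn.leftInvOn_invFunOn hp

theorem tubeMap_tubeInv {x : ℝ × ℝ} (hx : x ∈ tubeMap γ ε '' strip) :
    tubeMap γ ε (tubeInv γ ε x) = x := by
  rw [tubeInv_eq_invFunOn hx]
  exact Function.invFunOn_eq hx

theorem tubeInv_mem {x : ℝ × ℝ} (hx : x ∈ tubeMap γ ε '' strip) : tubeInv γ ε x ∈ strip := by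
  rw [tubeInv_eq_invFunOn hx]
  exact Function.invFunOn_mem hx

/-- Near Φ(p) the global inverse coincides with the local inverse of the inverse function theorem:
the latter takes values in the strip, where Φ is injective. -/
theorem contDiffOn_tubeInv (h : IsWaveguide γ ε) :
    ContDiffOn ℝ 1 (tubeInv γ ε) (tubeMap γ ε '' strip) := by
  rintro _ ⟨p, hp, rfl⟩
  refine ContDiffAt.contDiffWithinAt ?_
  have hdet : (fderiv ℝ (tubeMap γ ε) p).det ≠ 0 := by
    rw [h.det_fderiv_tubeMap]
    exact (h.weight_pos hp).ne'
  let f' := (fderiv ℝ (tubeMap γ ε) p).toContinuousLinearEquivOfDetNeZero hdet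
  have hf' : HasFDerivAt (tubeMap γ ε) (f' : ℝ × ℝ →L[ℝ] ℝ × ℝ) p := by
    rw [ContinuousLinearMap.coe_toContinuousLinearEquivOfDetNeZero]
    exact h.hasFDerivAt_tubeMap p
  have hc : ContDiffAt ℝ 1 (tubeMap γ ε) p := (h.contDiff_tubeMap.of_le (by norm_num)).contDiffAt
  have hs : HasStrictFDerivAt (tubeMap γ ε) (f' : ℝ × ℝ →L[ℝ] ℝ × ℝ) p :=
    hc.hasStrictFDerivAt' hf' (by simp)
  refine (hc.to_localInverse hf' (by simp)).congr_of_eventuallyEq ?_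
  have ht : Tendsto (hs.localInverse (tubeMap γ ε) f' p) (𝓝 (tubeMap γ ε p)) (𝓝 p) :=
    hs.localInverse_tendsto
  filter_upwards [hs.eventually_right_inverse, ht (strip.isOpen.mem_nhds hp)] with y hy hy'
  nth_rewrite 1 [← hy]
  exact h.tubeInv_tubeMap hy'

theorem measurable_tubeInv (h : IsWaveguide γ ε) : Measurable (tubeInv γ ε) := by
  have hc := h.contDiffOn_tubeInv.continuousOn
  classical
  refine ContinuousOn.measurable_piecewise (hc.congr fun x hx => ?_) continuousOn_const
    h.isOpen_tube.measurableSet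
  exact (tubeInv_eq_invFunOn hx).symm

theorem measurable_tubeMap (h : IsWaveguide γ ε) : Measurable (tubeMap γ ε) :=
  h.contDiff_tubeMap.continuous.measurable

theorem abs_det_fderiv_tubeMap (h : IsWaveguide γ ε) {p : ℝ × ℝ} (hp : p ∈ strip) :
    |(fderiv ℝ (tubeMap γ ε) p).det| = weight γ ε p := by
  rw [h.det_fderiv_tubeMap, abs_of_pos (h.weight_pos hp)]

/-! ### Change of variables and transport of null sets and test functions -/

theorem setIntegral_tube {E : Type*} [NormedAddCommGroup E] [NormedSpace ℝ E]
    (h : IsWaveguide γ ε) (F : ℝ × ℝ → E) :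
    ∫ x in (tube h : Set (ℝ × ℝ)), F x =
      ∫ p in (strip : Set (ℝ × ℝ)), weight γ ε p • F (tubeMap γ ε p) := by
  have := integral_image_eq_integral_abs_det_fderiv_smul volume strip.isOpen.measurableSet
    (fun p _ => (h.hasFDerivAt_tubeMap p).hasFDerivWithinAt) h.tube_injOn F
  refine this.trans (setIntegral_congr_fun strip.isOpen.measurableSet fun p hp => ?_)
  simp only [h.abs_det_fderiv_tubeMap hp]

theorem measurePreserving_tubeMap (h : IsWaveguide γ ε) :
    MeasurePreserving (tubeMap γ ε) ((volume.restrict (strip : Set (ℝ × ℝ))).withDensity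
      fun p => ENNReal.ofReal (weight γ ε p)) (volume.restrict (tube h : Set (ℝ × ℝ))) := by
  refine ⟨h.measurable_tubeMap, ?_⟩
  have := map_withDensity_abs_det_fderiv_eq_addHaar volume
    strip.isOpen.measurableSet.nullMeasurableSet
    (fun p _ => (h.hasFDerivAt_tubeMap p).hasFDerivWithinAt) h.tube_injOn
  rw [← show _ = volume.restrict (tube h : Set (ℝ × ℝ)) from this]
  congr 1
  refine withDensity_congr_ae ?_
  filter_upwards [ae_restrict_mem strip.isOpen.measurableSet] with p hp
  rw [h.abs_det_fderiv_tubeMap hp]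

/-- Positivity of the weight makes Lebesgue measure on the strip absolutely continuous with respect
to the weighted measure. Statements that hold almost everywhere on the tube can thus be read in
tubular coordinates. -/
theorem quasiMeasurePreserving_tubeMap (h : IsWaveguide γ ε) :
    Measure.QuasiMeasurePreserving (tubeMap γ ε) (volume.restrict (strip : Set (ℝ × ℝ)))
      (volume.restrict (tube h : Set (ℝ × ℝ))) := by
  refine ⟨h.measurable_tubeMap, ?_⟩
  rw [← h.measurePreserving_tubeMap.map_eq]
  refine Measure.AbsolutelyContinuous.map (withDensity_absolutelyContinuous'
    h.continuous_weight.measurable.ennreal_ofReal.aemeasurable ?_) h.measurable_tubeMap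
  filter_upwards [ae_restrict_mem strip.isOpen.measurableSet] with p hp
  simpa using h.weight_pos hp

theorem quasiMeasurePreserving_tubeInv (h : IsWaveguide γ ε) :
    Measure.QuasiMeasurePreserving (tubeInv γ ε) (volume.restrict (tube h : Set (ℝ × ℝ)))
      (volume.restrict (strip : Set (ℝ × ℝ))) := by
  refine ⟨h.measurable_tubeInv, ?_⟩
  rw [← h.measurePreserving_tubeMap.map_eq,
    Measure.map_map h.measurable_tubeInv h.measurable_tubeMap]
  have hid : tubeInv γ ε ∘ tubeMap γ ε =ᵐ[(volume.restrict (strip : Set (ℝ × ℝ))).withDensity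
      fun p => ENNReal.ofReal (weight γ ε p)] id := by
    refine (withDensity_absolutelyContinuous _ _).ae_le ?_
    filter_upwards [ae_restrict_mem strip.isOpen.measurableSet] with p hp
    exact h.tubeInv_tubeMap hp
  rw [Measure.map_congr hid, Measure.map_id]
  exact withDensity_absolutelyContinuous _ _

/-- A compactly supported `C¹` function on the strip, transplanted to the tube. -/
theorem exists_pushforward (h : IsWaveguide γ ε) {a : ℝ × ℝ → ℂ}
    (ha : ContDiff ℝ 1 a) (hc : HasCompactSupport a) (hs : tsupport a ⊆ (strip : Set (ℝ × ℝ))) :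
    ∃ b : ℝ × ℝ → ℂ, ContDiff ℝ 1 b ∧ HasCompactSupport b ∧
      tsupport b ⊆ (tube h : Set (ℝ × ℝ)) ∧ ∀ p ∈ strip, b (tubeMap γ ε p) = a p := by
  have hK : IsCompact (tubeMap γ ε '' tsupport a) :=
    IsCompact.image hc h.contDiff_tubeMap.continuous
  have hKT : tubeMap γ ε '' tsupport a ⊆ (tube h : Set (ℝ × ℝ)) := image_mono hs
  -- The cut-off at the edge of the tube does no harm: the support lies in the compact image of the
  -- support of `a`, well inside the tube.
  set b : ℝ × ℝ → ℂ := (tubeMap γ ε '' strip).indicator (a ∘ tubeInv γ ε) with hb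
  have hz : ∀ x ∉ tubeMap γ ε '' tsupport a, b x = 0 := by
    intro x hx
    by_cases hxT : x ∈ tubeMap γ ε '' strip
    · rw [hb, indicator_of_mem hxT]
      exact image_eq_zero_of_notMem_tsupport (f := a) fun hh => hx ⟨_, hh, tubeMap_tubeInv hxT⟩
    · rw [hb, indicator_of_notMem hxT]
  have hts : tsupport b ⊆ tubeMap γ ε '' tsupport a :=
    closure_minimal (fun x hx => by_contra fun hx' => hx (hz x hx')) hK.isClosed
  refine ⟨b, contDiff_iff_contDiffAt.2 fun x => ?_, hK.of_isClosed_subset (isClosed_tsupport _) hts,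
    hts.trans hKT, fun p hp => ?_⟩
  · by_cases hx : x ∈ tubeMap γ ε '' tsupport a
    · have hn := h.isOpen_tube.mem_nhds (hKT hx)
      refine (ha.contDiffAt.comp x (h.contDiffOn_tubeInv.contDiffAt hn)).congr_of_eventuallyEq ?_
      filter_upwards [hn] with y hy
      rw [hb, indicator_of_mem hy]
    · refine contDiffAt_const (c := (0 : ℂ)) |>.congr_of_eventuallyEq ?_
      filter_upwards [hK.isClosed.isOpen_compl.mem_nhds hx] with y hy
      exact hz y hy
  · rw [hb, indicator_of_mem (mem_image_of_mem _ hp), Function.comp_apply, h.tubeInv_tubeMap hp]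

end IsWaveguide

/-! ### Weak derivatives in tubular coordinates -/

theorem hasFDerivAt_ofReal_comp {a : ℝ × ℝ → ℝ} {a' : ℝ × ℝ →L[ℝ] ℝ} {p : ℝ × ℝ}
    (ha : HasFDerivAt a a' p) :
    HasFDerivAt (fun q => ((a q : ℝ) : ℂ)) (Complex.ofRealCLM.comp a') p :=
  Complex.ofRealCLM.hasFDerivAt.comp p ha

theorem hasFDerivAt_ofReal_comp_fst {a : ℝ → ℝ} {a' : ℝ} {p : ℝ × ℝ}
    (ha : HasDerivAt a a' p.1) :
    HasFDerivAt (fun q : ℝ × ℝ => ((a q.1 : ℝ) : ℂ))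
      (Complex.ofRealCLM.comp (a' • ContinuousLinearMap.fst ℝ ℝ ℝ)) p :=
  hasFDerivAt_ofReal_comp (ha.comp_hasFDerivAt p hasFDerivAt_fst)

namespace IsWaveguide

variable {γ : ℝ → ℝ × ℝ} {ε : ℝ}

theorem hasDerivAt_deriv_fst (h : IsWaveguide γ ε) (s : ℝ) :
    HasDerivAt (fun s => (deriv γ s).1) (-(curvature γ s * (deriv γ s).2)) s := by
  have := (hasFDerivAt_fst (𝕜 := ℝ) (p := deriv γ s)).comp_hasDerivAt s (h.hasDerivAt_deriv s)
  exact this.congr_deriv (by simp [normal])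

theorem hasDerivAt_deriv_snd (h : IsWaveguide γ ε) (s : ℝ) :
    HasDerivAt (fun s => (deriv γ s).2) (curvature γ s * (deriv γ s).1) s := by
  have := (hasFDerivAt_snd (𝕜 := ℝ) (p := deriv γ s)).comp_hasDerivAt s (h.hasDerivAt_deriv s)
  exact this.congr_deriv (by simp [normal])

theorem contDiff_deriv_fst (h : IsWaveguide γ ε) : ContDiff ℝ 1 fun s => (deriv γ s).1 :=
  (h.contDiff_deriv.of_le (by norm_num)).fst

theorem contDiff_deriv_snd (h : IsWaveguide γ ε) : ContDiff ℝ 1 fun s => (deriv γ s).2 :=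
  (h.contDiff_deriv.of_le (by norm_num)).snd

theorem hasFDerivAt_jac (h : IsWaveguide γ ε) (p : ℝ × ℝ) :
    HasFDerivAt (jac γ ε) (-((ε * p.2 * deriv (curvature γ) p.1) • ContinuousLinearMap.fst ℝ ℝ ℝ +
      (ε * curvature γ p.1) • ContinuousLinearMap.snd ℝ ℝ ℝ)) p := by
  have hk : HasDerivAt (curvature γ) (deriv (curvature γ) p.1) p.1 :=
    (h.contDiff_curvature.differentiable (by norm_num) p.1).hasDerivAt
  have k1 := hk.comp_hasFDerivAt p (hasFDerivAt_fst (𝕜 := ℝ) (p := p))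
  have k2 := (((hasFDerivAt_snd (𝕜 := ℝ) (p := p)).const_mul ε).mul k1).const_sub 1
  refine HasFDerivAt.congr_fderiv (f := jac γ ε) k2 ?_
  ext <;> simp
  ring

theorem contDiff_ofReal_jac (h : IsWaveguide γ ε) : ContDiff ℝ 1 fun p => ((jac γ ε p : ℝ) : ℂ) :=
  Complex.ofRealCLM.contDiff.comp h.contDiff_jac

theorem continuous_curvature_fst (h : IsWaveguide γ ε) :
    Continuous fun p : ℝ × ℝ => curvature γ p.1 :=
  h.contDiff_curvature.continuous.comp continuous_fst

/-- A compactly supported `C¹` function on the tube, written in tubular coordinates. -/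
theorem exists_pullback (h : IsWaveguide γ ε) {a : ℝ × ℝ → ℂ}
    (ha : ContDiff ℝ 1 a) (hc : HasCompactSupport a) (hs : tsupport a ⊆ (tube h : Set (ℝ × ℝ))) :
    ∃ b : ℝ × ℝ → ℂ, ContDiff ℝ 1 b ∧ HasCompactSupport b ∧
      tsupport b ⊆ (strip : Set (ℝ × ℝ)) ∧ ∀ p ∈ strip, b p = a (tubeMap γ ε p) := by
  have hK : IsCompact (tubeInv γ ε '' tsupport a) :=
    IsCompact.image_of_continuousOn hc (h.contDiffOn_tubeInv.continuousOn.mono hs)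
  have hKT : tubeInv γ ε '' tsupport a ⊆ (strip : Set (ℝ × ℝ)) := by
    rintro _ ⟨x, hx, rfl⟩
    exact tubeInv_mem (hs hx)
  set b : ℝ × ℝ → ℂ := (strip : Set (ℝ × ℝ)).indicator (a ∘ tubeMap γ ε) with hb
  have hz : ∀ p ∉ tubeInv γ ε '' tsupport a, b p = 0 := by
    intro p hp
    by_cases hpT : p ∈ (strip : Set (ℝ × ℝ))
    · rw [hb, indicator_of_mem hpT]
      exact image_eq_zero_of_notMem_tsupport (f := a) fun hh => hp ⟨_, hh, h.tubeInv_tubeMap hpT⟩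
    · rw [hb, indicator_of_notMem hpT]
  have hts : tsupport b ⊆ tubeInv γ ε '' tsupport a :=
    closure_minimal (fun x hx => by_contra fun hx' => hx (hz x hx')) hK.isClosed
  refine ⟨b, contDiff_iff_contDiffAt.2 fun x => ?_, hK.of_isClosed_subset (isClosed_tsupport _) hts,
    hts.trans hKT, fun p hp => by rw [hb, indicator_of_mem hp, Function.comp_apply]⟩
  by_cases hx : x ∈ tubeInv γ ε '' tsupport a
  · have hn := strip.isOpen.mem_nhds (hKT hx)
    have hΦ : ContDiff ℝ 1 (tubeMap γ ε) := h.contDiff_tubeMap.of_le (by norm_num)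
    refine (ha.comp hΦ).contDiffAt.congr_of_eventuallyEq ?_
    filter_upwards [hn] with y hy
    rw [hb, indicator_of_mem hy]
  · refine contDiffAt_const (c := (0 : ℂ)) |>.congr_of_eventuallyEq ?_
    filter_upwards [hK.isClosed.isOpen_compl.mem_nhds hx] with y hy
    exact hz y hy

/-- The chain rule for a function on the tube that agrees with `a` in tubular coordinates. -/
theorem fderiv_comp_tubeMap (h : IsWaveguide γ ε) {a b : ℝ × ℝ → ℂ} (hb : ContDiff ℝ 1 b)
    (hab : ∀ p ∈ strip, b (tubeMap γ ε p) = a p) {p : ℝ × ℝ} (hp : p ∈ strip) :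
    fderiv ℝ a p (1, 0) = jac γ ε p * ((deriv γ p.1).1 * fderiv ℝ b (tubeMap γ ε p) (1, 0) +
        (deriv γ p.1).2 * fderiv ℝ b (tubeMap γ ε p) (0, 1)) ∧
      fderiv ℝ a p (0, 1) = ε * (-(deriv γ p.1).2 * fderiv ℝ b (tubeMap γ ε p) (1, 0) +
        (deriv γ p.1).1 * fderiv ℝ b (tubeMap γ ε p) (0, 1)) := by
  have hd : fderiv ℝ a p = (fderiv ℝ b (tubeMap γ ε p)).comp (fderiv ℝ (tubeMap γ ε) p) := by
    have := ((hb.differentiable (by simp) (tubeMap γ ε p)).hasFDerivAt.comp p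
      (h.hasFDerivAt_tubeMap p)).fderiv
    rw [← this]
    refine Filter.EventuallyEq.fderiv_eq ?_
    filter_upwards [strip.isOpen.mem_nhds hp] with q hq
    exact (hab q hq).symm
  have hlin : ∀ x y : ℝ, fderiv ℝ b (tubeMap γ ε p) (x, y) =
      x * fderiv ℝ b (tubeMap γ ε p) (1, 0) + y * fderiv ℝ b (tubeMap γ ε p) (0, 1) := by
    intro x y
    have : ((x, y) : ℝ × ℝ) = x • (1, 0) + y • (0, 1) := by ext <;> simp
    rw [this, map_add, map_smul, map_smul, Complex.real_smul, Complex.real_smul]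
  constructor
  · rw [hd, ContinuousLinearMap.comp_apply, h.fderiv_tubeMap]
    have : (jac γ ε p * 1) • deriv γ p.1 + (ε * 0) • normal γ p.1 =
        (jac γ ε p * (deriv γ p.1).1, jac γ ε p * (deriv γ p.1).2) := by ext <;> simp
    rw [this, hlin]
    push_cast
    ring
  · rw [hd, ContinuousLinearMap.comp_apply, h.fderiv_tubeMap]
    have : (jac γ ε p * 0) • deriv γ p.1 + (ε * 1) • normal γ p.1 =
        (ε * -(deriv γ p.1).2, ε * (deriv γ p.1).1) := by ext <;> simp [normal]
    rw [this, hlin]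
    push_cast
    ring

theorem setIntegral_tube_complex (h : IsWaveguide γ ε) (F : ℝ × ℝ → ℂ) :
    ∫ x in (tube h : Set (ℝ × ℝ)), F x =
      ∫ p in (strip : Set (ℝ × ℝ)), (weight γ ε p : ℂ) * F (tubeMap γ ε p) := by
  rw [h.setIntegral_tube]
  simp_rw [Complex.real_smul]

/-- The divergence theorem for weak partial derivatives, written in tubular coordinates. -/
theorem setIntegral_strip_div (h : IsWaveguide γ ε) {f g₁ g₂ : ℝ × ℝ → ℂ}
    (hf : LocallyIntegrableOn f (tube h : Set (ℝ × ℝ)))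
    (hg₁ : LocallyIntegrableOn g₁ (tube h : Set (ℝ × ℝ)))
    (hg₂ : LocallyIntegrableOn g₂ (tube h : Set (ℝ × ℝ)))
    (h₁ : WeakPartial (tube h) (1, 0) f g₁) (h₂ : WeakPartial (tube h) (0, 1) f g₂)
    {a₁ a₂ : ℝ × ℝ → ℂ} (ha₁ : ContDiff ℝ 1 a₁) (ha₂ : ContDiff ℝ 1 a₂)
    (hc₁ : HasCompactSupport a₁) (hc₂ : HasCompactSupport a₂)
    (hs₁ : tsupport a₁ ⊆ (strip : Set (ℝ × ℝ))) (hs₂ : tsupport a₂ ⊆ (strip : Set (ℝ × ℝ))) :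
    ∫ p in (strip : Set (ℝ × ℝ)), (ε * ((deriv γ p.1).1 * fderiv ℝ a₁ p (1, 0) +
        (deriv γ p.1).2 * fderiv ℝ a₂ p (1, 0)) +
        jac γ ε p * (-(deriv γ p.1).2 * fderiv ℝ a₁ p (0, 1) +
        (deriv γ p.1).1 * fderiv ℝ a₂ p (0, 1))) * f (tubeMap γ ε p) =
      -∫ p in (strip : Set (ℝ × ℝ)), ε * jac γ ε p *
        (a₁ p * g₁ (tubeMap γ ε p) + a₂ p * g₂ (tubeMap γ ε p)) := by
  obtain ⟨b₁, hb₁, hbc₁, hbs₁, hab₁⟩ := h.exists_pushforward ha₁ hc₁ hs₁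
  obtain ⟨b₂, hb₂, hbc₂, hbs₂, hab₂⟩ := h.exists_pushforward ha₂ hc₂ hs₂
  have k₁ := h₁ b₁ hb₁ hbc₁ hbs₁
  have k₂ := h₂ b₂ hb₂ hbc₂ hbs₂
  have i₁ := integrableOn_mul_of_tsupport_subset
    ((hb₁.continuous_fderiv (by simp)).clm_apply continuous_const)
    (hbc₁.fderiv_apply (𝕜 := ℝ) (1, 0)) ((tsupport_fderiv_apply_subset ℝ _).trans hbs₁) hf
  have i₂ := integrableOn_mul_of_tsupport_subset
    ((hb₂.continuous_fderiv (by simp)).clm_apply continuous_const)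
    (hbc₂.fderiv_apply (𝕜 := ℝ) (0, 1)) ((tsupport_fderiv_apply_subset ℝ _).trans hbs₂) hf
  have j₁ := integrableOn_mul_of_tsupport_subset hb₁.continuous hbc₁ hbs₁ hg₁
  have j₂ := integrableOn_mul_of_tsupport_subset hb₂.continuous hbc₂ hbs₂ hg₂
  have key : ∫ x in (tube h : Set (ℝ × ℝ)),
      (fderiv ℝ b₁ x (1, 0) * f x + fderiv ℝ b₂ x (0, 1) * f x) =
      -∫ x in (tube h : Set (ℝ × ℝ)), (b₁ x * g₁ x + b₂ x * g₂ x) := by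
    rw [integral_add i₁ i₂, integral_add j₁ j₂, k₁, k₂]
    ring
  rw [h.setIntegral_tube_complex, h.setIntegral_tube_complex] at key
  -- For the field b = (b₁, b₂) and a = b ∘ Φ, the chain rule and |γ'| = 1 give εJ div b = ε γ'·∂_s
  -- a + J ν·∂_t a.
  refine Eq.trans ?_ (key.trans (congrArg Neg.neg ?_))
  · refine setIntegral_congr_fun strip.isOpen.measurableSet fun p hp => ?_
    obtain ⟨d₁, d₂⟩ := h.fderiv_comp_tubeMap hb₁ hab₁ hp
    obtain ⟨d₃, d₄⟩ := h.fderiv_comp_tubeMap hb₂ hab₂ hp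
    have hu : (((deriv γ p.1).1 : ℂ)) ^ 2 + ((deriv γ p.1).2 : ℂ) ^ 2 = 1 := by
      exact_mod_cast h.unit_speed p.1
    simp only [d₁, d₂, d₃, d₄, weight_eq, Complex.ofReal_mul]
    linear_combination ε * jac γ ε p * f (tubeMap γ ε p) *
      (fderiv ℝ b₁ (tubeMap γ ε p) (1, 0) + fderiv ℝ b₂ (tubeMap γ ε p) (0, 1)) * hu
  · refine setIntegral_congr_fun strip.isOpen.measurableSet fun p hp => ?_
    simp only [hab₁ p hp, hab₂ p hp, weight_eq, Complex.ofReal_mul]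

/-- The weak derivative along the curve of a function in tubular coordinates. -/
theorem weakPartial_comp_tubeMap_fst (h : IsWaveguide γ ε) {f g₁ g₂ : ℝ × ℝ → ℂ}
    (hf : LocallyIntegrableOn f (tube h : Set (ℝ × ℝ)))
    (hg₁ : LocallyIntegrableOn g₁ (tube h : Set (ℝ × ℝ)))
    (hg₂ : LocallyIntegrableOn g₂ (tube h : Set (ℝ × ℝ)))
    (h₁ : WeakPartial (tube h) (1, 0) f g₁) (h₂ : WeakPartial (tube h) (0, 1) f g₂) :
    WeakPartial strip (1, 0) (fun p => f (tubeMap γ ε p)) (fun p => jac γ ε p *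
      ((deriv γ p.1).1 * g₁ (tubeMap γ ε p) + (deriv γ p.1).2 * g₂ (tubeMap γ ε p))) := by
  intro ψ hψ hc hs
  have hε : (ε : ℂ) ≠ 0 := Complex.ofReal_ne_zero.2 h.eps_pos.ne'
  have hx : ContDiff ℝ 1 fun p : ℝ × ℝ => (((deriv γ p.1).1 : ℝ) : ℂ) :=
    Complex.ofRealCLM.contDiff.comp (h.contDiff_deriv_fst.comp contDiff_fst)
  have hy : ContDiff ℝ 1 fun p : ℝ × ℝ => (((deriv γ p.1).2 : ℝ) : ℂ) :=
    Complex.ofRealCLM.contDiff.comp (h.contDiff_deriv_snd.comp contDiff_fst)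
  -- The test field is ψγ'. Since ∂_s γ' = κν is orthogonal to γ', and γ' to ν, its weighted
  -- divergence is just ε ∂_s ψ.
  have key := h.setIntegral_strip_div hf hg₁ hg₂ h₁ h₂ (hψ.mul hx) (hψ.mul hy)
    hc.mul_right hc.mul_right (tsupport_mul_subset_left.trans hs)
    (tsupport_mul_subset_left.trans hs)
  have e1 : ∀ p : ℝ × ℝ, ε * ((deriv γ p.1).1 *
      fderiv ℝ (fun p => ψ p * (((deriv γ p.1).1 : ℝ) : ℂ)) p (1, 0) + (deriv γ p.1).2 *
      fderiv ℝ (fun p => ψ p * (((deriv γ p.1).2 : ℝ) : ℂ)) p (1, 0)) +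
      jac γ ε p * (-(deriv γ p.1).2 *
      fderiv ℝ (fun p => ψ p * (((deriv γ p.1).1 : ℝ) : ℂ)) p (0, 1) + (deriv γ p.1).1 *
      fderiv ℝ (fun p => ψ p * (((deriv γ p.1).2 : ℝ) : ℂ)) p (0, 1)) =
      ε * fderiv ℝ ψ p (1, 0) := by
    intro p
    have hψd := (hψ.differentiable (by simp) p).hasFDerivAt
    have d1 : fderiv ℝ (fun p => ψ p * (((deriv γ p.1).1 : ℝ) : ℂ)) p = _ :=
      (hψd.mul (hasFDerivAt_ofReal_comp_fst (h.hasDerivAt_deriv_fst p.1))).fderiv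
    have d2 : fderiv ℝ (fun p => ψ p * (((deriv γ p.1).2 : ℝ) : ℂ)) p = _ :=
      (hψd.mul (hasFDerivAt_ofReal_comp_fst (h.hasDerivAt_deriv_snd p.1))).fderiv
    have hu : (((deriv γ p.1).1 : ℂ)) ^ 2 + ((deriv γ p.1).2 : ℂ) ^ 2 = 1 := by
      exact_mod_cast h.unit_speed p.1
    simp only [d1, d2, add_apply, smul_apply, smul_eq_mul, ContinuousLinearMap.comp_apply,
      ContinuousLinearMap.coe_fst', Complex.ofRealCLM_apply]
    push_cast
    linear_combination ε * fderiv ℝ ψ p (1, 0) * hu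
  simp_rw [e1, mul_assoc] at key
  rw [integral_const_mul, integral_const_mul, ← mul_neg] at key
  rw [mul_left_cancel₀ hε key]
  congr 1
  refine setIntegral_congr_fun strip.isOpen.measurableSet fun p hp => ?_
  simp only
  ring

/-- The weak derivative across the tube of a function in tubular coordinates. -/
theorem weakPartial_comp_tubeMap_snd (h : IsWaveguide γ ε) {f g₁ g₂ : ℝ × ℝ → ℂ}
    (hf : LocallyIntegrableOn f (tube h : Set (ℝ × ℝ)))
    (hg₁ : LocallyIntegrableOn g₁ (tube h : Set (ℝ × ℝ)))
    (hg₂ : LocallyIntegrableOn g₂ (tube h : Set (ℝ × ℝ)))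
    (h₁ : WeakPartial (tube h) (1, 0) f g₁) (h₂ : WeakPartial (tube h) (0, 1) f g₂) :
    WeakPartial strip (0, 1) (fun p => f (tubeMap γ ε p)) (fun p => ε *
      (-(deriv γ p.1).2 * g₁ (tubeMap γ ε p) + (deriv γ p.1).1 * g₂ (tubeMap γ ε p))) := by
  intro ψ hψ hc hs
  have hx : ContDiff ℝ 1 fun p : ℝ × ℝ => (((deriv γ p.1).1 : ℝ) : ℂ) :=
    Complex.ofRealCLM.contDiff.comp (h.contDiff_deriv_fst.comp contDiff_fst)
  have hy : ContDiff ℝ 1 fun p : ℝ × ℝ => (((deriv γ p.1).2 : ℝ) : ℂ) :=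
    Complex.ofRealCLM.contDiff.comp (h.contDiff_deriv_snd.comp contDiff_fst)
  have hJ : ∀ p ∈ strip, (jac γ ε p : ℂ) ≠ 0 := fun p hp =>
    Complex.ofReal_ne_zero.2 (h.jac_pos hp).ne'
  -- The test field is χν with χ = ψ/J. Its weighted divergence is -εκχ + J ∂_t χ, and this is
  -- ∂_t(Jχ) = ∂_t ψ because ∂_t J = -εκ.
  set χ : ℝ × ℝ → ℂ := fun p => ψ p * ((jac γ ε p : ℝ) : ℂ)⁻¹ with hχd
  have hχ : ContDiff ℝ 1 χ := contDiff_mul_of_contDiffOn strip.isOpen hψ hs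
    (h.contDiff_ofReal_jac.contDiffOn.inv hJ)
  have hχc : HasCompactSupport χ := hc.mul_right
  have hχs : tsupport χ ⊆ (strip : Set (ℝ × ℝ)) := tsupport_mul_subset_left.trans hs
  have key := h.setIntegral_strip_div hf hg₁ hg₂ h₁ h₂ (hχ.mul hy.neg) (hχ.mul hx)
    hχc.mul_right hχc.mul_right (tsupport_mul_subset_left.trans hχs)
    (tsupport_mul_subset_left.trans hχs)
  refine Eq.trans ?_ (key.trans (congrArg Neg.neg ?_))
  · refine setIntegral_congr_fun strip.isOpen.measurableSet fun p hp => ?_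
    have hχp := (hχ.differentiable (by simp) p).hasFDerivAt
    have d1 : fderiv ℝ (fun p => χ p * -(((deriv γ p.1).2 : ℝ) : ℂ)) p = _ :=
      (hχp.mul (hasFDerivAt_ofReal_comp_fst (h.hasDerivAt_deriv_snd p.1)).neg).fderiv
    have d2 : fderiv ℝ (fun p => χ p * (((deriv γ p.1).1 : ℝ) : ℂ)) p = _ :=
      (hχp.mul (hasFDerivAt_ofReal_comp_fst (h.hasDerivAt_deriv_fst p.1))).fderiv
    have d3 : fderiv ℝ ψ p = fderiv ℝ (fun p => χ p * ((jac γ ε p : ℝ) : ℂ)) p := by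
      refine Filter.EventuallyEq.fderiv_eq ?_
      filter_upwards [strip.isOpen.mem_nhds hp] with q hq
      rw [hχd]
      field_simp [hJ q hq]
    have d4 : fderiv ℝ (fun p => χ p * ((jac γ ε p : ℝ) : ℂ)) p = _ :=
      (hχp.mul (hasFDerivAt_ofReal_comp (h.hasFDerivAt_jac p))).fderiv
    have hu : (((deriv γ p.1).1 : ℂ)) ^ 2 + ((deriv γ p.1).2 : ℂ) ^ 2 = 1 := by
      exact_mod_cast h.unit_speed p.1
    simp only [d1, d2, d3, d4, add_apply, smul_apply, smul_eq_mul, ContinuousLinearMap.comp_apply,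
      ContinuousLinearMap.coe_fst', ContinuousLinearMap.coe_snd', Complex.ofRealCLM_apply,
      neg_apply, Pi.neg_apply]
    push_cast
    linear_combination -(jac γ ε p * fderiv ℝ χ p (0, 1) - ε * curvature γ p.1 * χ p) *
      f (tubeMap γ ε p) * hu
  · refine setIntegral_congr_fun strip.isOpen.measurableSet fun p hp => ?_
    simp only [hχd]
    field_simp [hJ p hp]

/-- A function on the tube has weak derivatives if it has weak derivatives in tubular
coordinates. -/
theorem weakPartial_of_comp_tubeMap (h : IsWaveguide γ ε) {e : ℝ × ℝ} {f g G₁ G₂ : ℝ × ℝ → ℂ}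
    (hf : LocallyIntegrableOn (fun p => f (tubeMap γ ε p)) (strip : Set (ℝ × ℝ)))
    (hG₁ : LocallyIntegrableOn G₁ (strip : Set (ℝ × ℝ)))
    (hG₂ : LocallyIntegrableOn G₂ (strip : Set (ℝ × ℝ)))
    (h₁ : WeakPartial strip (1, 0) (fun p => f (tubeMap γ ε p)) G₁)
    (h₂ : WeakPartial strip (0, 1) (fun p => f (tubeMap γ ε p)) G₂)
    (hg : ∀ᵐ p ∂volume.restrict (strip : Set (ℝ × ℝ)), (weight γ ε p : ℂ) * g (tubeMap γ ε p) =
      ε * ((deriv γ p.1).1 * e.1 + (deriv γ p.1).2 * e.2) * G₁ p +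
      jac γ ε p * (-(deriv γ p.1).2 * e.1 + (deriv γ p.1).1 * e.2) * G₂ p) :
    WeakPartial (tube h) e f g := by
  intro ψ hψ hc hs
  obtain ⟨χ, hχ, hχc, hχs, hχψ⟩ := h.exists_pullback hψ hc hs
  have hx : ContDiff ℝ 1 fun p : ℝ × ℝ => (((deriv γ p.1).1 : ℝ) : ℂ) :=
    Complex.ofRealCLM.contDiff.comp (h.contDiff_deriv_fst.comp contDiff_fst)
  have hy : ContDiff ℝ 1 fun p : ℝ × ℝ => (((deriv γ p.1).2 : ℝ) : ℂ) :=
    Complex.ofRealCLM.contDiff.comp (h.contDiff_deriv_snd.comp contDiff_fst)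
  -- Here α = ε γ'·e and β = ν·e. With χ = ψ ∘ Φ on the strip, εJ ∂_e ψ is α ∂_s χ + Jβ ∂_t χ.
  -- Moreover ∂_s α + ∂_t(Jβ) = εκ ν·e - εκ ν·e = 0, so this equals ∂_s(χα) + ∂_t(χJβ), and χα and
  -- χJβ are admissible test functions.
  set α : ℝ × ℝ → ℂ := fun p =>
    ε * ((((deriv γ p.1).1 : ℝ) : ℂ) * e.1 + (((deriv γ p.1).2 : ℝ) : ℂ) * e.2) with hα
  set β : ℝ × ℝ → ℂ := fun p =>
    -(((deriv γ p.1).2 : ℝ) : ℂ) * e.1 + (((deriv γ p.1).1 : ℝ) : ℂ) * e.2 with hβ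
  have hαc : ContDiff ℝ 1 α :=
    contDiff_const.mul ((hx.mul contDiff_const).add (hy.mul contDiff_const))
  have hβc : ContDiff ℝ 1 β := (hy.neg.mul contDiff_const).add (hx.mul contDiff_const)
  have hm := h.contDiff_ofReal_jac.mul hβc
  have a1 := hχ.mul hαc
  have a2 := hχ.mul hm
  have c1 : HasCompactSupport (fun p => χ p * α p) := hχc.mul_right
  have c2 : HasCompactSupport (fun p => χ p * (((jac γ ε p : ℝ) : ℂ) * β p)) := hχc.mul_right
  have s1 : tsupport (fun p => χ p * α p) ⊆ (strip : Set (ℝ × ℝ)) :=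
    tsupport_mul_subset_left.trans hχs
  have s2 : tsupport (fun p => χ p * (((jac γ ε p : ℝ) : ℂ) * β p)) ⊆ (strip : Set (ℝ × ℝ)) :=
    tsupport_mul_subset_left.trans hχs
  have k₁ := h₁ _ a1 c1 s1
  have k₂ := h₂ _ a2 c2 s2
  have i₁ := integrableOn_mul_of_tsupport_subset
    ((a1.continuous_fderiv (by simp)).clm_apply continuous_const)
    (c1.fderiv_apply (𝕜 := ℝ) (1, 0)) ((tsupport_fderiv_apply_subset ℝ _).trans s1) hf
  have i₂ := integrableOn_mul_of_tsupport_subset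
    ((a2.continuous_fderiv (by simp)).clm_apply continuous_const)
    (c2.fderiv_apply (𝕜 := ℝ) (0, 1)) ((tsupport_fderiv_apply_subset ℝ _).trans s2) hf
  have j₁ := integrableOn_mul_of_tsupport_subset a1.continuous c1 s1 hG₁
  have j₂ := integrableOn_mul_of_tsupport_subset a2.continuous c2 s2 hG₂
  have key := congrArg₂ (· + ·) k₁ k₂
  simp only [← neg_add] at key
  rw [← integral_add i₁ i₂, ← integral_add j₁ j₂] at key
  rw [h.setIntegral_tube_complex, h.setIntegral_tube_complex]
  refine Eq.trans ?_ (key.trans (congrArg Neg.neg ?_))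
  · refine setIntegral_congr_fun strip.isOpen.measurableSet fun p hp => ?_
    obtain ⟨d₁, d₂⟩ := h.fderiv_comp_tubeMap hψ (fun p hp => (hχψ p hp).symm) hp
    have hχp := (hχ.differentiable (by simp) p).hasFDerivAt
    have dx := hasFDerivAt_ofReal_comp_fst (p := p) (h.hasDerivAt_deriv_fst p.1)
    have dy := hasFDerivAt_ofReal_comp_fst (p := p) (h.hasDerivAt_deriv_snd p.1)
    have dα : HasFDerivAt α _ p := ((dx.mul_const (e.1 : ℂ)).add (dy.mul_const (e.2 : ℂ))).const_mul
      (ε : ℂ)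
    have dβ : HasFDerivAt β _ p := (dy.neg.mul_const (e.1 : ℂ)).add (dx.mul_const (e.2 : ℂ))
    have d3 : fderiv ℝ (fun p => χ p * α p) p = _ := (hχp.mul dα).fderiv
    have d4 : fderiv ℝ (fun p => χ p * (((jac γ ε p : ℝ) : ℂ) * β p)) p = _ :=
      (hχp.mul ((hasFDerivAt_ofReal_comp (h.hasFDerivAt_jac p)).mul dβ)).fderiv
    have hu : (((deriv γ p.1).1 : ℂ)) ^ 2 + ((deriv γ p.1).2 : ℂ) ^ 2 = 1 := by
      exact_mod_cast h.unit_speed p.1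
    have hlin : fderiv ℝ ψ (tubeMap γ ε p) e = e.1 * fderiv ℝ ψ (tubeMap γ ε p) (1, 0) +
        e.2 * fderiv ℝ ψ (tubeMap γ ε p) (0, 1) := by
      have : e = e.1 • (1, 0) + e.2 • (0, 1) := by ext <;> simp
      nth_rewrite 1 [this]
      rw [map_add, map_smul, map_smul, Complex.real_smul, Complex.real_smul]
    rw [d3, d4]
    simp only [Pi.mul_apply, hlin, add_apply, smul_apply, smul_eq_mul, ContinuousLinearMap.comp_apply,
      ContinuousLinearMap.coe_fst', ContinuousLinearMap.coe_snd', Complex.ofRealCLM_apply,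
      neg_apply, d₁, d₂, weight_eq, hα, hβ]
    push_cast
    linear_combination -(ε * jac γ ε p * f (tubeMap γ ε p) *
      (e.1 * fderiv ℝ ψ (tubeMap γ ε p) (1, 0) + e.2 * fderiv ℝ ψ (tubeMap γ ε p) (0, 1))) * hu
  · refine integral_congr_ae ?_
    filter_upwards [hg, ae_restrict_mem strip.isOpen.measurableSet] with p hgp hp
    simp only [hχψ p hp, hα, hβ]
    linear_combination -ψ (tubeMap γ ε p) * hgp

end IsWaveguide

/-! ### The gauge factors -/

theorem act_apply (M : Matrix (Fin 2) (Fin 2) ℂ) (v : Spinor) (i : Fin 2) :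
    act M v i = M i 0 * v 0 + M i 1 * v 1 := by
  rw [act, Matrix.ofLp_toEuclideanCLM]
  simp [Matrix.mulVec, dotProduct, Fin.sum_univ_two]

/-- The diagonal entries of the gauge matrix. -/
def gaugeCoeff (t : ℝ) (i : Fin 2) : ℂ := gaugeMatrix t i i

theorem gaugeCoeff_zero (t : ℝ) :
    gaugeCoeff t 0 = Complex.exp (Complex.I * (Real.pi / 4 + t / 2)) := rfl

theorem gaugeCoeff_one (t : ℝ) :
    gaugeCoeff t 1 = -Complex.exp (-(Complex.I * (Real.pi / 4 + t / 2))) := rfl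

theorem act_gaugeMatrix_apply (t : ℝ) (v : Spinor) (i : Fin 2) :
    act (gaugeMatrix t) v i = gaugeCoeff t i * v i := by
  rw [act_apply]
  fin_cases i <;> simp [gaugeCoeff, gaugeMatrix]

theorem norm_gaugeCoeff (t : ℝ) (i : Fin 2) : ‖gaugeCoeff t i‖ = 1 := by
  have e : Complex.I * (Real.pi / 4 + t / 2) = ((Real.pi / 4 + t / 2 : ℝ) : ℂ) * Complex.I := by
    push_cast
    ring
  fin_cases i
  · change ‖gaugeCoeff t 0‖ = 1
    rw [gaugeCoeff_zero, e, Complex.norm_exp_ofReal_mul_I]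
  · change ‖gaugeCoeff t 1‖ = 1
    rw [gaugeCoeff_one, norm_neg, e, ← neg_mul, ← Complex.ofReal_neg,
      Complex.norm_exp_ofReal_mul_I]

theorem gaugeCoeff_ne_zero (t : ℝ) (i : Fin 2) : gaugeCoeff t i ≠ 0 :=
  norm_ne_zero_iff.1 (by rw [norm_gaugeCoeff]; exact one_ne_zero)

theorem norm_act_gaugeMatrix (t : ℝ) (v : Spinor) : ‖act (gaugeMatrix t) v‖ = ‖v‖ := by
  rw [EuclideanSpace.norm_eq, EuclideanSpace.norm_eq]
  simp_rw [act_gaugeMatrix_apply, norm_mul, norm_gaugeCoeff, one_mul]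

/-- With γ' = (x, y) the hypothesis reads i(x + iy) = e^{it}, and the quotient of the gauge entries
is -ie^{it}. This relation is what rotates σ·γ' to σ₁ and σ·ν to σ₂. -/
theorem gaugeCoeff_zero_eq {t : ℝ} {x y : ℂ} (h : -y + Complex.I * x = Complex.exp (Complex.I * t)) :
    gaugeCoeff t 0 = (x + Complex.I * y) * gaugeCoeff t 1 := by
  have e1 : x + Complex.I * y = -Complex.I * Complex.exp (Complex.I * t) := by
    rw [← h]
    linear_combination x * Complex.I_sq
  have e2 : Complex.I = Complex.exp (Complex.I * (Real.pi / 2)) := by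
    rw [mul_comm, Complex.exp_pi_div_two_mul_I]
  rw [e1, gaugeCoeff_zero, gaugeCoeff_one]
  nth_rewrite 2 [e2]
  rw [neg_mul, neg_mul_neg, ← Complex.exp_add, ← Complex.exp_add]
  congr 1
  ring

/-- The derivative of the phase of the diagonal gauge entries. -/
def gaugeSign (i : Fin 2) : ℂ := if i = 0 then Complex.I / 2 else -Complex.I / 2

theorem hasDerivAt_gaugeCoeff (t : ℝ) (i : Fin 2) :
    HasDerivAt (fun t => gaugeCoeff t i) (gaugeCoeff t i * gaugeSign i) t := by
  have k : HasDerivAt (fun t : ℝ => Complex.I * ((Real.pi : ℂ) / 4 + (t : ℂ) / 2))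
      (Complex.I / 2) t := by
    have := ((((Complex.ofRealCLM.hasDerivAt (x := t)).div_const 2).const_add
      ((Real.pi : ℂ) / 4)).const_mul Complex.I)
    refine this.congr_deriv ?_
    simp [div_eq_mul_inv]
  fin_cases i
  · exact k.cexp.congr_deriv (by simp [gaugeSign, gaugeCoeff_zero])
  · exact k.neg.cexp.neg.congr_deriv (by simp [gaugeSign, gaugeCoeff_one]; ring)

/-- The factor multiplying the `i`-th component in the straightening map. -/
def tubeFactor (γ : ℝ → ℝ × ℝ) (ε : ℝ) (θ : ℝ → ℝ) (i : Fin 2) (p : ℝ × ℝ) : ℂ :=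
  (Real.sqrt (weight γ ε p) : ℂ) * gaugeCoeff (θ p.1) i

/-- The straightening map on functions. -/
def straightenFun (γ : ℝ → ℝ × ℝ) (ε : ℝ) (θ : ℝ → ℝ) (f : ℝ × ℝ → Spinor) (p : ℝ × ℝ) : Spinor :=
  (Real.sqrt (weight γ ε p) : ℂ) • act (gaugeMatrix (θ p.1)) (f (tubeMap γ ε p))

theorem straightenFun_apply (γ : ℝ → ℝ × ℝ) (ε : ℝ) (θ : ℝ → ℝ) (f : ℝ × ℝ → Spinor) (p : ℝ × ℝ)
    (i : Fin 2) :
    straightenFun γ ε θ f p i = tubeFactor γ ε θ i p * f (tubeMap γ ε p) i := by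
  rw [straightenFun, PiLp.smul_apply, act_gaugeMatrix_apply, smul_eq_mul, tubeFactor, mul_assoc]

theorem continuous_gaugeCoeff (i : Fin 2) : Continuous fun t => gaugeCoeff t i :=
  continuous_iff_continuousAt.2 fun t => (hasDerivAt_gaugeCoeff t i).continuousAt

theorem measurable_spinor {f : ℝ × ℝ → Spinor} (hf : ∀ i, Measurable fun p => f p i) :
    Measurable f := by
  have : f = fun p => WithLp.toLp 2 fun i => f p i := rfl
  rw [this]
  exact (WithLp.measurable_toLp 2 (Fin 2 → ℂ)).comp (measurable_pi_lambda _ hf)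

theorem measurable_spinor_apply (i : Fin 2) : Measurable fun v : Spinor => v i :=
  (EuclideanSpace.proj (𝕜 := ℂ) (ι := Fin 2) i).continuous.measurable

/-! ### The angle of the normal and the unitary straightening map -/

namespace IsWaveguide

variable {γ : ℝ → ℝ × ℝ} {ε : ℝ} {θ : ℝ → ℝ}

/-- The angle of the normal. -/
theorem exists_angle (h : IsWaveguide γ ε) : ∃ θ : ℝ → ℝ,
    (∀ s, HasDerivAt θ (curvature γ s) s) ∧
      ∀ s, ((normal γ s).1 : ℂ) + Complex.I * ((normal γ s).2 : ℂ) =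
        Complex.exp (Complex.I * (θ s : ℂ)) := by
  have hκ := h.contDiff_curvature.continuous
  set n : ℝ → ℂ := fun s => ((normal γ s).1 : ℂ) + Complex.I * ((normal γ s).2 : ℂ) with hn
  have hn0 : ‖n 0‖ = 1 := by
    have : n 0 = ((normal γ 0).1 : ℂ) + ((normal γ 0).2 : ℂ) * Complex.I := by
      rw [hn]; ring
    rw [this, Complex.norm_add_mul_I, Real.sqrt_eq_one]
    have := h.unit_speed 0
    simp only [normal]
    linarith
  -- The complex normal solves n' = iκn, so n e^{-iθ} is constant for any primitive θ of κ; starting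
  -- at arg n(0), with |n(0)| = 1, makes the constant equal to 1.
  set θ : ℝ → ℝ := fun s => Complex.arg (n 0) + ∫ t in (0 : ℝ)..s, curvature γ t with hθ
  have hd : ∀ s, HasDerivAt θ (curvature γ s) s := fun s =>
    (intervalIntegral.integral_hasDerivAt_right (hκ.intervalIntegrable _ _)
      (hκ.stronglyMeasurableAtFilter _ _) hκ.continuousAt).const_add _
  refine ⟨θ, hd, fun s => ?_⟩
  have hnd : ∀ s, HasDerivAt n (Complex.I * curvature γ s * n s) s := by
    intro s
    have k := h.hasDerivAt_normal s
    have k1 : HasDerivAt (fun s => (normal γ s).1) _ s :=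
      (hasFDerivAt_fst (𝕜 := ℝ) (p := normal γ s)).comp_hasDerivAt s k
    have k2 : HasDerivAt (fun s => (normal γ s).2) _ s :=
      (hasFDerivAt_snd (𝕜 := ℝ) (p := normal γ s)).comp_hasDerivAt s k
    refine (k1.ofReal_comp.add (k2.ofReal_comp.const_mul Complex.I)).congr_deriv ?_
    simp only [hn, normal, ContinuousLinearMap.coe_fst', ContinuousLinearMap.coe_snd',
      Prod.smul_fst, Prod.smul_snd, smul_eq_mul]
    push_cast
    linear_combination -(curvature γ s * (deriv γ s).1 : ℂ) * Complex.I_sq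
  have hed : ∀ s, HasDerivAt (fun s => n s * Complex.exp (-(Complex.I * θ s))) 0 s := by
    intro s
    have k := ((hd s).ofReal_comp.const_mul Complex.I).neg.cexp
    refine ((hnd s).mul k).congr_deriv ?_
    simp only [Pi.neg_apply]
    ring
  have hc := is_const_of_deriv_eq_zero (fun s => (hed s).differentiableAt)
    (fun s => (hed s).deriv) s 0
  have h0 : n 0 * Complex.exp (-(Complex.I * θ 0)) = 1 := by
    have e : θ 0 = Complex.arg (n 0) := by simp [hθ]
    have := Complex.norm_mul_exp_arg_mul_I (n 0)
    rw [hn0, Complex.ofReal_one, one_mul] at this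
    rw [e, mul_comm Complex.I]
    nth_rewrite 1 [← this]
    rw [← Complex.exp_add, add_neg_cancel, Complex.exp_zero]
  rw [h0, Complex.exp_neg] at hc
  exact (eq_of_mul_inv_eq_one hc)

theorem tubeFactor_ne_zero (h : IsWaveguide γ ε) {p : ℝ × ℝ} (hp : p ∈ strip) (i : Fin 2) :
    tubeFactor γ ε θ i p ≠ 0 :=
  mul_ne_zero (Complex.ofReal_ne_zero.2 (Real.sqrt_ne_zero'.2 (h.weight_pos hp)))
    (gaugeCoeff_ne_zero _ _)

theorem measurable_tubeFactor (h : IsWaveguide γ ε) (hθ : Continuous θ) (i : Fin 2) :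
    Measurable (tubeFactor γ ε θ i) :=
  ((Complex.continuous_ofReal.comp (Real.continuous_sqrt.comp h.continuous_weight)).mul
    ((continuous_gaugeCoeff i).comp (hθ.comp continuous_fst))).measurable

theorem measurable_straightenFun (h : IsWaveguide γ ε) (hθ : Continuous θ) {f : ℝ × ℝ → Spinor}
    (hf : Measurable f) : Measurable (straightenFun γ ε θ f) := by
  refine measurable_spinor fun i => ?_
  simp_rw [straightenFun_apply]
  refine (h.measurable_tubeFactor hθ i).mul ?_
  exact (measurable_spinor_apply i).comp
    (hf.comp h.measurable_tubeMap)

theorem straightenFun_congr (h : IsWaveguide γ ε) {f g : ℝ × ℝ → Spinor}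
    (hfg : f =ᵐ[volume.restrict (tube h : Set (ℝ × ℝ))] g) :
    straightenFun γ ε θ f =ᵐ[volume.restrict (strip : Set (ℝ × ℝ))] straightenFun γ ε θ g := by
  filter_upwards [h.quasiMeasurePreserving_tubeMap.ae hfg] with p hp
  rw [straightenFun, straightenFun, hp]

/-- The gauge preserves the pointwise norm, and the square of the scalar factor is exactly the
Jacobian. -/
theorem eLpNorm_straightenFun (h : IsWaveguide γ ε) {f : ℝ × ℝ → Spinor} (hf : Measurable f) :
    eLpNorm (straightenFun γ ε θ f) 2 (volume.restrict (strip : Set (ℝ × ℝ))) =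
      eLpNorm f 2 (volume.restrict (tube h : Set (ℝ × ℝ))) := by
  rw [eLpNorm_eq_lintegral_rpow_enorm_toReal (by norm_num) (by norm_num),
    eLpNorm_eq_lintegral_rpow_enorm_toReal (by norm_num) (by norm_num)]
  congr 1
  have hm : Measurable fun x => ‖f x‖ₑ ^ (2 : ENNReal).toReal := hf.enorm.pow_const _
  rw [← h.measurePreserving_tubeMap.lintegral_comp hm]
  change _ = ∫⁻ p, ((fun x => ‖f x‖ₑ ^ (2 : ENNReal).toReal) ∘ tubeMap γ ε) p ∂_
  rw [lintegral_withDensity_eq_lintegral_mul _ h.continuous_weight.measurable.ennreal_ofReal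
      (hm.comp h.measurable_tubeMap)]
  refine setLIntegral_congr_fun strip.isOpen.measurableSet fun p hp => ?_
  have hw := (h.weight_pos hp).le
  have e1 : ‖straightenFun γ ε θ f p‖ₑ =
      ENNReal.ofReal (Real.sqrt (weight γ ε p)) * ‖f (tubeMap γ ε p)‖ₑ := by
    rw [straightenFun, enorm_smul, ← ofReal_norm (act _ _), norm_act_gaugeMatrix,
      ofReal_norm, ← ofReal_norm ((_ : ℝ) : ℂ), Complex.norm_real,
      Real.norm_of_nonneg (Real.sqrt_nonneg _)]
  simp only [e1, Pi.mul_apply, Function.comp_apply]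
  rw [ENNReal.mul_rpow_of_nonneg _ _ (by norm_num)]
  congr 1
  rw [ENNReal.toReal_ofNat, ENNReal.rpow_ofNat, ← ENNReal.ofReal_pow (Real.sqrt_nonneg _),
    Real.sq_sqrt hw]

theorem memLp_straightenFun (h : IsWaveguide γ ε) (hθ : Continuous θ) (u : L2 (tube h)) :
    MemLp (straightenFun γ ε θ u) 2 (volume.restrict (strip : Set (ℝ × ℝ))) := by
  have hu : Measurable u := (Lp.stronglyMeasurable u).measurable
  refine ⟨(h.measurable_straightenFun hθ hu).aestronglyMeasurable, ?_⟩
  rw [h.eLpNorm_straightenFun hu]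
  exact (Lp.memLp u).2

/-- The straightening map as a linear isometry. -/
def straightenIsometry (h : IsWaveguide γ ε) (hθ : Continuous θ) : L2 (tube h) →ₗᵢ[ℂ] L2 strip where
  toFun u := (h.memLp_straightenFun hθ u).toLp
  map_add' u v := by
    rw [← MemLp.toLp_add]
    refine MemLp.toLp_congr _ _ ?_
    refine (h.straightenFun_congr (Lp.coeFn_add u v)).trans (Eventually.of_forall fun p => ?_)
    simp only [straightenFun, Pi.add_apply, map_add, smul_add]
  map_smul' c u := by
    rw [RingHom.id_apply, ← MemLp.toLp_const_smul]
    refine MemLp.toLp_congr _ _ ?_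
    refine (h.straightenFun_congr (Lp.coeFn_smul c u)).trans (Eventually.of_forall fun p => ?_)
    simp only [straightenFun, Pi.smul_apply, map_smul]
    rw [smul_comm]
  norm_map' u := by
    change ‖(h.memLp_straightenFun hθ u).toLp‖ = ‖u‖
    rw [Lp.norm_toLp, h.eLpNorm_straightenFun (Lp.stronglyMeasurable u).measurable, Lp.norm_def]

theorem straightenIsometry_surjective (h : IsWaveguide γ ε) (hθ : Continuous θ) :
    Function.Surjective (h.straightenIsometry hθ) := by
  intro v
  set f : ℝ × ℝ → Spinor := fun x => WithLp.toLp 2 fun i =>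
    (tubeFactor γ ε θ i (tubeInv γ ε x))⁻¹ * v (tubeInv γ ε x) i with hf
  have hfm : Measurable f := by
    refine measurable_spinor fun i => ?_
    refine ((h.measurable_tubeFactor hθ i).comp h.measurable_tubeInv).inv.mul ?_
    exact (measurable_spinor_apply i).comp
      ((Lp.stronglyMeasurable v).measurable.comp h.measurable_tubeInv)
  have hfv : straightenFun γ ε θ f =ᵐ[volume.restrict (strip : Set (ℝ × ℝ))] v := by
    filter_upwards [ae_restrict_mem strip.isOpen.measurableSet] with p hp
    ext i
    rw [straightenFun_apply]
    simp only [hf, h.tubeInv_tubeMap hp]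
    rw [mul_inv_cancel_left₀ (h.tubeFactor_ne_zero hp i)]
  -- Square integrability of the preimage is read off from the norm identity, whose only hypothesis
  -- is measurability.
  have hfL : MemLp f 2 (volume.restrict (tube h : Set (ℝ × ℝ))) := by
    refine ⟨hfm.aestronglyMeasurable, ?_⟩
    rw [← h.eLpNorm_straightenFun (θ := θ) hfm, eLpNorm_congr_ae hfv]
    exact (Lp.memLp v).2
  refine ⟨hfL.toLp, ?_⟩
  refine Lp.ext (((MemLp.coeFn_toLp (h.memLp_straightenFun hθ _)).trans ?_).trans hfv)
  exact h.straightenFun_congr hfL.coeFn_toLp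

/-- The unitary straightening map. -/
def straighten (h : IsWaveguide γ ε) (hθ : Continuous θ) : L2 (tube h) ≃ₗᵢ[ℂ] L2 strip :=
  LinearIsometryEquiv.ofSurjective (h.straightenIsometry hθ) (h.straightenIsometry_surjective hθ)

theorem straighten_coeFn (h : IsWaveguide γ ε) (hθ : Continuous θ) (u : L2 (tube h)) :
    h.straighten hθ u =ᵐ[volume.restrict (strip : Set (ℝ × ℝ))] straightenFun γ ε θ u :=
  MemLp.coeFn_toLp (h.memLp_straightenFun hθ u)

theorem straighten_apply (h : IsWaveguide γ ε) (hθ : Continuous θ) (u : L2 (tube h)) :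
    ∀ᵐ p ∂volume.restrict (strip : Set (ℝ × ℝ)), ∀ i,
      h.straighten hθ u p i = tubeFactor γ ε θ i p * u (tubeMap γ ε p) i := by
  filter_upwards [h.straighten_coeFn hθ u] with p hp i
  rw [hp, straightenFun_apply]

end IsWaveguide

/-! ### Sobolev regularity under the straightening map -/

theorem _root_.MeasureTheory.LocallyIntegrableOn.congr_ae_restrict {f g : ℝ × ℝ → ℂ}
    {U : Set (ℝ × ℝ)} (hf : LocallyIntegrableOn f U)
    (hfg : f =ᵐ[volume.restrict U] g) : LocallyIntegrableOn g U := by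
  intro x hx
  obtain ⟨t, ht, hi⟩ := hf x hx
  refine ⟨t ∩ U, inter_mem ht self_mem_nhdsWithin, ?_⟩
  refine Integrable.congr (hi.mono_set inter_subset_left) ?_
  exact ae_restrict_of_ae_restrict_of_subset inter_subset_right hfg

/-- The logarithmic derivative of the straightening factor along the curve. -/
def logDerivS (γ : ℝ → ℝ × ℝ) (ε : ℝ) (i : Fin 2) (p : ℝ × ℝ) : ℂ :=
  -(jac γ ε p * coeffB γ ε p) + curvature γ p.1 * gaugeSign i

/-- The logarithmic derivative of the straightening factor across the tube. -/
def logDerivT (γ : ℝ → ℝ × ℝ) (ε : ℝ) (p : ℝ × ℝ) : ℂ :=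
  -(ε * (curvature γ p.1 * coeffA γ ε p) / 2)

theorem memLp_top_mul {a b : ℝ × ℝ → ℂ} {μ : Measure (ℝ × ℝ)} (ha : MemLp a ⊤ μ)
    (hb : MemLp b ⊤ μ) : MemLp (fun p => a p * b p) ⊤ μ :=
  hb.mul ha

theorem memLp_two_mul {a f : ℝ × ℝ → ℂ} {μ : Measure (ℝ × ℝ)} (ha : MemLp a ⊤ μ)
    (hf : MemLp f 2 μ) : MemLp (fun p => a p * f p) 2 μ :=
  hf.mul ha

theorem exists_L2_of_components {Ω : TopologicalSpace.Opens (ℝ × ℝ)} {F : Fin 2 → ℝ × ℝ → ℂ}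
    (hF : ∀ i, MemLp (F i) 2 (volume.restrict (Ω : Set (ℝ × ℝ)))) :
    ∃ q : L2 Ω, ∀ᵐ p ∂volume.restrict (Ω : Set (ℝ × ℝ)), ∀ i, q p i = F i p := by
  have h : MemLp (fun p => (WithLp.toLp 2 fun i => F i p : Spinor)) 2
      (volume.restrict (Ω : Set (ℝ × ℝ))) := MemLp.of_eval_piLp hF
  refine ⟨h.toLp, ?_⟩
  filter_upwards [h.coeFn_toLp] with p hp i
  rw [hp]

theorem coeffA_eq (γ : ℝ → ℝ × ℝ) (ε : ℝ) (p : ℝ × ℝ) : coeffA γ ε p = (jac γ ε p : ℂ)⁻¹ := by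
  rw [coeffA, one_div, Complex.ofReal_inv, jac]

theorem jac_mul_coeffB {γ : ℝ → ℝ × ℝ} {ε : ℝ} {p : ℝ × ℝ} (hJ : jac γ ε p ≠ 0) :
    (jac γ ε p : ℂ) * coeffB γ ε p =
      ε * p.2 * deriv (curvature γ) p.1 / (2 * jac γ ε p) := by
  have hJ' : (jac γ ε p : ℂ) ≠ 0 := Complex.ofReal_ne_zero.2 hJ
  have e : coeffB γ ε p = ε * p.2 * deriv (curvature γ) p.1 / (2 * (jac γ ε p : ℂ) ^ 2) := by
    rw [coeffB, ← jac]
    push_cast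
    rfl
  rw [e]
  field_simp

namespace IsWaveguide

variable {γ : ℝ → ℝ × ℝ} {ε : ℝ} {θ : ℝ → ℝ}

theorem memLp_top_of_continuous_bound {a : ℝ × ℝ → ℝ} (ha : Continuous a) {C : ℝ}
    (hC : ∀ p ∈ strip, |a p| ≤ C) :
    MemLp (fun p => (a p : ℂ)) ⊤ (volume.restrict (strip : Set (ℝ × ℝ))) := by
  refine memLp_top_of_bound (Complex.continuous_ofReal.comp ha).aestronglyMeasurable C ?_
  filter_upwards [ae_restrict_mem strip.isOpen.measurableSet] with p hp
  rw [Complex.norm_real]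
  exact hC p hp

theorem memLp_jac (h : IsWaveguide γ ε) :
    MemLp (fun p => (jac γ ε p : ℂ)) ⊤ (volume.restrict (strip : Set (ℝ × ℝ))) := by
  refine memLp_top_of_continuous_bound h.contDiff_jac.continuous (C := 3 / 2) fun p hp => ?_
  -- Reflecting t turns the lower bound 1/2 for J into the upper bound 3/2.
  have hp' : (p.1, -p.2) ∈ strip := ⟨mem_univ _, by linarith [hp.2.2], by linarith [hp.2.1]⟩
  have h1 := h.half_le hp'
  have h2 := h.half_le hp
  rw [jac, abs_le]
  simp only at h1
  constructor <;> linarith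

theorem memLp_curvature (h : IsWaveguide γ ε) :
    MemLp (fun p => (curvature γ p.1 : ℂ)) ⊤ (volume.restrict (strip : Set (ℝ × ℝ))) :=
  memLp_top_of_continuous_bound h.continuous_curvature_fst
    fun p _ => le_ciSup h.bddAbove_curvature p.1

theorem memLp_deriv_fst (h : IsWaveguide γ ε) :
    MemLp (fun p => ((deriv γ p.1).1 : ℂ)) ⊤ (volume.restrict (strip : Set (ℝ × ℝ))) := by
  refine memLp_top_of_continuous_bound (a := fun p => (deriv γ p.1).1)
    (h.contDiff_deriv_fst.continuous.comp continuous_fst) (C := 1) fun p _ => ?_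
  have := h.unit_speed p.1
  exact abs_le_one_iff_mul_self_le_one.2 (by nlinarith)

theorem memLp_deriv_snd (h : IsWaveguide γ ε) :
    MemLp (fun p => ((deriv γ p.1).2 : ℂ)) ⊤ (volume.restrict (strip : Set (ℝ × ℝ))) := by
  refine memLp_top_of_continuous_bound (a := fun p => (deriv γ p.1).2)
    (h.contDiff_deriv_snd.continuous.comp continuous_fst) (C := 1) fun p _ => ?_
  have := h.unit_speed p.1
  exact abs_le_one_iff_mul_self_le_one.2 (by nlinarith)

/-- Boundedness of κ' enters here through `coeffB`; it keeps the zeroth-order term of ∂_s in L², so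
that H¹ is carried into H¹. -/
theorem memLp_logDerivS (h : IsWaveguide γ ε) (i : Fin 2) :
    MemLp (logDerivS γ ε i) ⊤ (volume.restrict (strip : Set (ℝ × ℝ))) :=
  (memLp_top_mul h.memLp_jac (memLp_coeffB h)).neg.add
    (memLp_top_mul h.memLp_curvature (memLp_top_const _))

theorem memLp_logDerivT (h : IsWaveguide γ ε) :
    MemLp (logDerivT γ ε) ⊤ (volume.restrict (strip : Set (ℝ × ℝ))) := by
  have := (memLp_top_mul (memLp_top_const (-(ε : ℂ) / 2))
    (memLp_top_mul h.memLp_curvature (memLp_coeffA h)))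
  refine this.ae_eq (Eventually.of_forall fun p => ?_)
  simp only [logDerivT]
  ring

/-- The claim is confined to the strip because the square root is differentiated, which needs a
nonzero weight. -/
theorem contDiffOn_tubeFactor (h : IsWaveguide γ ε) (hd : ∀ s, HasDerivAt θ (curvature γ s) s)
    (i : Fin 2) : ContDiffOn ℝ 1 (tubeFactor γ ε θ i) (strip : Set (ℝ × ℝ)) := by
  have hθ : ContDiff ℝ 1 θ := by
    rw [contDiff_one_iff_deriv]
    refine ⟨fun s => (hd s).differentiableAt, ?_⟩
    rw [show deriv θ = curvature γ from funext fun s => (hd s).deriv]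
    exact h.contDiff_curvature.continuous
  have hg : ContDiff ℝ 1 fun t => gaugeCoeff t i := by
    rw [contDiff_one_iff_deriv]
    refine ⟨fun s => (hasDerivAt_gaugeCoeff s i).differentiableAt, ?_⟩
    rw [show deriv (fun t => gaugeCoeff t i) = fun t => gaugeCoeff t i * gaugeSign i from
      funext fun s => (hasDerivAt_gaugeCoeff s i).deriv]
    exact (continuous_gaugeCoeff i).mul continuous_const
  have hw : ContDiff ℝ 1 (weight γ ε) := contDiff_const.mul h.contDiff_jac
  have hs : ContDiffOn ℝ 1 (fun p => Real.sqrt (weight γ ε p)) (strip : Set (ℝ × ℝ)) :=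
    hw.contDiffOn.sqrt fun p hp => (h.weight_pos hp).ne'
  exact (Complex.ofRealCLM.contDiff.comp_contDiffOn hs).mul
    (hg.comp (hθ.comp contDiff_fst)).contDiffOn

/-- Half the logarithmic derivative of J contributes -εtκ'/(2J) along s and -εκ/(2J) along t. The
phase depends on s alone and contributes ±iκ/2, the half coming from θ/2. -/
theorem fderiv_tubeFactor (h : IsWaveguide γ ε) (hd : ∀ s, HasDerivAt θ (curvature γ s) s)
    (i : Fin 2) {p : ℝ × ℝ} (hp : p ∈ strip) :
    fderiv ℝ (tubeFactor γ ε θ i) p (1, 0) = tubeFactor γ ε θ i p * logDerivS γ ε i p ∧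
      fderiv ℝ (tubeFactor γ ε θ i) p (0, 1) = tubeFactor γ ε θ i p * logDerivT γ ε p := by
  have hw : HasFDerivAt (weight γ ε) _ p := (h.hasFDerivAt_jac p).const_mul ε
  have hs := hasFDerivAt_ofReal_comp (hw.sqrt (h.weight_pos hp).ne')
  have hg : HasFDerivAt (fun p : ℝ × ℝ => gaugeCoeff (θ p.1) i) _ p :=
    (((hasDerivAt_gaugeCoeff (θ p.1) i).scomp p.1 (hd p.1)).hasFDerivAt).comp p hasFDerivAt_fst
  have e : fderiv ℝ (tubeFactor γ ε θ i) p = _ := (hs.mul hg).fderiv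
  have hJ : (jac γ ε p : ℂ) ≠ 0 := Complex.ofReal_ne_zero.2 (h.jac_pos hp).ne'
  have hr : (Real.sqrt (weight γ ε p) : ℂ) ≠ 0 :=
    Complex.ofReal_ne_zero.2 (Real.sqrt_ne_zero'.2 (h.weight_pos hp))
  have hr2 : (Real.sqrt (weight γ ε p) : ℂ) ^ 2 = ε * jac γ ε p := by
    rw [← Complex.ofReal_pow, Real.sq_sqrt (h.weight_pos hp).le, weight_eq, Complex.ofReal_mul]
  set r : ℂ := (Real.sqrt (weight γ ε p) : ℂ) with hrd
  constructor
  · rw [e, logDerivS, jac_mul_coeffB (h.jac_pos hp).ne', tubeFactor, ← hrd]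
    simp
    rw [← hrd]
    field_simp
    linear_combination (gaugeCoeff (θ p.1) i * ε * p.2 * deriv (curvature γ) p.1 : ℂ) * hr2
  · rw [e, logDerivT, coeffA_eq, tubeFactor, ← hrd]
    simp
    rw [← hrd]
    field_simp
    linear_combination -(gaugeCoeff (θ p.1) i * ε * curvature γ p.1 : ℂ) * hr2

theorem comp_tubeMap_eq (h : IsWaveguide γ ε) (hθ : Continuous θ) (u : L2 (tube h)) :
    ∀ᵐ p ∂volume.restrict (strip : Set (ℝ × ℝ)), ∀ i,
      (tubeFactor γ ε θ i p)⁻¹ * h.straighten hθ u p i = u (tubeMap γ ε p) i := by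
  filter_upwards [h.straighten_apply hθ u, ae_restrict_mem strip.isOpen.measurableSet] with p hp
    hps i
  rw [hp, inv_mul_cancel_left₀ (h.tubeFactor_ne_zero hps i)]

theorem contDiffOn_tubeFactor_inv (h : IsWaveguide γ ε)
    (hd : ∀ s, HasDerivAt θ (curvature γ s) s) (i : Fin 2) :
    ContDiffOn ℝ 1 (fun p => (tubeFactor γ ε θ i p)⁻¹) (strip : Set (ℝ × ℝ)) :=
  (h.contDiffOn_tubeFactor hd i).inv fun _ hp => h.tubeFactor_ne_zero hp i

/-- On the strip u ∘ Φ is the L² function Wu divided, component by component, by a continuous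
nonvanishing factor. -/
theorem locallyIntegrableOn_comp_tubeMap (h : IsWaveguide γ ε)
    (hd : ∀ s, HasDerivAt θ (curvature γ s) s) (u : L2 (tube h)) (i : Fin 2) :
    LocallyIntegrableOn (fun p => u (tubeMap γ ε p) i) (strip : Set (ℝ × ℝ)) := by
  have hθ : Continuous θ := continuous_iff_continuousAt.2 fun s => (hd s).continuousAt
  refine ((locallyIntegrableOn_L2_apply (h.straighten hθ u) i).continuousOn_mul
    (h.contDiffOn_tubeFactor_inv hd i).continuousOn strip.isOpen.isLocallyClosed).congr_ae_restrict
    ?_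
  filter_upwards [h.comp_tubeMap_eq hθ u] with p hp
  exact hp i

/-- The straightening map sends functions with weak derivatives on the tube to functions with weak
derivatives on the strip. -/
theorem exists_isWeakDeriv_straighten (h : IsWaveguide γ ε) (hθ : Continuous θ)
    (hd : ∀ s, HasDerivAt θ (curvature γ s) s) {u v₁ v₂ : L2 (tube h)}
    (h₁ : IsWeakDeriv (tube h) (1, 0) u v₁) (h₂ : IsWeakDeriv (tube h) (0, 1) u v₂) :
    ∃ q₁ q₂ : L2 strip, IsWeakDeriv strip (1, 0) (h.straighten hθ u) q₁ ∧
      IsWeakDeriv strip (0, 1) (h.straighten hθ u) q₂ ∧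
      ∀ᵐ p ∂volume.restrict (strip : Set (ℝ × ℝ)), ∀ i,
        q₁ p i = jac γ ε p * ((deriv γ p.1).1 * h.straighten hθ v₁ p i +
          (deriv γ p.1).2 * h.straighten hθ v₂ p i) + logDerivS γ ε i p * h.straighten hθ u p i ∧
        q₂ p i = ε * (-(deriv γ p.1).2 * h.straighten hθ v₁ p i +
          (deriv γ p.1).1 * h.straighten hθ v₂ p i) + logDerivT γ ε p * h.straighten hθ u p i := by
  have memL2 : ∀ (w : L2 strip) (i : Fin 2), MemLp (fun p => w p i) 2
      (volume.restrict (strip : Set (ℝ × ℝ))) := fun w i => (Lp.memLp w).eval_piLp i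
  -- Chain rule plus product rule, written in terms of the images of `u`, `v₁`, `v₂` under the
  -- unitary map: these are in L² and their coefficients are bounded.
  obtain ⟨q₁, hq₁⟩ := exists_L2_of_components (Ω := strip) (F := fun i p =>
    jac γ ε p * ((deriv γ p.1).1 * h.straighten hθ v₁ p i +
      (deriv γ p.1).2 * h.straighten hθ v₂ p i) + logDerivS γ ε i p * h.straighten hθ u p i)
    fun i => (memLp_two_mul h.memLp_jac ((memLp_two_mul h.memLp_deriv_fst (memL2 _ i)).add
      (memLp_two_mul h.memLp_deriv_snd (memL2 _ i)))).add
      (memLp_two_mul (h.memLp_logDerivS i) (memL2 _ i))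
  obtain ⟨q₂, hq₂⟩ := exists_L2_of_components (Ω := strip) (F := fun i p =>
    ε * (-(deriv γ p.1).2 * h.straighten hθ v₁ p i +
      (deriv γ p.1).1 * h.straighten hθ v₂ p i) + logDerivT γ ε p * h.straighten hθ u p i)
    fun i => (((memLp_two_mul h.memLp_deriv_snd.neg (memL2 _ i)).add
      (memLp_two_mul h.memLp_deriv_fst (memL2 _ i))).const_mul (ε : ℂ)).add
      (memLp_two_mul h.memLp_logDerivT (memL2 _ i))
  have hcl := strip.isOpen.isLocallyClosed
  have hxc : ContinuousOn (fun p : ℝ × ℝ => (((deriv γ p.1).1 : ℝ) : ℂ))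
      (strip : Set (ℝ × ℝ)) := (Complex.continuous_ofReal.comp
    (h.contDiff_deriv_fst.continuous.comp continuous_fst)).continuousOn
  have hyc : ContinuousOn (fun p : ℝ × ℝ => (((deriv γ p.1).2 : ℝ) : ℂ))
      (strip : Set (ℝ × ℝ)) := (Complex.continuous_ofReal.comp
    (h.contDiff_deriv_snd.continuous.comp continuous_fst)).continuousOn
  have lu := fun i => h.locallyIntegrableOn_comp_tubeMap hd u i
  have l₁ := fun i => h.locallyIntegrableOn_comp_tubeMap hd v₁ i
  have l₂ := fun i => h.locallyIntegrableOn_comp_tubeMap hd v₂ i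
  refine ⟨q₁, q₂, isWeakDeriv_of_weakPartial fun i => ?_, isWeakDeriv_of_weakPartial fun i => ?_,
    ?_⟩
  · have k := (h.weakPartial_comp_tubeMap_fst (locallyIntegrableOn_L2_apply u i)
      (locallyIntegrableOn_L2_apply v₁ i) (locallyIntegrableOn_L2_apply v₂ i)
      (h₁.weakPartial i) (h₂.weakPartial i)).mul (lu i)
      ((((l₁ i).continuousOn_mul hxc hcl).add ((l₂ i).continuousOn_mul hyc hcl)).continuousOn_mul
        h.contDiff_ofReal_jac.continuous.continuousOn hcl) (h.contDiffOn_tubeFactor hd i)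
    refine k.congr ?_ ?_
    · filter_upwards [h.straighten_apply hθ u] with p hp
      rw [hp]
    · filter_upwards [hq₁, h.straighten_apply hθ u, h.straighten_apply hθ v₁,
        h.straighten_apply hθ v₂, ae_restrict_mem strip.isOpen.measurableSet] with p e0 e1 e2 e3 hp
      rw [e0, e1, e2, e3, (h.fderiv_tubeFactor hd i hp).1]
      ring
  · have k := (h.weakPartial_comp_tubeMap_snd (locallyIntegrableOn_L2_apply u i)
      (locallyIntegrableOn_L2_apply v₁ i) (locallyIntegrableOn_L2_apply v₂ i)
      (h₁.weakPartial i) (h₂.weakPartial i)).mul (lu i)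
      ((((l₁ i).continuousOn_mul hyc.neg hcl).add
        ((l₂ i).continuousOn_mul hxc hcl)).continuousOn_mul
        continuousOn_const hcl) (h.contDiffOn_tubeFactor hd i)
    refine k.congr ?_ ?_
    · filter_upwards [h.straighten_apply hθ u] with p hp
      rw [hp]
    · filter_upwards [hq₂, h.straighten_apply hθ u, h.straighten_apply hθ v₁,
        h.straighten_apply hθ v₂, ae_restrict_mem strip.isOpen.measurableSet] with p e0 e1 e2 e3 hp
      rw [e0, e1, e2, e3, (h.fderiv_tubeFactor hd i hp).2]
      ring
  · filter_upwards [hq₁, hq₂] with p e1 e2 i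
    exact ⟨e1 i, e2 i⟩

/-- A function on the tube has weak derivatives if its image under the straightening map has. -/
theorem exists_isWeakDeriv_of_straighten (h : IsWaveguide γ ε) (hθ : Continuous θ)
    (hd : ∀ s, HasDerivAt θ (curvature γ s) s) {u : L2 (tube h)} {q₁ q₂ : L2 strip}
    (h₁ : IsWeakDeriv strip (1, 0) (h.straighten hθ u) q₁)
    (h₂ : IsWeakDeriv strip (0, 1) (h.straighten hθ u) q₂) (e : ℝ × ℝ) :
    ∃ v : L2 (tube h), IsWeakDeriv (tube h) e u v := by
  have memL2 : ∀ (w : L2 strip) (i : Fin 2), MemLp (fun p => w p i) 2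
      (volume.restrict (strip : Set (ℝ × ℝ))) := fun w i => (Lp.memLp w).eval_piLp i
  set U := h.straighten hθ u with hU
  -- This is what the image of ∂_e u must be: subtracting the logarithmic derivatives undoes the
  -- product rule, and ∂_e = J⁻¹(γ'·e)∂_s + ε⁻¹(ν·e)∂_t. Surjectivity of the unitary map then
  -- supplies the derivative itself.
  obtain ⟨z, hz⟩ := exists_L2_of_components (Ω := strip) (F := fun i p =>
    coeffA γ ε p * (((deriv γ p.1).1 * e.1 + (deriv γ p.1).2 * e.2) *
      (q₁ p i - logDerivS γ ε i p * U p i)) + (ε : ℂ)⁻¹ *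
    ((-(deriv γ p.1).2 * e.1 + (deriv γ p.1).1 * e.2) * (q₂ p i - logDerivT γ ε p * U p i)))
    fun i => (memLp_two_mul (memLp_coeffA h) (memLp_two_mul
      ((memLp_top_mul h.memLp_deriv_fst (memLp_top_const _)).add
        (memLp_top_mul h.memLp_deriv_snd (memLp_top_const _)))
      ((memL2 _ i).sub (memLp_two_mul (h.memLp_logDerivS i) (memL2 _ i))))).add
      ((memLp_two_mul ((memLp_top_mul h.memLp_deriv_snd.neg (memLp_top_const _)).add
        (memLp_top_mul h.memLp_deriv_fst (memLp_top_const _)))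
      ((memL2 _ i).sub (memLp_two_mul h.memLp_logDerivT (memL2 _ i)))).const_mul (ε : ℂ)⁻¹)
  obtain ⟨v, rfl⟩ := (h.straighten hθ).surjective z
  refine ⟨v, isWeakDeriv_of_weakPartial fun i => ?_⟩
  have hcl := strip.isOpen.isLocallyClosed
  have hinv := h.contDiffOn_tubeFactor_inv hd i
  have hfc : ∀ e : ℝ × ℝ, ContinuousOn (fun p => fderiv ℝ (fun p => (tubeFactor γ ε θ i p)⁻¹) p e)
      (strip : Set (ℝ × ℝ)) := fun e =>
    (hinv.continuousOn_fderiv_of_isOpen strip.isOpen le_rfl).clm_apply continuousOn_const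
  have lU := locallyIntegrableOn_L2_apply U i
  have l₁ := locallyIntegrableOn_L2_apply q₁ i
  have l₂ := locallyIntegrableOn_L2_apply q₂ i
  have hUu : (fun p => (tubeFactor γ ε θ i p)⁻¹ * U p i)
      =ᵐ[volume.restrict (strip : Set (ℝ × ℝ))] fun p => u (tubeMap γ ε p) i := by
    filter_upwards [h.comp_tubeMap_eq hθ u] with p hp
    exact hp i
  have k₁ := ((h₁.weakPartial i).mul lU l₁ hinv).congr hUu (ae_eq_refl _)
  have k₂ := ((h₂.weakPartial i).mul lU l₂ hinv).congr hUu (ae_eq_refl _)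
  refine h.weakPartial_of_comp_tubeMap (h.locallyIntegrableOn_comp_tubeMap hd u i)
    ((l₁.continuousOn_mul hinv.continuousOn hcl).add (lU.continuousOn_mul (hfc _) hcl))
    ((l₂.continuousOn_mul hinv.continuousOn hcl).add (lU.continuousOn_mul (hfc _) hcl)) k₁ k₂ ?_
  filter_upwards [hz, h.comp_tubeMap_eq hθ v, ae_restrict_mem strip.isOpen.measurableSet] with p
    e1 e2 hp
  have hm := h.tubeFactor_ne_zero (θ := θ) hp i
  have hJ : (jac γ ε p : ℂ) ≠ 0 := Complex.ofReal_ne_zero.2 (h.jac_pos hp).ne'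
  have hε : (ε : ℂ) ≠ 0 := Complex.ofReal_ne_zero.2 h.eps_pos.ne'
  have hmd : DifferentiableAt ℝ (tubeFactor γ ε θ i) p :=
    ((h.contDiffOn_tubeFactor hd i).contDiffAt (strip.isOpen.mem_nhds hp)).differentiableAt
      (by simp)
  have hi : ∀ w, fderiv ℝ (fun p => (tubeFactor γ ε θ i p)⁻¹) p w =
      -(((tubeFactor γ ε θ i p) ^ 2)⁻¹ * fderiv ℝ (tubeFactor γ ε θ i) p w) := by
    intro w
    have : fderiv ℝ (fun p => (tubeFactor γ ε θ i p)⁻¹) p = _ :=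
      ((hasDerivAt_inv hm).hasFDerivAt.restrictScalars ℝ |>.comp p hmd.hasFDerivAt).fderiv
    rw [this]
    simp
    ring
  simp only [Pi.add_apply]
  rw [← e2 i, e1 i, hi, hi, (h.fderiv_tubeFactor hd i hp).1, (h.fderiv_tubeFactor hd i hp).2,
    weight_eq, coeffA_eq, Complex.ofReal_mul]
  field_simp
  ring

end IsWaveguide

/-! ### Traces under the straightening map -/

theorem norm_eq_of_apply_eq_mul {v z : Spinor} {β : Fin 2 → ℂ} (hβ : ∀ i, ‖β i‖ = 1)
    (h : ∀ i, v i = β i * z i) : ‖v‖ = ‖z‖ := by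
  rw [EuclideanSpace.norm_eq, EuclideanSpace.norm_eq]
  simp_rw [h, norm_mul, hβ, one_mul]

/-- Multiplication by uniformly converging factors and by fixed phases preserves convergence
in `L²`. -/
theorem tendsto_eLpNorm_sub_of_factor {ι : Type*} {l : Filter ι} {c : ι → ℝ → ℝ} {c₀ : ℝ → ℝ}
    {β : ℝ → Fin 2 → ℂ} {f F : ι → ℝ → Spinor} {g G : ℝ → Spinor} {C : ℝ} {δ : ι → ℝ}
    (hf : ∀ k, AEStronglyMeasurable (f k) volume) (hg : MemLp g 2 volume)
    (hβ : ∀ s i, ‖β s i‖ = 1) (hC : ∀ᶠ k in l, ∀ s, |c k s| ≤ C)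
    (hδ : ∀ᶠ k in l, ∀ s, |c k s - c₀ s| ≤ δ k) (hδ0 : Tendsto δ l (𝓝 0))
    (hF : ∀ᶠ k in l, ∀ s i, F k s i = c k s * β s i * f k s i)
    (hG : ∀ᵐ s, ∀ i, G s i = c₀ s * β s i * g s i)
    (hlim : Tendsto (fun k => eLpNorm (fun s => f k s - g s) 2 volume) l (𝓝 0)) :
    Tendsto (fun k => eLpNorm (fun s => F k s - G s) 2 volume) l (𝓝 0) := by
  have hbound : ∀ᶠ k in l, eLpNorm (fun s => F k s - G s) 2 volume ≤
      ‖C‖ₑ * eLpNorm (fun s => f k s - g s) 2 volume + ‖δ k‖ₑ * eLpNorm g 2 volume := by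
    filter_upwards [hC, hδ, hF] with k hCk hδk hFk
    -- Up to phases, F - G = c(f - g) + (c - c₀)g: a bounded multiple of a null sequence, plus a
    -- uniformly small multiple of a fixed L² function.
    have hpt : ∀ᵐ s, ‖F k s - G s‖ ≤ C * ‖f k s - g s‖ + δ k * ‖g s‖ := by
      filter_upwards [hG] with s hGs
      have e : ‖F k s - G s‖ =
          ‖(c k s : ℂ) • (f k s - g s) + ((c k s - c₀ s : ℝ) : ℂ) • g s‖ := by
        refine norm_eq_of_apply_eq_mul (hβ s) fun i => ?_
        simp only [PiLp.sub_apply, PiLp.add_apply, PiLp.smul_apply, smul_eq_mul, hFk s i, hGs i]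
        push_cast
        ring
      rw [e]
      refine (norm_add_le _ _).trans (add_le_add ?_ ?_)
      · rw [norm_smul, Complex.norm_real]
        exact mul_le_mul_of_nonneg_right (hCk s) (norm_nonneg _)
      · rw [norm_smul, Complex.norm_real]
        exact mul_le_mul_of_nonneg_right (hδk s) (norm_nonneg _)
    have hm : AEStronglyMeasurable (fun s => f k s - g s) volume := (hf k).sub hg.1
    refine (eLpNorm_mono_ae_real hpt).trans ?_
    refine (eLpNorm_add_le (f := fun s => C * ‖f k s - g s‖) (g := fun s => δ k * ‖g s‖)
      (hm.norm.const_mul C) (hg.1.norm.const_mul (δ k)) (by norm_num)).trans (le_of_eq ?_)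
    rw [show (fun s => C * ‖f k s - g s‖) = C • fun s => ‖f k s - g s‖ from rfl,
      show (fun s => δ k * ‖g s‖) = δ k • fun s => ‖g s‖ from rfl, eLpNorm_const_smul,
      eLpNorm_const_smul, eLpNorm_norm, eLpNorm_norm]
  have h1 : Tendsto (fun k => ‖C‖ₑ * eLpNorm (fun s => f k s - g s) 2 volume) l (𝓝 0) := by
    have := ENNReal.Tendsto.const_mul (a := ‖C‖ₑ) hlim (Or.inr (by simp))
    rwa [mul_zero] at this
  have h2 : Tendsto (fun k => ‖δ k‖ₑ * eLpNorm g 2 volume) l (𝓝 0) := by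
    have hδe : Tendsto (fun k => ‖δ k‖ₑ) l (𝓝 0) := by
      have := hδ0.enorm
      rwa [enorm_zero] at this
    have := ENNReal.Tendsto.mul_const (b := eLpNorm g 2 volume) hδe (Or.inr hg.2.ne)
    rwa [zero_mul] at this
  have h3 := h1.add h2
  rw [add_zero] at h3
  exact tendsto_of_tendsto_of_tendsto_of_le_of_le' tendsto_const_nhds h3
    (Eventually.of_forall fun _ => zero_le) hbound

/-- Factor a - b = (√a - √b)(√a + √b) and use |√a - √b| ≤ √a + √b. No lower bound on `a` or `b` is
required. -/
theorem _root_.Real.abs_sqrt_sub_sqrt_le {a b : ℝ} (ha : 0 ≤ a) (hb : 0 ≤ b) :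
    |Real.sqrt a - Real.sqrt b| ≤ Real.sqrt |a - b| := by
  refine Real.le_sqrt_of_sq_le ?_
  have e : a - b = (Real.sqrt a - Real.sqrt b) * (Real.sqrt a + Real.sqrt b) := by
    nth_rewrite 1 [← Real.sq_sqrt ha, ← Real.sq_sqrt hb]
    ring
  have h1 : |Real.sqrt a - Real.sqrt b| ≤ |Real.sqrt a + Real.sqrt b| := by
    have := Real.sqrt_nonneg a
    have := Real.sqrt_nonneg b
    rw [abs_of_nonneg (by positivity : 0 ≤ Real.sqrt a + Real.sqrt b), abs_le]
    constructor <;> linarith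
  rw [e, abs_mul, pow_two]
  exact mul_le_mul_of_nonneg_left h1 (abs_nonneg _)

theorem exists_memLp_line {G : Fin 2 → ℝ → ℂ} (hG : ∀ i, MemLp (G i) 2 (volume : Measure ℝ)) :
    ∃ g : Lp Spinor 2 (volume : Measure ℝ), ∀ᵐ s, ∀ i, g s i = G i s := by
  have h : MemLp (fun s => (WithLp.toLp 2 fun i => G i s : Spinor)) 2 (volume : Measure ℝ) :=
    MemLp.of_eval_piLp hG
  refine ⟨h.toLp, ?_⟩
  filter_upwards [h.coeFn_toLp] with p hp i
  rw [hp]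

namespace IsWaveguide

variable {γ : ℝ → ℝ × ℝ} {ε : ℝ} {θ : ℝ → ℝ}

/-- The closed range |t| ≤ 1 is needed, since the traces live on the sides t = ±1. -/
theorem weight_bounds (h : IsWaveguide γ ε) (s : ℝ) {t : ℝ} (ht : |t| ≤ 1) :
    ε / 2 ≤ weight γ ε (s, t) ∧ weight γ ε (s, t) ≤ 2 * ε := by
  have hε := h.eps_pos
  have h1 : |curvature γ s| ≤ ⨆ s, |curvature γ s| := le_ciSup h.bddAbove_curvature s
  have h2 : |ε * t * curvature γ s| ≤ ε * 1 * ⨆ s, |curvature γ s| := by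
    rw [abs_mul, abs_mul, abs_of_pos hε]
    gcongr
  have h3 := abs_le.1 h2
  have h4 := h.eps_lt
  have h5 : 1 / 2 ≤ 1 - ε * t * curvature γ s := by linarith
  have h6 : 1 - ε * t * curvature γ s ≤ 2 := by linarith
  simp only [weight]
  constructor <;> nlinarith

theorem abs_sqrt_weight_sub_le (h : IsWaveguide γ ε) (s : ℝ) {t t' : ℝ} (ht : |t| ≤ 1)
    (ht' : |t'| ≤ 1) : |Real.sqrt (weight γ ε (s, t)) - Real.sqrt (weight γ ε (s, t'))| ≤
      Real.sqrt (ε ^ 2 * (⨆ s, |curvature γ s|) * |t - t'|) := by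
  have hε := h.eps_pos
  have h1 : |curvature γ s| ≤ ⨆ s, |curvature γ s| := le_ciSup h.bddAbove_curvature s
  refine (Real.abs_sqrt_sub_sqrt_le (by linarith [(h.weight_bounds s ht).1])
    (by linarith [(h.weight_bounds s ht').1])).trans (Real.sqrt_le_sqrt ?_)
  have e : weight γ ε (s, t) - weight γ ε (s, t') = -(ε ^ 2 * curvature γ s * (t - t')) := by
    simp only [weight]
    ring
  rw [e, abs_neg, abs_mul, abs_mul, abs_of_nonneg (sq_nonneg ε)]
  gcongr

theorem memLp_line_mul {a : ℝ → ℂ} {f : ℝ → ℂ} {C : ℝ} (ha : Measurable a) (hC : ∀ s, ‖a s‖ ≤ C)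
    (hf : MemLp f 2 (volume : Measure ℝ)) : MemLp (fun s => a s * f s) 2 (volume : Measure ℝ) :=
  hf.mul (memLp_top_of_bound ha.aestronglyMeasurable C (Eventually.of_forall hC))

theorem norm_tubeFactor (i : Fin 2) (p : ℝ × ℝ) :
    ‖tubeFactor γ ε θ i p‖ = Real.sqrt (weight γ ε p) := by
  rw [tubeFactor, norm_mul, norm_gaugeCoeff, mul_one, Complex.norm_real,
    Real.norm_of_nonneg (Real.sqrt_nonneg _)]

/-- Depth `r` below a side of the strip is depth `ε * r` below the corresponding side of the tube,
so approach to the boundary is only rescaled. -/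
theorem tubeMap_side (τ r s : ℝ) : tubeMap γ ε (s, τ * (1 - r)) =
    γ s + (τ * ε) • normal γ s + (ε * r) • (-τ • normal γ s) := by
  ext <;> simp [tubeMap] <;> ring

theorem abs_side {τ r : ℝ} (hτ : |τ| = 1) (h0 : 0 < r) (h1 : r < 1) : |τ * (1 - r)| < 1 := by
  rw [abs_mul, hτ, one_mul, abs_of_pos (by linarith)]
  linarith

theorem abs_side_sub {τ r : ℝ} (hτ : |τ| = 1) (h0 : 0 < r) : |τ * (1 - r) - τ| = r := by
  rw [show τ * (1 - r) - τ = -(τ * r) by ring, abs_neg, abs_mul, hτ, one_mul, abs_of_pos h0]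

theorem tendsto_sqrt_const_mul (a : ℝ) : Tendsto (fun r : ℝ => Real.sqrt (a * r)) (𝓝[>] 0) (𝓝 0) := by
  have : Tendsto (fun r : ℝ => Real.sqrt (a * r)) (𝓝 0) (𝓝 (Real.sqrt (a * 0))) :=
    (Real.continuous_sqrt.comp (continuous_const.mul continuous_id)).tendsto 0
  rw [mul_zero, Real.sqrt_zero] at this
  exact this.mono_left nhdsWithin_le_nhds

theorem tendsto_const_mul_nhdsGT_zero {a : ℝ} (ha : 0 < a) :
    Tendsto (fun r : ℝ => a * r) (𝓝[>] 0) (𝓝[>] 0) := by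
  refine tendsto_nhdsWithin_iff.2 ⟨?_, eventually_mem_nhdsWithin.mono fun r hr => mul_pos ha hr⟩
  have : Tendsto (fun r : ℝ => a * r) (𝓝 0) (𝓝 (a * 0)) := tendsto_id.const_mul a
  rw [mul_zero] at this
  exact this.mono_left nhdsWithin_le_nhds

theorem measurable_tubeFactor_side (h : IsWaveguide γ ε) (hθ : Continuous θ) (i : Fin 2) (τ : ℝ) :
    Measurable fun s => tubeFactor γ ε θ i (s, τ) :=
  (h.measurable_tubeFactor hθ i).comp (measurable_id.prodMk measurable_const)

/-- The trace of a straightened function. -/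
theorem hasTrace_straighten (h : IsWaveguide γ ε) (hθ : Continuous θ) {τ : ℝ} (hτ : |τ| = 1)
    {u : L2 (tube h)} {g : Lp Spinor 2 (volume : Measure ℝ)}
    (hg : HasTrace (tube h) (fun s => γ s + (τ * ε) • normal γ s) (fun s => -τ • normal γ s) u g) :
    ∃ g', HasTrace strip (fun s => (s, τ)) (fun _ => (0, -τ)) (h.straighten hθ u) g' ∧
      ∀ᵐ s, ∀ i, g' s i = tubeFactor γ ε θ i (s, τ) * g s i := by
  obtain ⟨w, hw, hwu, hl⟩ := hg
  obtain ⟨g', hg'⟩ := exists_memLp_line (G := fun i s => tubeFactor γ ε θ i (s, τ) * g s i)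
    fun i => memLp_line_mul (C := Real.sqrt (2 * ε)) (h.measurable_tubeFactor_side hθ i τ)
      (fun s => by
        rw [norm_tubeFactor]
        exact Real.sqrt_le_sqrt (h.weight_bounds s hτ.le).2) ((Lp.memLp g).eval_piLp i)
  have hν : Continuous (normal γ) := h.contDiff_normal.continuous
  refine ⟨g', ⟨straightenFun γ ε θ w, (h.measurable_straightenFun hθ hw.measurable).stronglyMeasurable,
    (h.straightenFun_congr hwu).trans (h.straighten_coeFn hθ u).symm, ?_⟩, hg'⟩
  -- The phase is the same at every depth; only the square root of the weight varies, and it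
  -- converges uniformly in s.
  refine tendsto_eLpNorm_sub_of_factor (C := Real.sqrt (2 * ε))
    (c := fun r s => Real.sqrt (weight γ ε (s, τ * (1 - r))))
    (c₀ := fun s => Real.sqrt (weight γ ε (s, τ))) (β := fun s i => gaugeCoeff (θ s) i)
    (δ := fun r => Real.sqrt (ε ^ 2 * (⨆ s, |curvature γ s|) * r))
    (f := fun r s => w (γ s + (τ * ε) • normal γ s + (ε * r) • (-τ • normal γ s)))
    (fun r => ?_) (Lp.memLp g) (fun s i => norm_gaugeCoeff _ _) ?_ ?_ (tendsto_sqrt_const_mul _) ?_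
    ?_ (hl.comp (tendsto_const_mul_nhdsGT_zero h.eps_pos))
  · refine (hw.comp_measurable (Continuous.measurable ?_)).aestronglyMeasurable
    exact (h.contDiff.continuous.add (hν.const_smul (τ * ε))).add
      ((hν.const_smul (-τ)).const_smul (ε * r))
  · filter_upwards [Ioo_mem_nhdsGT one_pos] with r hr s
    rw [abs_of_nonneg (Real.sqrt_nonneg _)]
    exact Real.sqrt_le_sqrt (h.weight_bounds s (abs_side hτ hr.1 hr.2).le).2
  · filter_upwards [Ioo_mem_nhdsGT one_pos] with r hr s
    have := h.abs_sqrt_weight_sub_le s (abs_side hτ hr.1 hr.2).le hτ.le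
    rwa [abs_side_sub hτ hr.1] at this
  · refine Eventually.of_forall fun r s i => ?_
    have e : ((s, τ) : ℝ × ℝ) + r • ((0, -τ) : ℝ × ℝ) = (s, τ * (1 - r)) := by
      ext
      · simp
      · simp
        ring
    rw [e, straightenFun_apply, tubeMap_side, tubeFactor]
  · filter_upwards [hg'] with s hs i
    rw [hs i, tubeFactor]

/-- The trace of a function on the tube, recovered from its straightened version. -/
theorem hasTrace_of_straighten (h : IsWaveguide γ ε) (hθ : Continuous θ) {τ : ℝ} (hτ : |τ| = 1)
    {u : L2 (tube h)} {g' : Lp Spinor 2 (volume : Measure ℝ)}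
    (hg' : HasTrace strip (fun s => (s, τ)) (fun _ => (0, -τ)) (h.straighten hθ u) g') :
    ∃ g, HasTrace (tube h) (fun s => γ s + (τ * ε) • normal γ s) (fun s => -τ • normal γ s) u g ∧
      ∀ᵐ s, ∀ i, g' s i = tubeFactor γ ε θ i (s, τ) * g s i := by
  obtain ⟨w, hw, hwu, hl⟩ := hg'
  have hε := h.eps_pos
  have hsqrt : ∀ s {t : ℝ}, |t| ≤ 1 → Real.sqrt (ε / 2) ≤ Real.sqrt (weight γ ε (s, t)) :=
    fun s t ht => Real.sqrt_le_sqrt (h.weight_bounds s ht).1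
  have hs0 : 0 < Real.sqrt (ε / 2) := Real.sqrt_pos.2 (by linarith)
  obtain ⟨g, hg⟩ := exists_memLp_line (G := fun i s => (tubeFactor γ ε θ i (s, τ))⁻¹ * g' s i)
    fun i => memLp_line_mul (C := (Real.sqrt (ε / 2))⁻¹) (h.measurable_tubeFactor_side hθ i τ).inv
      (fun s => by
        rw [norm_inv, norm_tubeFactor]
        exact inv_anti₀ hs0 (hsqrt s hτ.le)) ((Lp.memLp g').eval_piLp i)
  set f : ℝ × ℝ → Spinor := fun x => WithLp.toLp 2 fun i =>
    (tubeFactor γ ε θ i (tubeInv γ ε x))⁻¹ * w (tubeInv γ ε x) i with hf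
  have hfm : Measurable f := by
    refine measurable_spinor fun i => ?_
    refine ((h.measurable_tubeFactor hθ i).comp h.measurable_tubeInv).inv.mul ?_
    exact (measurable_spinor_apply i).comp (hw.measurable.comp h.measurable_tubeInv)
  have hfu : f =ᵐ[volume.restrict (tube h : Set (ℝ × ℝ))] u := by
    filter_upwards [h.quasiMeasurePreserving_tubeInv.ae hwu,
      h.quasiMeasurePreserving_tubeInv.ae (h.straighten_apply hθ u),
      ae_restrict_mem (tube h).isOpen.measurableSet] with x h1 h2 hx
    ext i
    simp only [hf]
    rw [h1, h2 i, inv_mul_cancel_left₀ (h.tubeFactor_ne_zero (tubeInv_mem hx) i),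
      tubeMap_tubeInv hx]
  have hlim := hl.comp (tendsto_const_mul_nhdsGT_zero (inv_pos.2 hε))
  have hδ0 : Tendsto (fun r => Real.sqrt (ε ^ 2 * (⨆ s, |curvature γ s|) * (ε⁻¹ * r)) /
      (ε / 2)) (𝓝[>] 0) (𝓝 0) := by
    have := ((tendsto_sqrt_const_mul (ε ^ 2 * (⨆ s, |curvature γ s|))).comp
      (tendsto_const_mul_nhdsGT_zero (inv_pos.2 hε))).div_const (ε / 2)
    rwa [zero_div] at this
  -- For depth r < ε in the tube the corresponding point lies in the open strip, where `tubeInv`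
  -- inverts Φ.
  have hr1 : ∀ r ∈ Ioo 0 ε, 0 < ε⁻¹ * r ∧ ε⁻¹ * r < 1 := fun r hr =>
    ⟨mul_pos (inv_pos.2 hε) hr.1, by rw [inv_mul_lt_iff₀ hε, mul_one]; exact hr.2⟩
  refine ⟨g, ⟨f, hfm.stronglyMeasurable, hfu, ?_⟩, ?_⟩
  · refine tendsto_eLpNorm_sub_of_factor (C := (Real.sqrt (ε / 2))⁻¹)
      (c := fun r s => (Real.sqrt (weight γ ε (s, τ * (1 - ε⁻¹ * r))))⁻¹)
      (c₀ := fun s => (Real.sqrt (weight γ ε (s, τ)))⁻¹)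
      (β := fun s i => (gaugeCoeff (θ s) i)⁻¹)
      (δ := fun r => Real.sqrt (ε ^ 2 * (⨆ s, |curvature γ s|) * (ε⁻¹ * r)) / (ε / 2))
      (f := fun r s => w ((s, τ) + (ε⁻¹ * r) • ((0, -τ) : ℝ × ℝ)))
      (fun r => ?_) (Lp.memLp g') (fun s i => by rw [norm_inv, norm_gaugeCoeff, inv_one]) ?_ ?_ hδ0
      ?_ ?_ hlim
    · exact (hw.comp_measurable (by fun_prop)).aestronglyMeasurable
    · filter_upwards [Ioo_mem_nhdsGT hε] with r hr s
      obtain ⟨k0, k1⟩ := hr1 r hr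
      rw [abs_of_nonneg (inv_nonneg.2 (Real.sqrt_nonneg _))]
      exact inv_anti₀ hs0 (hsqrt s (abs_side hτ k0 k1).le)
    · filter_upwards [Ioo_mem_nhdsGT hε] with r hr s
      obtain ⟨k0, k1⟩ := hr1 r hr
      have k2 := h.abs_sqrt_weight_sub_le s (abs_side hτ k0 k1).le hτ.le
      rw [abs_side_sub hτ k0] at k2
      have a1 := hsqrt s (abs_side hτ k0 k1).le
      have a2 := hsqrt s hτ.le
      -- A lower bound for the product of the roots converts the estimate for their difference into
      -- one for the difference of their reciprocals.
      have a3 : ε / 2 ≤ Real.sqrt (weight γ ε (s, τ * (1 - ε⁻¹ * r))) *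
          Real.sqrt (weight γ ε (s, τ)) := by
        rw [← Real.mul_self_sqrt (by linarith : 0 ≤ ε / 2)]
        exact mul_le_mul a1 a2 hs0.le (hs0.le.trans a1)
      rw [inv_sub_inv (hs0.trans_le a1).ne' (hs0.trans_le a2).ne', abs_div, abs_sub_comm,
        abs_of_pos (mul_pos (hs0.trans_le a1) (hs0.trans_le a2))]
      exact div_le_div₀ (Real.sqrt_nonneg _) k2 (by linarith) a3
    · filter_upwards [Ioo_mem_nhdsGT hε] with r hr s i
      obtain ⟨k0, k1⟩ := hr1 r hr
      have e : ((s, τ) : ℝ × ℝ) + (ε⁻¹ * r) • ((0, -τ) : ℝ × ℝ) = (s, τ * (1 - ε⁻¹ * r)) := by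
        ext
        · simp
        · simp
          ring
      have hp : ((s, τ * (1 - ε⁻¹ * r)) : ℝ × ℝ) ∈ strip :=
        ⟨mem_univ _, abs_lt.1 (abs_side hτ k0 k1)⟩
      have e2 : γ s + (τ * ε) • normal γ s + r • (-τ • normal γ s) =
          tubeMap γ ε (s, τ * (1 - ε⁻¹ * r)) := by
        rw [tubeMap_side, mul_inv_cancel_left₀ hε.ne']
      rw [e, e2]
      simp only [hf, h.tubeInv_tubeMap hp, tubeFactor, mul_inv, Complex.ofReal_inv]
    · filter_upwards [hg] with s hs i
      rw [hs i, tubeFactor, mul_inv, Complex.ofReal_inv]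
  · filter_upwards [hg] with s hs i
    have : tubeFactor γ ε θ i (s, τ) ≠ 0 := by
      rw [← norm_ne_zero_iff, norm_tubeFactor]
      exact (hs0.trans_le (hsqrt s hτ.le)).ne'
    rw [hs i, mul_inv_cancel_left₀ this]

/-- The infinite mass boundary condition in the straightened picture. -/
theorem boundary_condition_iff (h : IsWaveguide γ ε) {τ : ℝ} (hτ : |τ| = 1) {s : ℝ}
    (hn : ((normal γ s).1 : ℂ) + Complex.I * ((normal γ s).2 : ℂ) =
      Complex.exp (Complex.I * (θ s : ℂ))) {g g' : Spinor}
    (hg : ∀ i, g' i = tubeFactor γ ε θ i (s, τ) * g i) :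
    act (-Complex.I • (σ₃ * sigmaDot (τ • normal γ s))) g = g ↔ g' 1 = -(τ : ℂ) * g' 0 := by
  have hw : (Real.sqrt (weight γ ε (s, τ)) : ℂ) ≠ 0 := by
    refine Complex.ofReal_ne_zero.2 (Real.sqrt_ne_zero'.2 ?_)
    linarith [(h.weight_bounds s hτ.le).1, h.eps_pos]
  have hg1 := gaugeCoeff_ne_zero (θ s) 1
  have hu : (((deriv γ s).1 : ℂ)) ^ 2 + ((deriv γ s).2 : ℂ) ^ 2 = 1 := by
    exact_mod_cast h.unit_speed s
  have hτ2 : (τ : ℂ) ^ 2 = 1 := by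
    have : τ ^ 2 = 1 := by rw [← sq_abs, hτ, one_pow]
    exact_mod_cast this
  have h0 : gaugeCoeff (θ s) 0 = ((deriv γ s).1 + Complex.I * (deriv γ s).2) *
      gaugeCoeff (θ s) 1 := gaugeCoeff_zero_eq (by rw [← hn]; simp [normal])
  have hI := Complex.I_sq
  -- The boundary matrix is off-diagonal with entries -τ(x - iy) and -τ(x + iy), where γ' = (x, y).
  -- Their product is 1, so either of the two scalar equations implies the other.
  have c0 : act (-Complex.I • (σ₃ * sigmaDot (τ • normal γ s))) g 0 =
      -(τ : ℂ) * ((deriv γ s).1 - Complex.I * (deriv γ s).2) * g 1 := by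
    rw [act_apply]
    simp [σ₃, sigmaDot, σ₁, σ₂, normal]
    left
    linear_combination -(τ * (deriv γ s).1 : ℂ) * hI
  have c1 : act (-Complex.I • (σ₃ * sigmaDot (τ • normal γ s))) g 1 =
      -(τ : ℂ) * ((deriv γ s).1 + Complex.I * (deriv γ s).2) * g 0 := by
    rw [act_apply]
    simp [σ₃, sigmaDot, σ₁, σ₂, normal]
    left
    linear_combination -(τ * (deriv γ s).1 : ℂ) * hI
  have key : g' 1 = -(τ : ℂ) * g' 0 ↔
      -(τ : ℂ) * ((deriv γ s).1 + Complex.I * (deriv γ s).2) * g 0 = g 1 := by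
    rw [hg 0, hg 1, tubeFactor, tubeFactor]
    simp only [h0]
    constructor
    · intro hh
      refine mul_left_cancel₀ (mul_ne_zero hw hg1) ?_
      linear_combination -hh
    · intro hh
      linear_combination -(Real.sqrt (weight γ ε (s, τ)) * gaugeCoeff (θ s) 1 : ℂ) * hh
  rw [key]
  constructor
  · intro hh
    rw [← c1, hh]
  · intro hh
    ext i
    fin_cases i
    · change act _ g 0 = g 0
      rw [c0, ← hh]
      linear_combination (τ ^ 2 * g 0 : ℂ) * hu + g 0 * hτ2 -
        (τ ^ 2 * (deriv γ s).2 ^ 2 * g 0 : ℂ) * hI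
    · change act _ g 1 = g 1
      rw [c1, hh]

end IsWaveguide

/-! ### Unitary equivalence -/

theorem matOp_apply {Ω : TopologicalSpace.Opens (ℝ × ℝ)} (M : Matrix (Fin 2) (Fin 2) ℂ)
    (u : L2 Ω) : ∀ᵐ p ∂volume.restrict (Ω : Set (ℝ × ℝ)), ∀ i,
      matOp Ω M u p i = M i 0 * u p 0 + M i 1 * u p 1 := by
  filter_upwards [(act M).coeFn_compLpL (p := 2) u] with p hp i
  rw [← act_apply, ← hp]
  rfl

theorem mulOp_apply {Ω : TopologicalSpace.Opens (ℝ × ℝ)} {a : ℝ × ℝ → ℂ}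
    (ha : MemLp a ⊤ (volume.restrict (Ω : Set (ℝ × ℝ)))) (u : L2 Ω) :
    ∀ᵐ p ∂volume.restrict (Ω : Set (ℝ × ℝ)), ∀ i, mulOp a ha u p i = a p * u p i := by
  have h := (ContinuousLinearMap.lsmul ℂ ℂ).coeFn_holder (r := 2) (ha.toLp a) u
  filter_upwards [h, ha.coeFn_toLp] with p hp hap i
  change ((ContinuousLinearMap.lsmul ℂ ℂ).holder 2 (ha.toLp a) u) p i = _
  rw [hp, hap]
  rfl

theorem isWeakDeriv_pd₁ {Ω : TopologicalSpace.Opens (ℝ × ℝ)} (u : H1 Ω) :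
    IsWeakDeriv Ω (1, 0) u (pd₁ Ω u) :=
  weakDeriv_spec (Submodule.inclusion inf_le_left u)

theorem isWeakDeriv_pd₂ {Ω : TopologicalSpace.Opens (ℝ × ℝ)} (u : H1 Ω) :
    IsWeakDeriv Ω (0, 1) u (pd₂ Ω u) :=
  weakDeriv_spec (Submodule.inclusion inf_le_right u)

theorem mem_H1_iff {Ω : TopologicalSpace.Opens (ℝ × ℝ)} {u : L2 Ω} :
    u ∈ H1 Ω ↔ (∃ v, IsWeakDeriv Ω (1, 0) u v) ∧ ∃ v, IsWeakDeriv Ω (0, 1) u v :=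
  Iff.rfl

/-- The Dirac operator in terms of components. -/
theorem diracOp_apply {γ : ℝ → ℝ × ℝ} {ε : ℝ} (h : IsWaveguide γ ε) (m : ℝ)
    (u : (diracOp h m).domain) {v₁ v₂ : L2 (tube h)} (h₁ : IsWeakDeriv (tube h) (1, 0) u v₁)
    (h₂ : IsWeakDeriv (tube h) (0, 1) u v₂) :
    ∀ᵐ x ∂volume.restrict (tube h : Set (ℝ × ℝ)),
      diracOp h m u x 0 = -Complex.I * v₁ x 1 - v₂ x 1 + m * (u : L2 (tube h)) x 0 ∧
      diracOp h m u x 1 = -Complex.I * v₁ x 0 + v₂ x 0 - m * (u : L2 (tube h)) x 1 := by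
  set u' : H1 (tube h) := ⟨u, u.2.1⟩ with hu'
  have e₁ : pd₁ (tube h) u' = v₁ := (isWeakDeriv_pd₁ u').unique h₁
  have e₂ : pd₂ (tube h) u' = v₂ := (isWeakDeriv_pd₂ u').unique h₂
  have e : diracOp h m u = matOp (tube h) (-Complex.I • σ₁) (pd₁ (tube h) u') +
      matOp (tube h) (-Complex.I • σ₂) (pd₂ (tube h) u') +
      (m : ℂ) • matOp (tube h) σ₃ (u : L2 (tube h)) := rfl
  rw [e, e₁, e₂]
  filter_upwards [Lp.coeFn_add (matOp (tube h) (-Complex.I • σ₁) v₁ +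
      matOp (tube h) (-Complex.I • σ₂) v₂) ((m : ℂ) • matOp (tube h) σ₃ (u : L2 (tube h))),
    Lp.coeFn_add (matOp (tube h) (-Complex.I • σ₁) v₁) (matOp (tube h) (-Complex.I • σ₂) v₂),
    Lp.coeFn_smul (m : ℂ) (matOp (tube h) σ₃ (u : L2 (tube h))),
    matOp_apply (-Complex.I • σ₁) v₁, matOp_apply (-Complex.I • σ₂) v₂,
    matOp_apply σ₃ (u : L2 (tube h))] with x a1 a2 a3 b1 b2 b3
  rw [a1, Pi.add_apply, a2, Pi.add_apply, a3, Pi.smul_apply]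
  simp only [PiLp.add_apply, PiLp.smul_apply, b1, b2, b3]
  constructor
  · simp [σ₁, σ₂, σ₃]
    ring
  · simp [σ₁, σ₂, σ₃]
    ring

/-- The straightened operator in terms of components. -/
theorem straightOp_apply {γ : ℝ → ℝ × ℝ} {ε : ℝ} (h : IsWaveguide γ ε) (m : ℝ)
    (u : (straightOp h m).domain) {q₁ q₂ : L2 strip} (h₁ : IsWeakDeriv strip (1, 0) u q₁)
    (h₂ : IsWeakDeriv strip (0, 1) u q₂) :
    ∀ᵐ p ∂volume.restrict (strip : Set (ℝ × ℝ)),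
      straightOp h m u p 0 = coeffA γ ε p * (-Complex.I * q₁ p 1) - (ε : ℂ)⁻¹ * q₂ p 1 +
        coeffB γ ε p * (-Complex.I * (u : L2 strip) p 1) + m * (u : L2 strip) p 0 ∧
      straightOp h m u p 1 = coeffA γ ε p * (-Complex.I * q₁ p 0) + (ε : ℂ)⁻¹ * q₂ p 0 +
        coeffB γ ε p * (-Complex.I * (u : L2 strip) p 0) - m * (u : L2 strip) p 1 := by
  set u' : H1 strip := ⟨u, u.2.1⟩ with hu'
  have e₁ : pd₁ strip u' = q₁ := (isWeakDeriv_pd₁ u').unique h₁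
  have e₂ : pd₂ strip u' = q₂ := (isWeakDeriv_pd₂ u').unique h₂
  have e : straightOp h m u =
      mulOp (coeffA γ ε) (memLp_coeffA h) (matOp strip (-Complex.I • σ₁) (pd₁ strip u')) +
      ((1 / ε : ℝ) : ℂ) • matOp strip (-Complex.I • σ₂) (pd₂ strip u') +
      mulOp (coeffB γ ε) (memLp_coeffB h) (matOp strip (-Complex.I • σ₁) (u : L2 strip)) +
      (m : ℂ) • matOp strip σ₃ (u : L2 strip) := rfl
  rw [e, e₁, e₂]
  set A := mulOp (coeffA γ ε) (memLp_coeffA h) (matOp strip (-Complex.I • σ₁) q₁)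
  set B := ((1 / ε : ℝ) : ℂ) • matOp strip (-Complex.I • σ₂) q₂
  set C := mulOp (coeffB γ ε) (memLp_coeffB h) (matOp strip (-Complex.I • σ₁) (u : L2 strip))
  filter_upwards [Lp.coeFn_add (A + B + C) ((m : ℂ) • matOp strip σ₃ (u : L2 strip)),
    Lp.coeFn_add (A + B) C, Lp.coeFn_add A B,
    Lp.coeFn_smul (m : ℂ) (matOp strip σ₃ (u : L2 strip)),
    Lp.coeFn_smul ((1 / ε : ℝ) : ℂ) (matOp strip (-Complex.I • σ₂) q₂),
    matOp_apply (-Complex.I • σ₁) q₁, matOp_apply (-Complex.I • σ₂) q₂,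
    matOp_apply σ₃ (u : L2 strip), matOp_apply (-Complex.I • σ₁) (u : L2 strip),
    mulOp_apply (memLp_coeffA h) (matOp strip (-Complex.I • σ₁) q₁),
    mulOp_apply (memLp_coeffB h) (matOp strip (-Complex.I • σ₁) (u : L2 strip))]
    with p a1 a2 a3 a4 a5 b1 b2 b3 b4 c1 c2
  rw [a1, Pi.add_apply, a2, Pi.add_apply, a3, Pi.add_apply, a4, Pi.smul_apply, a5, Pi.smul_apply]
  simp only [PiLp.add_apply, PiLp.smul_apply, c1, c2, b1, b2, b3, b4, A, C]
  constructor
  · simp [σ₁, σ₂, σ₃]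
    ring
  · simp [σ₁, σ₂, σ₃]
    ring

/-! ### Equality of domains and of the conjugated operators -/

namespace IsWaveguide

variable {γ : ℝ → ℝ × ℝ} {ε : ℝ} {θ : ℝ → ℝ}

theorem straighten_mem_H1_iff (h : IsWaveguide γ ε) (hθ : Continuous θ)
    (hd : ∀ s, HasDerivAt θ (curvature γ s) s) (u : L2 (tube h)) :
    u ∈ H1 (tube h) ↔ h.straighten hθ u ∈ H1 strip := by
  rw [mem_H1_iff, mem_H1_iff]
  constructor
  · rintro ⟨⟨v₁, h₁⟩, v₂, h₂⟩
    obtain ⟨q₁, q₂, k₁, k₂, -⟩ := h.exists_isWeakDeriv_straighten hθ hd h₁ h₂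
    exact ⟨⟨q₁, k₁⟩, q₂, k₂⟩
  · rintro ⟨⟨q₁, h₁⟩, q₂, h₂⟩
    exact ⟨h.exists_isWeakDeriv_of_straighten hθ hd h₁ h₂ _,
      h.exists_isWeakDeriv_of_straighten hθ hd h₁ h₂ _⟩

theorem straighten_mem_stripDomain_iff (h : IsWaveguide γ ε) (hθ : Continuous θ)
    (hd : ∀ s, HasDerivAt θ (curvature γ s) s)
    (hn : ∀ s, ((normal γ s).1 : ℂ) + Complex.I * ((normal γ s).2 : ℂ) =
      Complex.exp (Complex.I * (θ s : ℂ))) (u : L2 (tube h)) :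
    u ∈ diracDomain h ↔ h.straighten hθ u ∈ stripDomain := by
  refine and_congr (h.straighten_mem_H1_iff hθ hd u) (forall₂_congr fun τ hτ => ?_)
  have hτ1 : |τ| = 1 := by
    rcases hτ with rfl | rfl <;> simp
  constructor
  · rintro ⟨g, hg, hb⟩
    obtain ⟨g', hg', hgg⟩ := h.hasTrace_straighten hθ hτ1 hg
    refine ⟨g', hg', ?_⟩
    filter_upwards [hb, hgg] with s hbs hs
    exact (h.boundary_condition_iff hτ1 (hn s) hs).1 hbs
  · rintro ⟨g', hg', hb⟩
    obtain ⟨g, hg, hgg⟩ := h.hasTrace_of_straighten hθ hτ1 hg'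
    refine ⟨g, hg, ?_⟩
    filter_upwards [hb, hgg] with s hbs hs
    exact (h.boundary_condition_iff hτ1 (hn s) hs).2 hbs

/-- The `coeffB` part of `logDerivS` cancels against the explicit `coeffB` term of the operator. Its
phase part ±iκ/2, acted on by J⁻¹(-iσ₁), cancels against `logDerivT` acted on by ε⁻¹(-iσ₂). What
remains is the original operator, rotated by the gauge. -/
theorem straightOp_straighten (h : IsWaveguide γ ε) (hθ : Continuous θ)
    (hd : ∀ s, HasDerivAt θ (curvature γ s) s)
    (hn : ∀ s, ((normal γ s).1 : ℂ) + Complex.I * ((normal γ s).2 : ℂ) =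
      Complex.exp (Complex.I * (θ s : ℂ))) (m : ℝ) (u : (diracOp h m).domain)
    (v : (straightOp h m).domain) (hv : (v : L2 strip) = h.straighten hθ u) :
    straightOp h m v = h.straighten hθ (diracOp h m u) := by
  obtain ⟨⟨v₁, h₁⟩, v₂, h₂⟩ := mem_H1_iff.1 u.2.1
  obtain ⟨q₁, q₂, k₁, k₂, hq⟩ := h.exists_isWeakDeriv_straighten hθ hd h₁ h₂
  rw [← hv] at k₁ k₂
  have hD := h.quasiMeasurePreserving_tubeMap.ae (diracOp_apply h m u h₁ h₂)
  refine Lp.ext ?_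
  filter_upwards [straightOp_apply h m v k₁ k₂, hD, hq, h.straighten_apply hθ (diracOp h m u),
    h.straighten_apply hθ (u : L2 (tube h)), h.straighten_apply hθ v₁, h.straighten_apply hθ v₂,
    ae_restrict_mem strip.isOpen.measurableSet] with p hE hDp hqp hW hU hV₁ hV₂ hp
  have hJ : (jac γ ε p : ℂ) ≠ 0 := Complex.ofReal_ne_zero.2 (h.jac_pos hp).ne'
  have hε : (ε : ℂ) ≠ 0 := Complex.ofReal_ne_zero.2 h.eps_pos.ne'
  have hu : (((deriv γ p.1).1 : ℂ)) ^ 2 + ((deriv γ p.1).2 : ℂ) ^ 2 = 1 := by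
    exact_mod_cast h.unit_speed p.1
  have hI := Complex.I_sq
  have h0 : tubeFactor γ ε θ 0 p = ((deriv γ p.1).1 + Complex.I * (deriv γ p.1).2) *
      tubeFactor γ ε θ 1 p := by
    rw [tubeFactor, tubeFactor, gaugeCoeff_zero_eq (x := (deriv γ p.1).1) (y := (deriv γ p.1).2)
      (by rw [← hn]; simp [normal])]
    ring
  ext i
  fin_cases i
  · change straightOp h m v p 0 = h.straighten hθ (diracOp h m u) p 0
    rw [hE.1, hW 0, hDp.1, (hqp 1).1, (hqp 1).2, hv, hU 0, hU 1, hV₁ 1, hV₂ 1, logDerivS,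
      logDerivT, coeffA_eq, h0]
    simp only [gaugeSign, one_ne_zero, if_false]
    set T := tubeFactor γ ε θ 1 p
    set a₁ := v₁ (tubeMap γ ε p) 1
    set a₂ := v₂ (tubeMap γ ε p) 1
    set w := (u : L2 (tube h)) (tubeMap γ ε p) 1
    linear_combination ((deriv γ p.1).2 * T * a₁ +
        curvature γ p.1 * (jac γ ε p : ℂ)⁻¹ / 2 * T * w) * hI -
      Complex.I * ((deriv γ p.1).1 * T * a₁ + (deriv γ p.1).2 * T * a₂ - coeffB γ ε p * T * w) *
        mul_inv_cancel₀ hJ -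
      (-(deriv γ p.1).2 * T * a₁ + (deriv γ p.1).1 * T * a₂ -
        curvature γ p.1 * (jac γ ε p : ℂ)⁻¹ / 2 * T * w) * mul_inv_cancel₀ hε
  · change straightOp h m v p 1 = h.straighten hθ (diracOp h m u) p 1
    rw [hE.2, hW 1, hDp.2, (hqp 0).1, (hqp 0).2, hv, hU 0, hU 1, hV₁ 0, hV₂ 0, logDerivS,
      logDerivT, coeffA_eq, h0]
    simp only [gaugeSign, if_true]
    set T := tubeFactor γ ε θ 1 p
    set a₁ := v₁ (tubeMap γ ε p) 0
    set a₂ := v₂ (tubeMap γ ε p) 0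
    set w := (u : L2 (tube h)) (tubeMap γ ε p) 0
    set c := ((deriv γ p.1).1 : ℂ)
    set d := ((deriv γ p.1).2 : ℂ)
    set V := (c + Complex.I * d) * T
    -- Unlike in the upper component, the quotient c + id of the gauge entries now sits on the
    -- differentiated side; it is removed by (c + id)(c - id) = 1, which is where unit speed is
    -- used.
    linear_combination (-Complex.I * T * a₁ + T * a₂) * hu + (-(c * d * T * a₁) -
        d ^ 2 * T * a₂ - curvature γ p.1 * (jac γ ε p : ℂ)⁻¹ / 2 * V * w) * hI -
      Complex.I * (c * V * a₁ + d * V * a₂ - coeffB γ ε p * V * w) * mul_inv_cancel₀ hJ +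
      (-d * V * a₁ + c * V * a₂ - curvature γ p.1 * (jac γ ε p : ℂ)⁻¹ / 2 * V * w) *
        mul_inv_cancel₀ hε

end IsWaveguide

end DiracWaveguide

end

theorem proposition2 (γ : ℝ → ℝ × ℝ) (ε m : ℝ) (h : IsWaveguide γ ε) (hm : 0 ≤ m) :
    ∃ (θ : ℝ → ℝ) (W : L2 (tube h) ≃ₗᵢ[ℂ] L2 strip),
      (∀ s, HasDerivAt θ (curvature γ s) s) ∧
      (∀ s, ((normal γ s).1 : ℂ) + Complex.I * ((normal γ s).2 : ℂ) =
        Complex.exp (Complex.I * (θ s : ℂ))) ∧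
      (∀ u : L2 (tube h), W u =ᵐ[volume.restrict (strip : Set (ℝ × ℝ))]
        fun p => (Real.sqrt (weight γ ε p) : ℂ) • act (gaugeMatrix (θ p.1)) (u (tubeMap γ ε p))) ∧
      Conjugates W (diracOp h m) (straightOp h m) := by
  obtain ⟨θ, hd, hn⟩ := h.exists_angle
  have hθ : Continuous θ := continuous_iff_continuousAt.2 fun s => (hd s).continuousAt
  exact ⟨θ, h.straighten hθ, hd, hn, h.straighten_coeFn hθ,
    h.straighten_mem_stripDomain_iff hθ hd hn, h.straightOp_straighten hθ hd hn m⟩
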